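/- Let $M$ be a compact connected topological manifold, possibly with boundary, with a compatible metric, let $\varphi$ be a continuous flow on $M$ (defined for all times), fix $T>0$, and let $\alpha\in H^1(M,\mathbb{R})$. **Pseudo-orbits.** Let $N$ be $M$ or a covering of $M$, with the lifted flow $\psi$ and a metric. An $(\epsilon,T)$-pseudo-orbit of length $l>0$ in $N$ is a right-continuous curve $\gamma\colon[0,l)\to N$ that is continuous outside a finite set $\Delta\subset[0,l)$ disjoint from $[0,T)$, whose points are pairwise at distance at least $T$, such that $\gamma(s)=\psi_{s-t}(\gamma(t))$ whenever $\gamma$ is continuous on $[t,s]$, and such that for every $u\in\Delta$ the left limit $\gamma(u^-)$ exists and is at distance less than $\epsilon$ from $\gamma(u)$. A periodic $(\epsilon,T)$-pseudo-orbit of length $l>0$ is a map $\gamma\colon\mathbb{R}/l\mathbb{Z}\to M$ with the same properties for the flow $\varphi$, where instead of the conditions on $\Delta\subset[0,l)$ one asks that the lift to $\mathbb{R}$ of the finite set $\Delta\subset\mathbb{R}/l\mathbb{Z}$ has points pairwise at distance at least $T$. An $\epsilon$-realization of it is a closed curve obtained by inserting, at each discontinuity time $u$, a curve from $\gamma(u^-)$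 to $\gamma(u)$ inside the $\epsilon$-ball centered at $\gamma(u)$. For small $\epsilon$ all $\epsilon$-realizations of $\gamma$ have the same homology class, denoted by $[\gamma]\in H_1(M,\mathbb{R})$. **Asymptotic pseudo-directions.** Let $D_{\varphi,\epsilon,T}\subset H_1(M,\mathbb{R})$ be the closure of the set of all $\frac{1}{\mathrm{len}(\gamma)}[\gamma]$, for $\gamma$ a periodic $(\epsilon,T)$-pseudo-orbit, and $D_\varphi=\bigcap_{\epsilon>0}D_{\varphi,\epsilon,T}$ (only small $\epsilon$ matter). **$\alpha$-recurrence.** Let $\mathrm{Rec}_\alpha$ be the set of $x\in M$ such that for all small $\epsilon>0$ and all $T'>0$ there is a periodic $(\epsilon,T')$-pseudo-orbit $\gamma$ through $x$ with $\alpha([\gamma])=0$. **Quasi-Lyapunov classes.** Let $\pi_\alpha\colon\widehat M_\alpha\to M$ be the Abelian covering associated to $\alpha$, that is, the quotient of the universal covering of $M$ by the kernel of $\pi_1(M)\to H_1(M,\mathbb{Z})\xrightarrow{\alpha}\mathbb{R}$, on which $H_1(M,\mathbb{Z})$ acts by deck transformations. Equip it with the lifted flow and with any compatible metric that is invariant under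 deck transformations and for which $\pi_\alpha$ is isometric on every ball of some fixed radius $r>0$. A map $f\colon\widehat M_\alpha\to\mathbb{R}$ is $\alpha$-equivariant if $f(\delta\cdot x)=\alpha(\delta)+f(x)$ for all $x\in\widehat M_\alpha$ and all $\delta\in H_1(M,\mathbb{Z})$. The class $\alpha$ is quasi-Lyapunov if for every continuous $\alpha$-equivariant map $f\colon\widehat M_\alpha\to\mathbb{R}$ there are $C\ge0$ and $\epsilon>0$ such that $f(\gamma(0))\ge f(\gamma(t))-C$ for every $(\epsilon,T)$-pseudo-orbit $\gamma$ in $\widehat M_\alpha$ and every $t\in[0,\mathrm{len}(\gamma))$. **Proposition.** We have $\alpha(v)<0$ for all $v\in D_\varphi$ if and only if $\alpha$ is quasi-Lyapunov and $\mathrm{Rec}_\alpha$ is empty. -/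

import Mathlib

open CategoryTheory AlgebraicTopology Set Filter Topology

universe u

noncomputable section

namespace AsympDir

/-! ### Singular homology in degree one -/

/-- The singular chain complex of `M` with real coefficients. -/
abbrev singChains (M : Type u) [TopologicalSpace M] : ChainComplex (ModuleCat.{u} ℝ) ℕ :=
  ((singularChainComplexFunctor (ModuleCat.{u} ℝ)).obj (ModuleCat.of ℝ (ULift.{u} ℝ))).obj
    (TopCat.of M)

/-- The first singular homology `H₁(M; ℝ)`; it is by definition the value at `M` of the functor
`singularHomologyFunctor` in degree `1` with real coefficients. -/
abbrev H1 (M : Type u) [TopologicalSpace M] : ModuleCat.{u} ℝ := (singChains M).homology 1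

/-- The first cohomology `H¹(M; ℝ)`, identified with the dual of `H₁(M; ℝ)` by the pairing of a
class with a cycle (universal coefficients over a field). -/
abbrev CohomH1 (M : Type u) [TopologicalSpace M] : Type u := Module.Dual ℝ (H1 M)

variable {M : Type u}

/-- The singular `1`-simplex given by a curve `c : [0,1] → M`; vertex `0` goes to `c 0` and
vertex `1` to `c 1`. -/
def pathSimplex [TopologicalSpace M] (c : C(unitInterval, M)) :
    (TopCat.toSSet.obj (TopCat.of M)).obj (Opposite.op (SimplexCategory.mk 1)) :=
  (TopCat.toSSetObjEquiv (TopCat.of M) (Opposite.op (SimplexCategory.mk 1))).symm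
    (c.comp (stdSimplexHomeomorphUnitInterval : C(stdSimplex ℝ (Fin 2), unitInterval)))

/-- A curve `c : [0,1] → M`, seen as a singular `1`-chain with coefficient `1`. -/
def pathChain [TopologicalSpace M] (c : C(unitInterval, M)) : (singChains M).X 1 :=
  (SSet.ιChainComplex (TopCat.toSSet.obj (TopCat.of M)) (R := ModuleCat.of ℝ (ULift.{u} ℝ))
    (pathSimplex c)).hom (ULift.up 1)

/-- The singular `1`-chain `z` is a cycle, and `h` is its homology class. -/
def IsHomologyClass [TopologicalSpace M] (z : (singChains M).X 1) (h : H1 M) : Prop :=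
  ∃ w : (singChains M).cycles 1,
    ((singChains M).iCycles 1).hom w = z ∧ ((singChains M).homologyπ 1).hom w = h

/-! ### Manifolds -/

/-- A (finite-dimensional) topological manifold, possibly with boundary.  The first case covers
empty boundary, in every dimension (also `0`). -/
def IsTopManifold (M : Type u) [TopologicalSpace M] : Prop :=
  (∃ n : ℕ, Nonempty (ChartedSpace (EuclideanSpace ℝ (Fin n)) M)) ∨
    ∃ (n : ℕ) (_ : NeZero n), Nonempty (ChartedSpace (EuclideanHalfSpace n) M)

/-! ### Pseudo-orbits -/

/-- `γ`, restricted to `[0, l)`, is an `(ε, T)`-pseudo-orbit of length `l` of the flow `ψ`, where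
jumps are measured by the distance function `d`. -/
def IsPseudoOrbit {N : Type u} [TopologicalSpace N] (d : N → N → ℝ) (ψ : ℝ → N → N)
    (ε T l : ℝ) (γ : ℝ → N) : Prop :=
  0 < l ∧
  (∀ t ∈ Ico 0 l, ContinuousWithinAt γ (Ico t l) t) ∧
  ∃ Δ : Set ℝ, Δ.Finite ∧ Δ ⊆ Ico 0 l ∧ Disjoint Δ (Ico 0 T) ∧
    (∀ t ∈ Ico 0 l, t ∉ Δ → ContinuousWithinAt γ (Ico 0 l) t) ∧
    (∀ s ∈ Δ, ∀ t ∈ Δ, s ≠ t → T ≤ |s - t|) ∧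
    (∀ t s, 0 ≤ t → t ≤ s → s < l → ContinuousOn γ (Icc t s) → γ s = ψ (s - t) (γ t)) ∧
    (∀ t ∈ Δ, ∃ y, Tendsto γ (𝓝[<] t) (𝓝 y) ∧ d (γ t) y < ε)

/-- `γ` is the lift to `ℝ` of a periodic `(ε, T)`-pseudo-orbit `ℝ / lℤ → M` of the flow `φ`.  The
set `Δ` is the lift to `ℝ` of the set of jump times, so that successive jumps around the circle are
distant by at least `T`, also when there is only one jump time in a period. -/
def IsPeriodicPseudoOrbit [MetricSpace M] (φ : Flow ℝ M) (ε T l : ℝ) (γ : ℝ → M) : Prop :=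
  0 < l ∧ Function.Periodic γ l ∧
  (∀ t, ContinuousWithinAt γ (Ici t) t) ∧
  ∃ Δ : Set ℝ, (∀ t, t + l ∈ Δ ↔ t ∈ Δ) ∧ (Δ ∩ Ico 0 l).Finite ∧
    (∀ t, t ∉ Δ → ContinuousAt γ t) ∧
    (∀ s ∈ Δ, ∀ t ∈ Δ, s ≠ t → T ≤ |s - t|) ∧
    (∀ t s, t ≤ s → ContinuousOn γ (Icc t s) → γ s = φ (s - t) (γ t)) ∧
    (∀ t ∈ Δ, ∃ y, Tendsto γ (𝓝[<] t) (𝓝 y) ∧ dist (γ t) y < ε)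

/-- The closed curve `δ` is an `ε`-realization of the `l`-periodic curve `γ`: up to
parametrization by the nondecreasing map `σ`, it follows `γ` once around, and at every discontinuity
time `u` of `γ` a curve that stays in the `ε`-ball centered at `γ u` is inserted.  (Continuity of
`δ` forces the inserted curve to go from the left limit of `γ` at `u` to `γ u`; if `0` is a
discontinuity time, the curve inserted there may be cut into a first and a last part of `δ`.) -/
def IsRealization [MetricSpace M] (ε l : ℝ) (γ : ℝ → M) (δ : C(unitInterval, M)) : Prop :=
  δ 0 = δ 1 ∧ ∃ σ : unitInterval → ℝ, Continuous σ ∧ Monotone σ ∧ σ 0 = 0 ∧ σ 1 = l ∧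
    ∀ s, (ContinuousAt γ (σ s) → δ s = γ (σ s)) ∧
      (¬ ContinuousAt γ (σ s) → δ s ∈ Metric.ball (γ (σ s)) ε)

/-- `h` is the homology class of an `ε`-realization of the `l`-periodic curve `γ`.  For small `ε`
this determines `h`, the class `[γ]`. -/
def IsClassOf [MetricSpace M] (ε l : ℝ) (γ : ℝ → M) (h : H1 M) : Prop :=
  ∃ δ : C(unitInterval, M), IsRealization ε l γ δ ∧ IsHomologyClass (pathChain δ) h

/-! ### Asymptotic pseudo-directions and the `α`-recurrent set -/

/-- The closure of the set of all `[γ] / len γ`, for `γ` a periodic `(ε, T)`-pseudo-orbit.  The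
closure is taken for the canonical topology of the finite-dimensional real vector space `H₁(M; ℝ)`.
-/
def pseudoDirections [MetricSpace M] (φ : Flow ℝ M) (ε T : ℝ) : Set (H1 M) :=
  @closure (H1 M) (moduleTopology ℝ (H1 M))
    {v | ∃ (l : ℝ) (γ : ℝ → M) (h : H1 M),
      IsPeriodicPseudoOrbit φ ε T l γ ∧ IsClassOf ε l γ h ∧ v = l⁻¹ • h}

/-- The set `D_φ` of asymptotic pseudo-directions.  The sets in the intersection decrease with `ε`,
so only small `ε` matter. -/
def asympPseudoDirections [MetricSpace M] (φ : Flow ℝ M) (T : ℝ) : Set (H1 M) :=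
  ⋂ (ε : ℝ) (_ : 0 < ε), pseudoDirections φ ε T

/-- The `α`-recurrent set.  The condition gets stronger as `ε` decreases, so only small `ε` matter.
-/
def alphaRecurrentSet [MetricSpace M] (φ : Flow ℝ M) (α : CohomH1 M) : Set M :=
  {x | ∀ ε > 0, ∀ T > 0, ∃ (l : ℝ) (γ : ℝ → M) (h : H1 M),
    IsPeriodicPseudoOrbit φ ε T l γ ∧ (∃ t, γ t = x) ∧ IsClassOf ε l γ h ∧ α h = 0}

/-! ### The Abelian covering associated to `α` -/

/-- Curves starting at `x₀`, with the compact-open topology. -/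
abbrev PathsFrom [TopologicalSpace M] (x₀ : M) : Type u := {c : C(unitInterval, M) // c 0 = x₀}

/-- Two curves starting at `x₀` are identified when they have the same endpoint and `α` vanishes
on the closed curve that they form.  This is the quotient of the universal covering (curves up to
homotopy with fixed ends) by the kernel of `π₁(M) → H₁(M; ℤ) → ℝ`, the second map being `α`. -/
def coverSetoid [TopologicalSpace M] (α : CohomH1 M) (x₀ : M) : Setoid (PathsFrom x₀) where
  r c c' := c.1 1 = c'.1 1 ∧
    ∃ h : H1 M, IsHomologyClass (pathChain c'.1 - pathChain c.1) h ∧ α h = 0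
  iseqv :=
    { refl := fun c => ⟨rfl, 0, ⟨0, by simp, by simp⟩, by simp⟩
      symm := by
        rintro c c' ⟨he, h, ⟨w, hw, hh⟩, ha⟩
        exact ⟨he.symm, -h, ⟨-w, by simp [hw], by simp [hh]⟩, by simp [ha]⟩
      trans := by
        rintro c c' c'' ⟨he, h, ⟨w, hw, hh⟩, ha⟩ ⟨he', h', ⟨w', hw', hh'⟩, ha'⟩
        exact ⟨he.trans he', h + h', ⟨w + w', by simp [hw, hw'], by simp [hh, hh']⟩,
          by simp [ha, ha']⟩ }

/-- The covering `M̂_α` of `M` associated to `α`, with the quotient topology. -/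
def Cover [TopologicalSpace M] (α : CohomH1 M) (x₀ : M) : Type u := Quotient (coverSetoid α x₀)

instance [TopologicalSpace M] (α : CohomH1 M) (x₀ : M) : TopologicalSpace (Cover α x₀) :=
  inferInstanceAs (TopologicalSpace (Quotient (coverSetoid α x₀)))

/-- The point of `M̂_α` given by a curve starting at `x₀`. -/
def Cover.mk [TopologicalSpace M] (α : CohomH1 M) {x₀ : M} (c : PathsFrom x₀) : Cover α x₀ :=
  Quotient.mk (coverSetoid α x₀) c

/-- The covering map `M̂_α → M`. -/
def Cover.proj [TopologicalSpace M] {α : CohomH1 M} {x₀ : M} : Cover α x₀ → M :=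
  Quotient.lift (fun c => c.1 1) fun _ _ h => h.1

/-- `y = h • x` for the action of the deck transformations on `M̂_α`, where `h` is (the real image
of) a class in `H₁(M; ℤ)`: if `x` is given by the curve `c`, then `h • x` is given by a curve `c'`
with the same endpoint such that `c' - c` is a cycle in the class `h`.  (If `h` is the class of a
loop `ℓ` based at `x₀`, one such `c'` is `ℓ` followed by `c`.) -/
def Cover.IsTranslate [TopologicalSpace M] {α : CohomH1 M} {x₀ : M} (h : H1 M)
    (x y : Cover α x₀) : Prop :=
  ∃ c c' : PathsFrom x₀, Cover.mk α c = x ∧ Cover.mk α c' = y ∧ c.1 1 = c'.1 1 ∧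
    IsHomologyClass (pathChain c'.1 - pathChain c.1) h

/-- The map `f : M̂_α → ℝ` is `α`-equivariant. -/
def IsEquivariant [TopologicalSpace M] {α : CohomH1 M} {x₀ : M} (f : Cover α x₀ → ℝ) : Prop :=
  ∀ (h : H1 M) (x y : Cover α x₀), Cover.IsTranslate h x y → f y = α h + f x

/-- The curve `s ↦ φ_{st}(c(s))`, from `x₀` to `φ_t(c(1))`.  It is homotopic with fixed ends to `c`
followed by the orbit arc from `c(1)` to `φ_t(c(1))`. -/
def flowPath [TopologicalSpace M] (φ : Flow ℝ M) {x₀ : M} (t : ℝ) (c : PathsFrom x₀) :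
    PathsFrom x₀ :=
  ⟨⟨fun s => φ ((s : ℝ) * t) (c.1 s),
      φ.continuous (continuous_subtype_val.mul continuous_const) c.1.continuous⟩,
    by simp [c.2]⟩

/-- The lift of the flow `φ` to `M̂_α`.  (The result does not depend on the curve that is chosen to
represent `x`.) -/
def liftFlow [TopologicalSpace M] (φ : Flow ℝ M) {α : CohomH1 M} {x₀ : M} (t : ℝ)
    (x : Cover α x₀) : Cover α x₀ :=
  Cover.mk α (flowPath φ t (Quotient.out x))

/-- `d` is a lift to `M̂_α` of the metric of `M`: it is compatible with the topology, invariant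
under deck transformations, and the covering map is isometric on all balls of some fixed radius. -/
structure IsLiftedMetric [MetricSpace M] {α : CohomH1 M} {x₀ : M}
    (d : MetricSpace (Cover α x₀)) : Prop where
  compatible : d.toPseudoMetricSpace.toUniformSpace.toTopologicalSpace =
    (inferInstance : TopologicalSpace (Cover α x₀))
  invariant : ∀ (h : H1 M) (x x' y y' : Cover α x₀),
    Cover.IsTranslate h x x' → Cover.IsTranslate h y y' → d.dist x' y' = d.dist x y
  isometric : ∃ r > 0, ∀ z x y : Cover α x₀, d.dist z x < r → d.dist z y < r →
    d.dist x y = dist x.proj y.proj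

/-! ### Quasi-Lyapunov classes -/

/-- The map `f : M̂_α → ℝ` is `C`-quasi-Lyapunov. -/
def IsQuasiLyapunovWith [MetricSpace M] (φ : Flow ℝ M) (T : ℝ) {α : CohomH1 M} {x₀ : M}
    (d : MetricSpace (Cover α x₀)) (C : ℝ) (f : Cover α x₀ → ℝ) : Prop :=
  ∃ ε > 0, ∀ (l : ℝ) (γ : ℝ → Cover α x₀),
    IsPseudoOrbit d.dist (liftFlow φ) ε T l γ → ∀ t ∈ Ico 0 l, f (γ t) - C ≤ f (γ 0)

/-- The class `α` is quasi-Lyapunov: every continuous `α`-equivariant map `M̂_α → ℝ` is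
`C`-quasi-Lyapunov for some `C ≥ 0`. -/
def IsQuasiLyapunov [MetricSpace M] (φ : Flow ℝ M) (T : ℝ) (α : CohomH1 M) (x₀ : M)
    (d : MetricSpace (Cover α x₀)) : Prop :=
  ∀ f : Cover α x₀ → ℝ, Continuous f → IsEquivariant f →
    ∃ C ≥ 0, IsQuasiLyapunovWith φ T d C f

end AsympDir

end

noncomputable section

namespace AsympDir

/-! Everything is reduced to one combinatorial object. The class `α` extends to an additive,
homotopy-invariant functional on all curves, a path cocycle. A point of the covering is determined
by its projection and its height, the value of this cocycle on a representing curve. In these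
coordinates the lifted flow is a skew product on `M × ℝ`. A small jump becomes the relation `Near`:
a short curve joins the base points and the height changes by the cocycle along it. Pseudo-orbits,
in `M` or in the covering, become chains of flow arcs followed by `Near` jumps. The value of `α` on
a periodic pseudo-orbit is the total height gain of a closed chain
(`LocallyContracts.exists_periodicPseudoOrbit`). Conversely, sampling a realization at short regular
times gives a periodic chain (`exists_chain_of_realization`).

Two finiteness facts carry the proof. After subtracting a function `g` of the base point, the height
has only finitely many possible increments over small curves and bounded orbit arcs
(`LocallyContracts.exists_height`). So chains are shadowed by walks in a finite weighted graph whose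
vertices are a net of `M` (`LocallyContracts.exists_drift`). If short closed walks have weight at
most `-s`, every walk has weight at most a constant minus `s` times its length over the number of
vertices (`walk_sum_le`). Short closed walks have finitely many weights, so if all are negative then
some `s > 0` works.

From left to right: the same height with values in `H1 M` shows that normalized classes stay in a
compact set. Hence negativity of `α` on `D_φ` gives negativity on all classes with small jumps.
There is then no recurrent point, closed chains have nonpositive sum, and the walk bound with `s ≥
0` bounds heights above along pseudo-orbits.

From right to left: applying the quasi-Lyapunov property of one continuous equivariant map to a
closed chain run many times shows that its sum is nonpositive. Emptiness of the recurrent set and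
compactness make the sum nonzero once jumps are small and arcs longer than some `L`. The walk bound
with `s > 0` then gives linear decay. It reaches arcs as short as `T` because, for tiny jumps, many
short steps together make one nearly exact arc of length between `L` and `3 * L`. So `α` is at most
some `-c < 0` on normalized classes, hence on their closure. -/

/-- The segment from `p` to `q`. -/
def seg {E : Type*} [AddCommGroup E] [Module ℝ E] [TopologicalSpace E] [IsTopologicalAddGroup E]
    [ContinuousSMul ℝ E] (p q : E) : C(unitInterval, E) :=
  ⟨fun s => p + (s : ℝ) • (q - p), by fun_prop⟩

@[simp] lemma seg_apply {E : Type*} [AddCommGroup E] [Module ℝ E] [TopologicalSpace E]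
    [IsTopologicalAddGroup E] [ContinuousSMul ℝ E] (p q : E) (s : unitInterval) :
    seg p q s = p + (s : ℝ) • (q - p) := rfl

/-! ### Path cocycles and the cocycle of a cohomology class -/

/-- An additive functional on curves, compatible with subdivision and homotopies. -/
structure PathCocycle (M : Type*) (A : Type*) [TopologicalSpace M] [AddCommGroup A] where
  /-- The value on a curve. -/
  toFun : C(unitInterval, M) → A
  -- Triangles in the plane serve two purposes: degenerate ones give additivity under subdivision,
  -- genuine ones give homotopy invariance.
  triangle : ∀ (H : C(ℝ × ℝ, M)) (p q r : ℝ × ℝ),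
    toFun (H.comp (seg p q)) + toFun (H.comp (seg q r)) = toFun (H.comp (seg p r))

instance {M A : Type*} [TopologicalSpace M] [AddCommGroup A] :
    CoeFun (PathCocycle M A) (fun _ => C(unitInterval, M) → A) := ⟨PathCocycle.toFun⟩

variable {M : Type u} [TopologicalSpace M]

/-- Singular one-chains modulo boundaries. -/
abbrev ChainsModB (M : Type u) [TopologicalSpace M] : ModuleCat.{u} ℝ := (singChains M).opcycles 1

/-- The class of a curve modulo boundaries. -/
def pathClass (c : C(unitInterval, M)) : ChainsModB M :=
  ((singChains M).pOpcycles 1).hom (pathChain c)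

/-- Evaluation of a morphism from the coefficients at `1`. -/
def evalOne (Y : ModuleCat.{u} ℝ) : (ModuleCat.of ℝ (ULift.{u} ℝ) ⟶ Y) →+ Y where
  toFun f := f.hom (ULift.up 1)
  map_zero' := rfl
  map_add' _ _ := rfl

lemma d_pathSimplex (x : (TopCat.toSSet.obj (TopCat.of M)).obj
      (Opposite.op (SimplexCategory.mk 1))) :
    ((singChains M).d 1 0).hom (evalOne ((singChains M).X 1) (SSet.ιChainComplex _ x)) =
      evalOne ((singChains M).X 0) (SSet.ιChainComplex _ ((TopCat.toSSet.obj (TopCat.of M)).δ 0 x)) -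
      evalOne ((singChains M).X 0) (SSet.ιChainComplex _ ((TopCat.toSSet.obj (TopCat.of M)).δ 1 x)) := by
  have hd := SSet.ιChainComplex_d (TopCat.toSSet.obj (TopCat.of M))
    (R := ModuleCat.of ℝ (ULift.{u} ℝ)) (n := 0) x
  replace hd := hd.trans (Fin.sum_univ_two _)
  simp only [Fin.val_zero, pow_zero, one_smul, Fin.val_one, pow_one,
    neg_smul, ← sub_eq_add_neg] at hd
  exact (congrArg (evalOne ((singChains M).X 0)) hd).trans
    ((evalOne ((singChains M).X 0)).map_sub _ _)

lemma d_triangleSimplex (x : (TopCat.toSSet.obj (TopCat.of M)).obj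
      (Opposite.op (SimplexCategory.mk 2))) :
    ((singChains M).d 2 1).hom (evalOne ((singChains M).X 2) (SSet.ιChainComplex _ x)) =
      evalOne ((singChains M).X 1) (SSet.ιChainComplex _ ((TopCat.toSSet.obj (TopCat.of M)).δ 0 x)) -
      evalOne ((singChains M).X 1) (SSet.ιChainComplex _ ((TopCat.toSSet.obj (TopCat.of M)).δ 1 x)) +
      evalOne ((singChains M).X 1) (SSet.ιChainComplex _ ((TopCat.toSSet.obj (TopCat.of M)).δ 2 x)) := by
  have hd := SSet.ιChainComplex_d (TopCat.toSSet.obj (TopCat.of M))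
    (R := ModuleCat.of ℝ (ULift.{u} ℝ)) (n := 1) x
  replace hd := hd.trans (Fin.sum_univ_three _)
  simp only [Fin.val_zero, pow_zero, one_smul, Fin.val_one, pow_one,
    neg_smul, Fin.val_two, even_two, Even.neg_pow, one_pow, ← sub_eq_add_neg] at hd
  exact (congrArg (evalOne ((singChains M).X 1)) hd).trans
    (((evalOne ((singChains M).X 1)).map_add _ _).trans
      (congrArg (· + _) ((evalOne ((singChains M).X 1)).map_sub _ _)))

/-- The affine triangle `p q r` followed by `H` is a singular 2-simplex whose faces are the three
curves, and its boundary dies modulo boundaries. -/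
lemma pathClass_triangle (H : C(ℝ × ℝ, M)) (p q r : ℝ × ℝ) :
    pathClass (H.comp (seg p q)) + pathClass (H.comp (seg q r)) =
      pathClass (H.comp (seg p r)) := by
  set S := TopCat.toSSet.obj (TopCat.of M)
  let v : Fin 3 → ℝ × ℝ := ![p, q, r]
  let aff : C(stdSimplex ℝ (Fin 3), ℝ × ℝ) := ⟨fun x => ∑ i, x.1 i • v i,
    continuous_finsetSum _ fun i _ =>
      ((continuous_apply i).comp continuous_subtype_val).smul continuous_const⟩
  let τ : S.obj (Opposite.op (SimplexCategory.mk 2)) :=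
    (TopCat.toSSetObjEquiv (TopCat.of M) (Opposite.op (SimplexCategory.mk 2))).symm (H.comp aff)
  have hf : ∀ i : Fin 3, S.δ i τ = pathSimplex
      (H.comp (seg (v (i.succAbove 0)) (v (i.succAbove 1)))) := by
    intro i
    have : S.δ i τ = (TopCat.toSSetObjEquiv (TopCat.of M)
        (Opposite.op (SimplexCategory.mk 1))).symm ((H.comp aff).comp
          ⟨stdSimplex.map i.succAbove, stdSimplex.continuous_map _⟩) := rfl
    rw [this, pathSimplex]
    congr 1
    ext x
    have hx : x.1 0 = 1 - x.1 1 := by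
      have := x.2.2
      rw [Fin.sum_univ_two] at this
      linarith
    show H _ = H _
    congr 1
    show ∑ j, (stdSimplex.map i.succAbove x).1 j • v j = _ + (x.1 1) • _
    have h2 : ∀ j, (stdSimplex.map i.succAbove x).1 j =
        ∑ k, if i.succAbove k = j then x.1 k else 0 := by
      intro j
      have := congrFun (stdSimplex.map_coe i.succAbove x) j
      refine this.trans ?_
      rw [FunOnFinite.linearMap_apply_apply, Finset.sum_filter]
      rfl
    simp only [h2, Fin.sum_univ_two, add_smul, ite_smul, zero_smul,
      Finset.sum_add_distrib, Finset.sum_ite_eq, Finset.mem_univ, if_true]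
    rw [hx]
    module
  have hz : ((singChains M).pOpcycles 1).hom (((singChains M).d 2 1).hom
      (evalOne ((singChains M).X 2) (SSet.ιChainComplex _ τ))) = 0 :=
    congrArg (fun f => f.hom (evalOne ((singChains M).X 2) (SSet.ιChainComplex _ τ)))
      ((singChains M).d_pOpcycles 2 1)
  rw [d_triangleSimplex, map_add, map_sub, hf, hf, hf] at hz
  have hz' : pathClass (H.comp (seg q r)) - pathClass (H.comp (seg p r)) +
      pathClass (H.comp (seg p q)) = 0 := hz
  rw [← sub_eq_zero, ← hz']
  abel

lemma homologyι_of_isHomologyClass {z : (singChains M).X 1} {h : H1 M} (hz : IsHomologyClass z h) :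
    ((singChains M).homologyι 1).hom h = ((singChains M).pOpcycles 1).hom z := by
  obtain ⟨w, rfl, rfl⟩ := hz
  exact congrArg (fun f => f.hom w) ((singChains M).homology_π_ι 1)

lemma homologyι_injective : Function.Injective ((singChains M).homologyι 1).hom :=
  (ModuleCat.mono_iff_injective _).1 inferInstance

/-- Cycles are given by a universal property, so the chain is first turned into the morphism `r ↦ r
• z` from the coefficients, which lifts to the cycles. -/
lemma exists_isHomologyClass {z : (singChains M).X 1}
    (hz : ((singChains M).d 1 0).hom z = 0) : ∃ h, IsHomologyClass z h := by
  let f : ModuleCat.of ℝ (ULift.{u} ℝ) ⟶ (singChains M).X 1 := ModuleCat.ofHom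
    ((LinearMap.toSpanSingleton ℝ _ z).comp ULift.moduleEquiv.toLinearMap)
  have hfz : ∀ r, f.hom r = r.down • z := fun _ => rfl
  have hf : f ≫ (singChains M).d 1 0 = 0 := by
    ext r
    show ((singChains M).d 1 0).hom (f.hom r) = 0
    rw [hfz, map_smul, hz, smul_zero]
  refine ⟨_, ((singChains M).liftCycles f 0 (by simp) hf).hom (ULift.up 1), ?_, rfl⟩
  refine (congrArg (fun g => g.hom (ULift.up 1))
    ((singChains M).liftCycles_i f (j := 0) (by simp) hf)).trans ?_
  exact (hfz _).trans (one_smul _ _)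

lemma pathSimplex_δ (c : C(unitInterval, M)) (i : Fin 2) :
    (TopCat.toSSet.obj (TopCat.of M)).δ i (pathSimplex c) =
      (TopCat.toSSetObjEquiv (TopCat.of M) (Opposite.op (SimplexCategory.mk 0))).symm
        (ContinuousMap.const _ (c (if i = 0 then 1 else 0))) := by
  have : (TopCat.toSSet.obj (TopCat.of M)).δ i (pathSimplex c) =
      (TopCat.toSSetObjEquiv (TopCat.of M) (Opposite.op (SimplexCategory.mk 0))).symm
        ((c.comp (stdSimplexHomeomorphUnitInterval : C(stdSimplex ℝ (Fin 2), unitInterval))).comp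
          ⟨stdSimplex.map i.succAbove, stdSimplex.continuous_map _⟩) := rfl
  rw [this]
  congr 1
  ext x
  show c _ = c _
  congr 1
  apply Subtype.ext
  show (stdSimplex.map i.succAbove x).1 1 = _
  have h0 : x.1 0 = 1 := by
    have := x.2.2
    rwa [Fin.sum_univ_one] at this
  have h2 := congrFun (stdSimplex.map_coe i.succAbove x) 1
  refine h2.trans ?_
  rw [FunOnFinite.linearMap_apply_apply, Finset.sum_filter]
  fin_cases i
  · exact (Fin.sum_univ_one _).trans ((if_pos (by rfl)).trans h0)
  · exact (Fin.sum_univ_one _).trans (if_neg (by decide))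

/-- The boundary of a curve depends only on its ends. -/
lemma d_pathChain_congr {c c' : C(unitInterval, M)} (h0 : c 0 = c' 0) (h1 : c 1 = c' 1) :
    ((singChains M).d 1 0).hom (pathChain c) = ((singChains M).d 1 0).hom (pathChain c') := by
  refine (d_pathSimplex (pathSimplex c)).trans (Eq.trans ?_ (d_pathSimplex (pathSimplex c')).symm)
  simp only [pathSimplex_δ, h0, h1, if_true, one_ne_zero, if_false]

lemma d_pathChain_of_closed {c : C(unitInterval, M)} (h : c 0 = c 1) :
    ((singChains M).d 1 0).hom (pathChain c) = 0 := by
  refine (d_pathSimplex (pathSimplex c)).trans ?_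
  simp only [pathSimplex_δ, h, if_true, one_ne_zero, if_false, sub_self]

/-- A closed curve has a homology class. -/
lemma exists_isHomologyClass_of_closed {c : C(unitInterval, M)} (h : c 0 = c 1) :
    ∃ k, IsHomologyClass (pathChain c) k :=
  exists_isHomologyClass (d_pathChain_of_closed h)

lemma exists_isHomologyClass_sub {c c' : C(unitInterval, M)} (h0 : c 0 = c' 0) (h1 : c 1 = c' 1) :
    ∃ k, IsHomologyClass (pathChain c' - pathChain c) k := by
  refine exists_isHomologyClass ?_
  rw [map_sub, d_pathChain_congr h0 h1, sub_self]

variable (M) in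
/-- A retraction of one-chains modulo boundaries onto the first homology. -/
lemma exists_retraction :
    ∃ π : ChainsModB M →ₗ[ℝ] H1 M, ∀ h, π (((singChains M).homologyι 1).hom h) = h := by
  obtain ⟨π, hπ⟩ := ((singChains M).homologyι 1).hom.exists_leftInverse_of_injective
    (LinearMap.ker_eq_bot.2 homologyι_injective)
  exact ⟨π, fun h => LinearMap.congr_fun hπ h⟩

variable (M) in
/-- A chosen retraction of one-chains modulo boundaries onto the first homology. -/
def retraction : ChainsModB M →ₗ[ℝ] H1 M := (exists_retraction M).choose

/-- The path cocycle with values in the first homology. -/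
def homCocycle (M : Type u) [TopologicalSpace M] : PathCocycle M (H1 M) where
  -- The retraction gives values to curves that are not closed. On closed curves, and on differences
  -- of curves with common ends, the value is the homology class whatever retraction was chosen.
  toFun c := retraction M (pathClass c)
  triangle H p q r := by rw [← map_add, pathClass_triangle]

lemma retraction_of_isHomologyClass {z : (singChains M).X 1} {h : H1 M}
    (hz : IsHomologyClass z h) : retraction M (((singChains M).pOpcycles 1).hom z) = h := by
  rw [← homologyι_of_isHomologyClass hz]
  exact (exists_retraction M).choose_spec h

lemma homCocycle_eq {c : C(unitInterval, M)} {h : H1 M} (hc : IsHomologyClass (pathChain c) h) :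
    homCocycle M c = h := retraction_of_isHomologyClass hc

lemma homCocycle_sub_eq {c c' : C(unitInterval, M)} {h : H1 M}
    (hc : IsHomologyClass (pathChain c' - pathChain c) h) :
    homCocycle M c' - homCocycle M c = h := by
  rw [← retraction_of_isHomologyClass hc, map_sub, map_sub]
  rfl

/-- The image of a path cocycle under an additive map. -/
def PathCocycle.map {A B : Type*} [AddCommGroup A] [AddCommGroup B] (Θ : PathCocycle M A)
    (f : A →+ B) : PathCocycle M B where
  toFun c := f (Θ c)
  triangle H p q r := by rw [← map_add, Θ.triangle]

/-- The real path cocycle of a cohomology class. -/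
def cohomCocycle (α : CohomH1 M) : PathCocycle M ℝ :=
  (homCocycle M).map (α : H1 M →ₗ[ℝ] ℝ).toAddMonoidHom

/-! ### Calculus of path cocycles: subdivision, homotopy, concatenation -/

namespace PathCocycle

variable {M : Type*} [TopologicalSpace M] {A : Type*} [AddCommGroup A] (Θ : PathCocycle M A)

/-- The value of a path cocycle along the restriction of a curve to `[a, b]`. -/
def along (c : C(ℝ, M)) (a b : ℝ) : A := Θ (c.comp (seg a b))

lemma along_add (c : C(ℝ, M)) (a b d : ℝ) : Θ.along c a b + Θ.along c b d = Θ.along c a d := by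
  have h : ∀ a b : ℝ, c.comp (seg a b) =
      (c.comp ⟨Prod.fst, continuous_fst⟩ : C(ℝ × ℝ, M)).comp (seg (a, 0) (b, 0)) := by
    intro a b
    ext s
    simp
  simp only [along, h]
  exact Θ.triangle _ _ _ _

@[simp] lemma along_self (c : C(ℝ, M)) (a : ℝ) : Θ.along c a a = 0 := by
  simpa using Θ.along_add c a a a

lemma along_congr {c c' : C(ℝ, M)} {a b a' b' : ℝ}
    (h : ∀ s : unitInterval, c (a + s * (b - a)) = c' (a' + s * (b' - a'))) :
    Θ.along c a b = Θ.along c' a' b' := by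
  unfold along
  congr 1
  ext s
  simpa using h s

lemma const (x : M) : Θ (.const _ x) = 0 :=
  Θ.along_self (.const _ x) 0

/-- The extension of a curve by constants. -/
def extend (p : C(unitInterval, M)) : C(ℝ, M) := p.comp ⟨projIcc 0 1 zero_le_one, continuous_projIcc⟩

lemma extend_apply (p : C(unitInterval, M)) (s : unitInterval) : extend p s = p s := by
  simp [extend]

lemma along_extend (p : C(unitInterval, M)) : Θ.along (extend p) 0 1 = Θ p := by
  unfold along
  congr 1
  ext s
  simp [extend]

section Square

variable (G : C(unitInterval × unitInterval, M))

lemma triangle_of_square {c d r : C(unitInterval, M)} (hc : ∀ s, G (s, 0) = c s)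
    (hd : ∀ u, G (1, u) = d u) (hr : ∀ s, G (s, s) = r s) : Θ r = Θ c + Θ d := by
  let H : C(ℝ × ℝ, M) := G.comp ⟨fun z => (projIcc 0 1 zero_le_one z.1, projIcc 0 1 zero_le_one z.2),
    by fun_prop⟩
  have := Θ.triangle H (0, 0) (1, 0) (1, 1)
  have h1 : H.comp (seg (0, 0) (1, 0)) = c := by
    ext s; simp [H, ← hc]
  have h2 : H.comp (seg (1, 0) (1, 1)) = d := by
    ext s; simp [H, ← hd]
  have h3 : H.comp (seg (0, 0) (1, 1)) = r := by
    ext s; simp [H, ← hr]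
  rw [← h1, ← h2, ← h3, this]

/-- The diagonal cuts the square into two triangles, and both boundary routes have its value. -/
lemma square {c₀ c₁ d₀ d₁ : C(unitInterval, M)} (h₀ : ∀ s, G (s, 0) = c₀ s)
    (h₁ : ∀ s, G (s, 1) = c₁ s) (k₀ : ∀ u, G (0, u) = d₀ u) (k₁ : ∀ u, G (1, u) = d₁ u) :
    Θ c₀ + Θ d₁ = Θ d₀ + Θ c₁ := by
  let r : C(unitInterval, M) := G.comp ⟨fun s => (s, s), by fun_prop⟩
  rw [← Θ.triangle_of_square G h₀ k₁ (r := r) (fun _ => rfl),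
    ← Θ.triangle_of_square (G.comp ⟨Prod.swap, continuous_swap⟩) (r := r) k₀ h₁ (fun _ => rfl)]

end Square

/-- The straight-line homotopy from `h` to the affine map with the same ends gives a square with two
constant sides. -/
lemma reparam (c : C(ℝ, M)) (h : C(unitInterval, ℝ)) : Θ (c.comp h) = Θ.along c (h 0) (h 1) := by
  let G : C(unitInterval × unitInterval, M) := c.comp
    ⟨fun z => h z.1 + z.2 * (h 0 + z.1 * (h 1 - h 0) - h z.1), by fun_prop⟩
  have := Θ.square G (c₀ := c.comp h) (c₁ := c.comp (seg (h 0) (h 1))) (d₀ := .const _ (c (h 0)))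
    (d₁ := .const _ (c (h 1))) (by intro s; simp [G]) (by intro s; simp [G]) (by intro s; simp [G])
    (by intro s; simp [G])
  rw [Θ.const, Θ.const, add_zero, zero_add] at this
  exact this

/-- Pull-back of a path cocycle. -/
def comap {N : Type*} [TopologicalSpace N] (f : C(N, M)) : PathCocycle N A where
  toFun c := Θ (f.comp c)
  triangle H p q r := Θ.triangle (f.comp H) p q r

/-- Concatenation of curves. -/
def concat (p q : C(unitInterval, M)) (h : p 1 = q 0) : C(unitInterval, M) :=
  (Path.trans (⟨p, rfl, h⟩ : Path (p 0) (q 0)) (⟨q, rfl, rfl⟩ : Path (q 0) (q 1))).toContinuousMap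

lemma concat_apply (p q : C(unitInterval, M)) (h : p 1 = q 0) (s : unitInterval) :
    concat p q h s = if (s : ℝ) ≤ 1 / 2 then extend p (2 * s) else extend q (2 * s - 1) := by
  refine (Path.trans_apply _ _ s).trans ?_
  split_ifs with hs
  · rw [extend, ContinuousMap.comp_apply]
    simp only [ContinuousMap.coe_mk]
    rw [projIcc_of_mem _ (unitInterval.mul_pos_mem_iff zero_lt_two |>.2 ⟨s.2.1, hs⟩)]
    rfl
  · rw [extend, ContinuousMap.comp_apply]
    simp only [ContinuousMap.coe_mk]
    rw [projIcc_of_mem _ (unitInterval.two_mul_sub_one_mem_iff.2 ⟨(not_le.1 hs).le, s.2.2⟩)]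
    rfl

@[simp] lemma concat_zero (p q : C(unitInterval, M)) (h : p 1 = q 0) : concat p q h 0 = p 0 :=
  Path.source _

@[simp] lemma concat_one (p q : C(unitInterval, M)) (h : p 1 = q 0) : concat p q h 1 = q 1 :=
  Path.target _

lemma concat_forall {p q : C(unitInterval, M)} (h : p 1 = q 0) {P : M → Prop}
    (hp : ∀ s, P (p s)) (hq : ∀ s, P (q s)) (s : unitInterval) : P (concat p q h s) := by
  rw [concat_apply]
  split_ifs
  exacts [hp _, hq _]

lemma extend_concat_left (p q : C(unitInterval, M)) (h : p 1 = q 0) (s : unitInterval) :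
    extend (concat p q h) (s / 2) = p s := by
  have hs : (s : ℝ) / 2 ∈ Icc (0 : ℝ) 1 := ⟨by linarith [s.2.1], by linarith [s.2.2]⟩
  rw [extend_apply (concat p q h) ⟨_, hs⟩, concat_apply, if_pos (by simpa using by linarith [s.2.2]),
    mul_div_cancel₀ _ two_ne_zero, extend_apply]

lemma extend_concat_right (p q : C(unitInterval, M)) (h : p 1 = q 0) (s : unitInterval) :
    extend (concat p q h) ((1 + s) / 2) = q s := by
  have hs : (1 + s : ℝ) / 2 ∈ Icc (0 : ℝ) 1 := ⟨by linarith [s.2.1], by linarith [s.2.2]⟩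
  rw [extend_apply (concat p q h) ⟨_, hs⟩, concat_apply, mul_div_cancel₀ _ two_ne_zero,
    add_sub_cancel_left, extend_apply]
  split_ifs with h2
  · have h0 : s = 0 := le_antisymm (by have : (s : ℝ) ≤ 0 := by linarith
                                       exact_mod_cast this) s.2.1
    subst h0
    have := extend_apply p 1
    simpa [h] using this
  · rfl

lemma concat_eq (p q : C(unitInterval, M)) (h : p 1 = q 0) : Θ (concat p q h) = Θ p + Θ q := by
  rw [← Θ.along_extend, ← Θ.along_add _ 0 (1 / 2) 1, ← Θ.along_extend p, ← Θ.along_extend q]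
  congr 1 <;> refine Θ.along_congr fun s => ?_
  · rw [show (0 : ℝ) + s * (1 / 2 - 0) = s / 2 by ring, extend_concat_left]
    simp [extend_apply]
  · rw [show (1 / 2 : ℝ) + s * (1 - 1 / 2) = (1 + s) / 2 by ring, extend_concat_right]
    simp [extend_apply]

lemma along_sum (c : C(ℝ, M)) (t : ℕ → ℝ) (n : ℕ) :
    Θ.along c (t 0) (t n) = ∑ k ∈ Finset.range n, Θ.along c (t k) (t (k + 1)) := by
  induction n with
  | zero => simp
  | succ n ih => rw [Finset.sum_range_succ, ← ih, Θ.along_add]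

/-- The reversed curve. -/
def rev (p : C(unitInterval, M)) : C(unitInterval, M) := p.comp ⟨unitInterval.symm, by fun_prop⟩

@[simp] lemma rev_zero (p : C(unitInterval, M)) : rev p 0 = p 1 := by simp [rev]

@[simp] lemma rev_one (p : C(unitInterval, M)) : rev p 1 = p 0 := by simp [rev]

lemma rev_eq (p : C(unitInterval, M)) : Θ (rev p) = -Θ p := by
  have h : Θ (rev p) = Θ.along (extend p) 1 0 := by
    unfold along
    congr 1
    ext s
    have : (1 : ℝ) + s * (0 - 1) = (unitInterval.symm s : unitInterval) := by simp; ring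
    show _ = extend p _
    rw [seg_apply, smul_eq_mul, this, extend_apply]
    rfl
  rw [h, ← Θ.along_extend p, eq_neg_iff_add_eq_zero, Θ.along_add, Θ.along_self]

/-! ### The flow and its skew product with the heights -/

section Flow

variable (φ : Flow ℝ M)

/-- The orbit of a point. -/
def orbit (x : M) : C(ℝ, M) := ⟨fun t => φ t x, φ.continuous continuous_id continuous_const⟩

/-- The cocycle over the flow induced by a path cocycle. -/
def onOrbit (t : ℝ) (x : M) : A := Θ.along (orbit φ x) 0 t

lemma onOrbit_add (s t : ℝ) (x : M) :
    Θ.onOrbit φ (s + t) x = Θ.onOrbit φ s x + Θ.onOrbit φ t (φ s x) := by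
  rw [onOrbit, ← Θ.along_add _ 0 s (s + t)]
  congr 1
  refine Θ.along_congr fun u => ?_
  show φ _ x = φ _ (φ _ x)
  rw [← Flow.map_add]
  congr 1
  ring

lemma along_orbit (a b : ℝ) (x : M) :
    Θ.along (orbit φ x) a b = Θ.onOrbit φ (b - a) (φ a x) := by
  refine Θ.along_congr fun u => ?_
  show φ _ x = φ _ (φ _ x)
  rw [← Flow.map_add]
  congr 1
  ring

/-- The image of a curve under the flow at time `t`. -/
def push (t : ℝ) (p : C(unitInterval, M)) : C(unitInterval, M) :=
  ⟨fun s => φ t (p s), φ.continuous continuous_const p.continuous⟩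

/-- The square `(s, u) ↦ φ (u * t) (p s)` has as sides `p`, its image under the flow, and the two
orbit arcs. -/
lemma push_eq (t : ℝ) (p : C(unitInterval, M)) :
    Θ p + Θ.onOrbit φ t (p 1) = Θ.onOrbit φ t (p 0) + Θ (push φ t p) := by
  refine Θ.square ⟨fun z => φ (z.2 * t) (p z.1), φ.continuous (by fun_prop) (by fun_prop)⟩ ?_ ?_ ?_ ?_
  · intro s; simp
  · intro s; simp [push]
  · intro s; simp [orbit]
  · intro s; simp [orbit]

/-- The curve `r` is the diagonal of the square used for `push_eq`. This identifies the height of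
`flowPath`, hence the lifted flow, with the skew product. -/
lemma diag_eq (t : ℝ) (p r : C(unitInterval, M)) (hr : ∀ s, r s = φ (s * t) (p s)) :
    Θ r = Θ p + Θ.onOrbit φ t (p 1) := by
  refine Θ.triangle_of_square
    ⟨fun z => φ (z.2 * t) (p z.1), φ.continuous (by fun_prop) (by fun_prop)⟩ ?_ ?_ ?_
  · intro s; simp
  · intro s; simp [orbit]
  · intro s; simp [hr]

/-- The skew product of the flow with the group of heights. -/
def skew (t : ℝ) (X : M × A) : M × A := (φ t X.1, X.2 + Θ.onOrbit φ t X.1)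

@[simp] lemma skew_fst (t : ℝ) (X : M × A) : (Θ.skew φ t X).1 = φ t X.1 := rfl

lemma skew_snd (t : ℝ) (X : M × A) : (Θ.skew φ t X).2 = X.2 + Θ.onOrbit φ t X.1 := rfl

@[simp] lemma skew_zero (X : M × A) : Θ.skew φ 0 X = X := by
  simp [skew, onOrbit]

lemma skew_add (s t : ℝ) (X : M × A) : Θ.skew φ (s + t) X = Θ.skew φ t (Θ.skew φ s X) := by
  ext
  · simp [skew, add_comm s t, Flow.map_add]
  · simp [skew, onOrbit_add, add_assoc]

/-- Translation of the height. -/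
def raise (a : A) (X : M × A) : M × A := (X.1, X.2 + a)

@[simp] lemma raise_fst (a : A) (X : M × A) : (raise a X).1 = X.1 := rfl

@[simp] lemma raise_snd (a : A) (X : M × A) : (raise a X).2 = X.2 + a := rfl

@[simp] lemma raise_zero (X : M × A) : raise 0 X = X := by simp [raise]

lemma raise_raise (a b : A) (X : M × A) : raise b (raise a X) = raise (a + b) X := by
  simp [raise, add_assoc]

lemma skew_raise (t : ℝ) (X : M × A) (a : A) :
    Θ.skew φ t (raise a X) = raise a (Θ.skew φ t X) := by
  simp [raise, skew, add_right_comm]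

end Flow

end PathCocycle

/-! ### Small jumps in `M × A` and their behaviour under the skew flow -/

namespace PathCocycle

variable {M : Type*} [MetricSpace M] {A : Type*} [AddCommGroup A] (Θ : PathCocycle M A)

/-- `Y` is reached from `X` along a curve that stays in the `η`-ball centered at the end. -/
def Near (η : ℝ) (X Y : M × A) : Prop :=
  ∃ p : C(unitInterval, M), p 0 = X.1 ∧ p 1 = Y.1 ∧ (∀ s, dist (p s) Y.1 < η) ∧ Y.2 = X.2 + Θ p

variable {Θ}

lemma Near.dist_lt {η : ℝ} {X Y : M × A} (h : Θ.Near η X Y) : dist X.1 Y.1 < η := by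
  obtain ⟨p, h0, -, h, -⟩ := h
  exact h0 ▸ h 0

lemma Near.mono {η η' : ℝ} {X Y : M × A} (h : Θ.Near η X Y) (hη : η ≤ η') : Θ.Near η' X Y := by
  obtain ⟨p, h0, h1, h, h2⟩ := h
  exact ⟨p, h0, h1, fun s => (h s).trans_le hη, h2⟩

lemma Near.refl {η : ℝ} (hη : 0 < η) (X : M × A) : Θ.Near η X X :=
  ⟨.const _ X.1, rfl, rfl, by simpa, by simp [Θ.const]⟩

lemma Near.trans {η η' : ℝ} {X Y Z : M × A} (h : Θ.Near η X Y) (h' : Θ.Near η' Y Z) :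
    Θ.Near (η + η') X Z := by
  have hη : 0 < η := dist_nonneg.trans_lt h.dist_lt
  have hd := h'.dist_lt
  obtain ⟨p, hp0, hp1, hp, hp2⟩ := h
  obtain ⟨q, hq0, hq1, hq, hq2⟩ := h'
  refine ⟨concat p q (hp1.trans hq0.symm), by simp [hp0], by simp [hq1],
    concat_forall (P := fun z => dist z Z.1 < η + η') _ (fun s => ?_) (fun s => ?_),
    by rw [concat_eq, hq2, hp2, add_assoc]⟩
  · linarith [dist_triangle (p s) Y.1 Z.1, hp s]
  · linarith [hq s]

/-- The factor `2` pays for recentering the ball at the other end of the curve. -/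
lemma Near.symm {η : ℝ} {X Y : M × A} (h : Θ.Near η X Y) : Θ.Near (2 * η) Y X := by
  have hd := h.dist_lt
  obtain ⟨p, hp0, hp1, hp, hp2⟩ := h
  refine ⟨rev p, by simp [hp1], by simp [hp0], fun s => ?_, by rw [rev_eq, hp2]; abel⟩
  have := hp (unitInterval.symm s)
  rw [dist_comm] at hd
  show dist (p (unitInterval.symm s)) X.1 < _
  linarith [dist_triangle (p (unitInterval.symm s)) Y.1 X.1]

lemma Near.raise {η : ℝ} {X Y : M × A} (h : Θ.Near η X Y) (a : A) :
    Θ.Near η (raise a X) (raise a Y) := by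
  obtain ⟨p, hp0, hp1, hp, hp2⟩ := h
  exact ⟨p, hp0, hp1, hp, by simp [hp2, add_right_comm]⟩

lemma exists_unif_flow [CompactSpace M] (φ : Flow ℝ M) {η : ℝ} (hη : 0 < η) (L : ℝ) :
    ∃ δ > 0, ∀ x y, dist x y < δ → ∀ t ∈ Icc 0 L, dist (φ t x) (φ t y) < η := by
  let f : Icc (0 : ℝ) L × M → M := fun z => φ z.1 z.2
  have hf : Continuous f := φ.continuous (by fun_prop) (by fun_prop)
  obtain ⟨δ, hδ, h⟩ := Metric.uniformContinuous_iff.1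
    (CompactSpace.uniformContinuous_of_continuous hf) η hη
  refine ⟨δ, hδ, fun x y hxy t ht => h (a := (⟨t, ht⟩, x)) (b := (⟨t, ht⟩, y)) ?_⟩
  simpa [Prod.dist_eq] using hxy

lemma Near.push {η η' : ℝ} {X Y : M × A} (h : Θ.Near η X Y) (φ : Flow ℝ M) {t : ℝ}
    (ht : ∀ x y, dist x y < η → dist (φ t x) (φ t y) < η') :
    Θ.Near η' (Θ.skew φ t X) (Θ.skew φ t Y) := by
  obtain ⟨p, hp0, hp1, hp, hp2⟩ := h
  refine ⟨PathCocycle.push φ t p, ?_, ?_, fun s => ht _ _ (hp s), ?_⟩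
  · simp [PathCocycle.push, hp0]
  · simp [PathCocycle.push, hp1]
  · have := Θ.push_eq φ t p
    rw [hp0, hp1] at this
    rw [skew_snd, skew_snd, hp2, add_assoc, add_assoc, this]

-- Only base distances have to be controlled, by uniform continuity of the flow on `[0, L] × M`: by
-- `push_eq` the skew flow carries the height relation over exactly.
variable (Θ) in
lemma exists_near_flow [CompactSpace M] (φ : Flow ℝ M) {η : ℝ} (hη : 0 < η) (L : ℝ) :
    ∃ δ > 0, ∀ X Y, Θ.Near δ X Y → ∀ t ∈ Icc 0 L, Θ.Near η (Θ.skew φ t X) (Θ.skew φ t Y) := by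
  obtain ⟨δ, hδ, h⟩ := exists_unif_flow φ hη L
  exact ⟨δ, hδ, fun X Y hXY t ht => hXY.push φ fun x y hxy => h x y hxy t ht⟩

variable (Θ) in
lemma exists_near_orbit [CompactSpace M] (φ : Flow ℝ M) {η : ℝ} (hη : 0 < η) :
    ∃ τ > 0, ∀ X, ∀ t ∈ Icc 0 τ, Θ.Near η X (Θ.skew φ t X) := by
  let f : Icc (0 : ℝ) 1 × M → M := fun z => φ z.1 z.2
  have hf : Continuous f := φ.continuous (by fun_prop) (by fun_prop)
  obtain ⟨δ, hδ, h⟩ := Metric.uniformContinuous_iff.1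
    (CompactSpace.uniformContinuous_of_continuous hf) η hη
  refine ⟨min (δ / 2) 1, by positivity, fun X t ht => ?_⟩
  have ht1 : t ≤ 1 := ht.2.trans (min_le_right _ _)
  have ht2 : t ≤ δ / 2 := ht.2.trans (min_le_left _ _)
  refine ⟨(orbit φ X.1).comp (seg 0 t), by simp [orbit], by simp [orbit], fun s => ?_, rfl⟩
  have hst : s * t ∈ Icc (0 : ℝ) 1 := ⟨mul_nonneg s.2.1 ht.1, mul_le_one₀ s.2.2 ht.1 ht1⟩
  have := h (a := (⟨s * t, hst⟩, X.1)) (b := (⟨t, ht.1, ht1⟩, X.1)) (by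
    simp only [Prod.dist_eq, dist_self, Subtype.dist_eq, Real.dist_eq]
    rw [max_eq_left (abs_nonneg _), abs_sub_lt_iff]
    constructor <;> nlinarith [s.2.1, s.2.2, ht.1])
  simpa [orbit] using this

variable (Θ) in
/-- Finitely many nearly exact steps of the skew flow can be composed. -/
lemma exists_near_iterate [CompactSpace M] (φ : Flow ℝ M) {η : ℝ} (hη : 0 < η) (L : ℝ) (m : ℕ) :
    ∃ δ > 0, ∀ (X : ℕ → M × A) (h : ℝ), h ∈ Icc 0 L →
      (∀ k < m, Θ.Near δ (Θ.skew φ h (X k)) (X (k + 1))) →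
      Θ.Near η (Θ.skew φ (m * h) (X 0)) (X m) := by
  induction m generalizing η with
  | zero => exact ⟨1, one_pos, fun X h hh _ => by simpa using Near.refl hη _⟩
  | succ m ih =>
    obtain ⟨δ₁, hδ₁, h₁⟩ := Θ.exists_near_flow φ (half_pos hη) L
    obtain ⟨δ₂, hδ₂, h₂⟩ := ih hδ₁
    refine ⟨min δ₂ (η / 2), by positivity, fun X h hh hX => ?_⟩
    have hm := h₁ _ _ (h₂ X h hh fun k hk => (hX k (by omega)).mono (min_le_left _ _)) h hh
    have hl := (hX m (by omega)).mono (min_le_right _ _)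
    rw [← skew_add] at hm
    have := hm.trans hl
    rw [add_halves] at this
    convert this using 2
    push_cast
    ring

end PathCocycle

/-! ### Local contractibility of manifolds -/

/-- Every point has arbitrarily small neighbourhoods that contract to it within themselves. -/
def LocallyContracts (M : Type*) [TopologicalSpace M] : Prop :=
  ∀ x : M, ∀ U ∈ 𝓝 x, ∃ V ∈ 𝓝 x, V ⊆ U ∧ ∃ κ : M × unitInterval → M,
    ContinuousOn κ (V ×ˢ univ) ∧
      ∀ y ∈ V, κ (y, 0) = x ∧ κ (y, 1) = y ∧ ∀ u, κ (y, u) ∈ V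

/-- Traces of small balls on a convex set are star-shaped about their center. This covers Euclidean
spaces and half-spaces together. -/
lemma locallyContracts_of_isEmbedding {H E : Type*} [TopologicalSpace H] [NormedAddCommGroup E]
    [NormedSpace ℝ E] {f : H → E} (hf : IsEmbedding f) (hc : Convex ℝ (range f)) :
    LocallyContracts H := by
  intro x U hU
  obtain ⟨W, hW, hWU⟩ := (hf.isInducing.nhds_eq_comap x ▸ hU : U ∈ comap f (𝓝 (f x)))
  obtain ⟨r, hr, hrW⟩ := Metric.mem_nhds_iff.1 hW
  have hex : ∀ z : H × unitInterval, ∃ w, f w = f x + (z.2 : ℝ) • (f z.1 - f x) := by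
    intro z
    have := hc.add_smul_sub_mem (mem_range_self x) (mem_range_self z.1) z.2.2
    exact this
  choose κ hκ using hex
  have hcont : Continuous κ := by
    rw [hf.continuous_iff]
    have hfc := hf.continuous
    have : f ∘ κ = fun z => f x + (z.2 : ℝ) • (f z.1 - f x) := funext hκ
    rw [this]
    fun_prop
  refine ⟨f ⁻¹' Metric.ball (f x) r, hf.continuous.continuousAt (Metric.ball_mem_nhds _ hr),
    (preimage_mono hrW).trans hWU, κ, hcont.continuousOn, fun y hy => ⟨?_, ?_, fun u => ?_⟩⟩
  · apply hf.injective; simp [hκ]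
  · apply hf.injective; simp [hκ]
  · rw [mem_preimage, Metric.mem_ball, dist_eq_norm] at hy ⊢
    rw [hκ, add_sub_cancel_left, norm_smul, Real.norm_of_nonneg u.2.1]
    exact (mul_le_of_le_one_left (norm_nonneg _) u.2.2).trans_lt hy

lemma LocallyContracts.of_chartedSpace {H M : Type*} [TopologicalSpace H] [TopologicalSpace M]
    [ChartedSpace H M] (hH : LocallyContracts H) : LocallyContracts M := by
  intro x U hU
  let e := chartAt H x
  have hx : x ∈ e.source := mem_chart_source H x
  have hW : e.target ∩ e.symm ⁻¹' U ∈ 𝓝 (e x) := by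
    refine inter_mem (e.open_target.mem_nhds (e.map_source hx)) ?_
    refine (e.continuousAt_symm (e.map_source hx)).preimage_mem_nhds ?_
    rwa [e.left_inv hx]
  obtain ⟨V', hV', hVU, κ, hκ, h⟩ := hH (e x) _ hW
  refine ⟨e.source ∩ e ⁻¹' V', inter_mem (e.open_source.mem_nhds hx)
    ((e.continuousAt hx).preimage_mem_nhds hV'), ?_, fun z => e.symm (κ (e z.1, z.2)), ?_, ?_⟩
  · rintro y ⟨hy, hy'⟩
    have := (hVU hy').2
    rwa [mem_preimage, e.left_inv hy] at this
  · refine e.continuousOn_symm.comp (hκ.comp (f := fun z : M × unitInterval => (e z.1, z.2)) ?_ ?_) ?_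
    · exact (e.continuousOn.comp continuousOn_fst fun z hz => hz.1.1).prodMk continuousOn_snd
    · exact fun z hz => ⟨hz.1.2, trivial⟩
    · exact fun z hz => (hVU ((h _ hz.1.2).2.2 z.2)).1
  · rintro y ⟨hy, hy'⟩
    obtain ⟨h0, h1, h2⟩ := h _ hy'
    refine ⟨?_, ?_, fun u => ⟨e.map_target (hVU (h2 u)).1, ?_⟩⟩
    · simp only [h0, e.left_inv hx]
    · simp only [h1, e.left_inv hy]
    · simp only [mem_preimage, e.right_inv (hVU (h2 u)).1, h2 u]

lemma IsTopManifold.locallyContracts {M : Type u} [TopologicalSpace M] (h : IsTopManifold M) :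
    LocallyContracts M := by
  rcases h with ⟨n, ⟨h⟩⟩ | ⟨n, _, ⟨h⟩⟩
  · refine LocallyContracts.of_chartedSpace (H := EuclideanSpace ℝ (Fin n))
      (locallyContracts_of_isEmbedding .id ?_)
    simpa using convex_univ
  · refine LocallyContracts.of_chartedSpace (H := EuclideanHalfSpace n)
      (locallyContracts_of_isEmbedding (f := Subtype.val) .subtypeVal ?_)
    refine Eq.subst (motive := fun s => Convex ℝ s) Subtype.range_val.symm ?_
    intro x hx y hy a b ha hb _
    exact add_nonneg (mul_nonneg ha hx) (mul_nonneg hb hy)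

/-! ### Local primitives, and a height with finitely many increments -/

section Metric

variable {M : Type*} [MetricSpace M] [CompactSpace M]

/-- Close points are joined by small curves. -/
lemma LocallyContracts.exists_path (hM : LocallyContracts M) {η : ℝ} (hη : 0 < η) :
    ∃ ρ > 0, ∀ x y : M, dist x y < ρ →
      ∃ c : C(unitInterval, M), c 0 = x ∧ c 1 = y ∧ ∀ s, dist (c s) y < η := by
  choose V hV hVU κ hκ h using fun x : M => hM x _ (Metric.ball_mem_nhds x (half_pos hη))
  obtain ⟨ρ, hρ, hb⟩ := lebesgue_number_lemma_of_metric (s := (univ : Set M))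
    (c := fun x => interior (V x)) isCompact_univ (fun _ => isOpen_interior)
    (fun x _ => mem_iUnion.2 ⟨x, mem_interior_iff_mem_nhds.2 (hV x)⟩)
  have key : ∀ z x : M, x ∈ V z → ∃ c : C(unitInterval, M), c 0 = z ∧ c 1 = x ∧ ∀ s, c s ∈ V z := by
    intro z x hx
    refine ⟨⟨fun s => κ z (x, s), ?_⟩, (h z x hx).1, (h z x hx).2.1, (h z x hx).2.2⟩
    exact (hκ z).comp_continuous (by fun_prop) fun s => ⟨hx, trivial⟩
  refine ⟨ρ, hρ, fun x y hxy => ?_⟩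
  obtain ⟨z, hz⟩ := hb y trivial
  have hxz : x ∈ V z := interior_subset (hz hxy)
  have hyz : y ∈ V z := interior_subset (hz (Metric.mem_ball_self hρ))
  obtain ⟨c, hc0, hc1, hc⟩ := key z x hxz
  obtain ⟨c', hc0', hc1', hc'⟩ := key z y hyz
  refine ⟨PathCocycle.concat (PathCocycle.rev c) c' (by simp [hc0, hc0']), by simp [hc1],
    by simp [hc1'], PathCocycle.concat_forall (P := fun w => dist w y < η) _
      (fun s => ?_) (fun s => ?_)⟩
  · have h1 : dist (PathCocycle.rev c s) z < η / 2 := hVU z (hc (unitInterval.symm s))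
    have h2 := hVU z hyz
    exact (dist_triangle_right _ _ z).trans_lt (by linarith [Metric.mem_ball.1 h2])
  · have h1 := hVU z (hc' s)
    have h2 := hVU z hyz
    exact (dist_triangle_right _ _ z).trans_lt (by linarith [Metric.mem_ball.1 h1, Metric.mem_ball.1 h2])

variable {A : Type*} [AddCommGroup A] (Θ : PathCocycle M A)

/-- A path cocycle has local primitives, on balls of uniform size. -/
lemma LocallyContracts.exists_primitive (hM : LocallyContracts M) :
    ∃ ρ > 0, ∀ x : M, ∃ F : M → A, ∀ c : C(unitInterval, M), (∀ s, dist (c s) x < ρ) →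
      Θ c = F (c 1) - F (c 0) := by
  choose V hV _ κ hκ h using fun x : M => hM x univ univ_mem
  obtain ⟨ρ, hρ, hb⟩ := lebesgue_number_lemma_of_metric (s := (univ : Set M))
    (c := fun x => interior (V x)) isCompact_univ (fun _ => isOpen_interior)
    (fun x _ => mem_iUnion.2 ⟨x, mem_interior_iff_mem_nhds.2 (hV x)⟩)
  have hcont : ∀ z y : M, y ∈ V z → Continuous fun u : unitInterval => κ z (y, u) := fun z y hy =>
    (hκ z).comp_continuous (by fun_prop) fun s => ⟨hy, trivial⟩
  classical
  refine ⟨ρ, hρ, fun x => ?_⟩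
  obtain ⟨z, hz⟩ := hb x trivial
  refine ⟨fun y => if hy : y ∈ V z then Θ ⟨_, hcont z y hy⟩ else 0, fun c hc => ?_⟩
  have hcV : ∀ s, c s ∈ V z := fun s => interior_subset (hz (hc s))
  -- The primitive at `y` is the value on the contraction track from `z` to `y`. Contracting the
  -- whole curve `c` gives a square whose fourth side is constant at `z`.
  let G : C(unitInterval × unitInterval, M) := ⟨fun w => κ z (c w.1, w.2),
    (hκ z).comp_continuous (by fun_prop) fun s => ⟨hcV _, trivial⟩⟩
  have := Θ.square G (c₀ := .const _ z) (c₁ := c) (d₀ := ⟨_, hcont z _ (hcV 0)⟩)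
    (d₁ := ⟨_, hcont z _ (hcV 1)⟩) (fun s => (h z _ (hcV s)).1) (fun s => (h z _ (hcV s)).2.1)
    (fun _ => rfl) (fun _ => rfl)
  rw [Θ.const, zero_add] at this
  simp only [dif_pos (hcV _), this]
  abel

/-- Up to a coboundary, a path cocycle takes finitely many values on small curves. -/
lemma LocallyContracts.exists_discretization (hM : LocallyContracts M) :
    ∃ (g : M → A) (Ψ : Set A), Ψ.Finite ∧ ∃ lam > 0, ∀ c : C(unitInterval, M),
      (∀ s, dist (c s) (c 1) < lam) → Θ c - (g (c 1) - g (c 0)) ∈ Ψ := by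
  obtain ⟨ρ₀, hρ₀, hF⟩ := hM.exists_primitive Θ
  choose F hF using hF
  obtain ⟨ρ, hρ, hpath⟩ := hM.exists_path (η := ρ₀ / 4) (by positivity)
  obtain ⟨t, -, htf, ht⟩ := finite_cover_balls_of_compact (isCompact_univ (X := M)) hρ
  have hq : ∀ x : M, ∃ p ∈ t, ∃ c : C(unitInterval, M), c 0 = p ∧ c 1 = x ∧
      ∀ s, dist (c s) x < ρ₀ / 4 := by
    intro x
    obtain ⟨p, hp, hpx⟩ := mem_iUnion₂.1 (ht (mem_univ x))
    obtain ⟨c, h⟩ := hpath p x (by rwa [Metric.mem_ball, dist_comm] at hpx)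
    exact ⟨p, hp, c, h⟩
  choose i hi q hq0 hq1 hqs using hq
  -- Subtracting the values on `q (c 0)` and `q (c 1)` moves the ends of `c` to net points, so that
  -- only `F (i (c 1)) - F (i (c 0))` remains, `F` being the primitive about `i (c 0)`. The radius
  -- `ρ₀ / 8` keeps all three curves inside the ball of radius `ρ₀` about `i (c 0)`.
  refine ⟨fun x => Θ (q x), (fun z : M × M => F z.1 z.2 - F z.1 z.1) '' (t ×ˢ t),
    (htf.prod htf).image _, ρ₀ / 8, by positivity, fun c hc => ?_⟩
  refine ⟨(i (c 0), i (c 1)), ⟨hi _, hi _⟩, ?_⟩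
  have h01 := hc 0
  have hi0 : dist (c 0) (i (c 0)) < ρ₀ / 4 := by
    have := hqs (c 0) 0
    rwa [hq0, dist_comm] at this
  have e1 := hF (i (c 0)) c fun s => by
    have h2 := dist_triangle (c s) (c 1) (c 0)
    have h3 := dist_triangle (c s) (c 0) (i (c 0))
    rw [dist_comm (c 1) (c 0)] at h2
    linarith [hc s]
  have e2 := hF (i (c 0)) (q (c 0)) fun s => by
    linarith [dist_triangle (q (c 0) s) (c 0) (i (c 0)), hqs (c 0) s]
  have e3 := hF (i (c 0)) (q (c 1)) fun s => by
    have h2 := dist_triangle (q (c 1) s) (c 1) (c 0)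
    have h3 := dist_triangle (q (c 1) s) (c 0) (i (c 0))
    rw [dist_comm (c 1) (c 0)] at h2
    linarith [hqs (c 1) s]
  rw [hq0, hq1] at e2 e3
  simp only [e1, e2, e3]
  abel

/-- Finitely many increments in a finite set have a finite set of sums. -/
lemma exists_finite_sums {Ψ : Set A} (hΨ : Ψ.Finite) (N : ℕ) :
    ∃ W : Set A, W.Finite ∧ ∀ u : ℕ → A, (∀ k < N, u (k + 1) - u k ∈ Ψ) → u N - u 0 ∈ W := by
  induction N with
  | zero => exact ⟨{0}, finite_singleton _, fun u _ => by simp⟩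
  | succ N ih =>
    obtain ⟨W, hW, h⟩ := ih
    refine ⟨image2 (· + ·) W Ψ, hW.image2 _ hΨ, fun u hu => ?_⟩
    refine ⟨_, h u fun k hk => hu k (by omega), _, hu N (by omega), ?_⟩
    simp

/-- A height on `M × A` that takes finitely many increments along small curves and along
orbit arcs of bounded length. -/
lemma LocallyContracts.exists_height (hM : LocallyContracts M) (φ : Flow ℝ M) (L : ℝ) :
    ∃ (g : M → A) (W : Set A), W.Finite ∧ ∃ lam > 0,
      (∀ X Y : M × A, Θ.Near lam X Y → (Y.2 - g Y.1) - (X.2 - g X.1) ∈ W) ∧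
      ∀ (X : M × A), ∀ t ∈ Icc 0 L,
        ((Θ.skew φ t X).2 - g (Θ.skew φ t X).1) - (X.2 - g X.1) ∈ W := by
  obtain ⟨g, Ψ, hΨ, lam, hlam, h⟩ := hM.exists_discretization Θ
  have hN : ∀ X Y : M × A, Θ.Near lam X Y → (Y.2 - g Y.1) - (X.2 - g X.1) ∈ Ψ := by
    rintro X Y ⟨p, hp0, hp1, hp, hp2⟩
    have := h p (by rwa [hp1])
    rw [hp0, hp1] at this
    convert this using 1
    rw [hp2]
    abel
  obtain ⟨τ, hτ, hor⟩ := Θ.exists_near_orbit φ hlam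
  obtain ⟨N, hN1⟩ := exists_nat_ge (L / τ)
  obtain ⟨W, hW, hsum⟩ := exists_finite_sums hΨ (N + 1)
  refine ⟨g, Ψ ∪ W, hΨ.union hW, lam, hlam, fun X Y hXY => .inl (hN X Y hXY), fun X t ht => .inr ?_⟩
  have hpos : (0 : ℝ) < N + 1 := by positivity
  have hstep : t / (N + 1) ∈ Icc 0 τ := by
    refine ⟨div_nonneg ht.1 hpos.le, ?_⟩
    rw [div_le_iff₀ hpos]
    rw [div_le_iff₀ hτ] at hN1
    nlinarith [ht.2]
  have := hsum (fun k => (Θ.skew φ (k * (t / (N + 1))) X).2 - g (Θ.skew φ (k * (t / (N + 1))) X).1)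
    fun k _ => by
      have := hN _ _ (hor (Θ.skew φ (k * (t / (N + 1))) X) _ hstep)
      rw [← PathCocycle.skew_add, ← add_one_mul] at this
      exact_mod_cast this
  simp only [Nat.cast_add, Nat.cast_one, Nat.cast_zero, zero_mul, PathCocycle.skew_zero] at this
  rwa [mul_div_cancel₀ _ hpos.ne'] at this

end Metric

/-! ### Continuity of a real path cocycle up to a coboundary -/

section Smoothing

variable {M : Type*} [MetricSpace M] [CompactSpace M] (Θ : PathCocycle M ℝ)

/-- A real path cocycle becomes continuous after the addition of a coboundary. -/
lemma LocallyContracts.exists_continuous (hM : LocallyContracts M) :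
    ∃ g : M → ℝ, Continuous fun c : C(unitInterval, M) => Θ c + g (c 1) - g (c 0) := by
  obtain ⟨ρ, hρ, hF⟩ := hM.exists_primitive Θ
  choose F hF using hF
  obtain ⟨t, -, htf, ht⟩ := finite_cover_balls_of_compact (isCompact_univ (X := M)) hρ
  have : Fintype t := htf.fintype
  obtain ⟨P, hP⟩ := PartitionOfUnity.exists_isSubordinate (s := (univ : Set M)) isClosed_univ
    (fun p : t => Metric.ball (p : M) ρ) (fun _ => Metric.isOpen_ball)
    (fun x hx => by simpa using ht hx)
  let g : M → ℝ := fun x => -∑ p : t, P p x * F p x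
  have hg : ∀ q x, dist x q < ρ → ContinuousAt (fun y => F q y + g y) x := by
    intro q x hx
    -- The primitives themselves may be discontinuous, but differences of two of them are locally
    -- constant on the overlap of their balls, so the weighted sum is continuous.
    have e : (fun y => F q y + g y) = fun y => ∑ p : t, P p y * (F q y - F p y) := by
      ext y
      have h1 := P.sum_eq_one (mem_univ y)
      rw [finsum_eq_sum_of_fintype] at h1
      simp only [mul_sub, Finset.sum_sub_distrib, ← Finset.sum_mul, h1, one_mul, g]
      ring
    rw [e]
    refine tendsto_finsetSum _ fun p _ => ?_
    by_cases hxp : x ∈ tsupport (P p)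
    · have hxp' : dist x p < ρ := hP p hxp
      obtain ⟨η, hη, h1, h2⟩ : ∃ η > 0, 2 * η + dist x q ≤ ρ ∧ 2 * η + dist x p ≤ ρ := by
        refine ⟨min ((ρ - dist x q) / 2) ((ρ - dist x p) / 2), ?_, ?_, ?_⟩
        · exact lt_min (by linarith) (by linarith)
        · linarith [min_le_left ((ρ - dist x q) / 2) ((ρ - dist x p) / 2)]
        · linarith [min_le_right ((ρ - dist x q) / 2) ((ρ - dist x p) / 2)]
      obtain ⟨δ, hδ, hpath⟩ := hM.exists_path hη
      have hev : ∀ᶠ y in 𝓝 x, P p y * (F q x - F p x) = P p y * (F q y - F p y) := by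
        filter_upwards [Metric.ball_mem_nhds x (lt_min hδ hη)] with y hy
        rw [Metric.mem_ball, dist_comm] at hy
        obtain ⟨c, hc0, hc1, hc⟩ := hpath x y (hy.trans_le (min_le_left _ _))
        have hyη := hy.trans_le (min_le_right _ _)
        have hcx : ∀ s, dist (c s) x < 2 * η := fun s => by
          linarith [dist_triangle_right (c s) x y, hc s]
        have e1 := hF q c fun s => by linarith [dist_triangle (c s) x q, hcx s]
        have e2 := hF p c fun s => by linarith [dist_triangle (c s) x p, hcx s]
        rw [hc0, hc1] at e1 e2
        congr 1
        linarith
      exact ContinuousAt.congr (by fun_prop) hev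
    · have hev : ∀ᶠ y in 𝓝 x, 0 = P p y * (F q y - F p y) := by
        filter_upwards [(isClosed_tsupport (P p)).isOpen_compl.mem_nhds hxp] with y hy
        rw [image_eq_zero_of_notMem_tsupport hy, zero_mul]
      exact ContinuousAt.congr continuousAt_const hev
  refine ⟨g, continuous_iff_continuousAt.2 fun c₀ => ?_⟩
  obtain ⟨δ, hδ, hu⟩ := Metric.uniformContinuous_iff.1
    (CompactSpace.uniformContinuous_of_continuous (PathCocycle.extend c₀ |>.comp
      ⟨((↑) : unitInterval → ℝ), continuous_subtype_val⟩).continuous) (ρ / 2) (half_pos hρ)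
  obtain ⟨n, hn⟩ := exists_nat_one_div_lt hδ
  have hn0 : (0 : ℝ) < n + 1 := by positivity
  have hI : ∀ k ≤ n + 1, (k : ℝ) / (n + 1) ∈ Icc (0 : ℝ) 1 := fun k hk =>
    ⟨by positivity, by rw [div_le_one hn0]; exact_mod_cast hk⟩
  have hmem : ∀ k ≤ n, ∀ s : unitInterval, (k : ℝ) / (n + 1) + s * (1 / (n + 1)) ∈ Icc (0 : ℝ) 1 := by
    intro k hk s
    have h0 : (0 : ℝ) < 1 / (n + 1) := by positivity
    refine ⟨add_nonneg (hI k (by omega)).1 (mul_nonneg s.2.1 h0.le), ?_⟩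
    have := (hI (k + 1) (by omega)).2
    push_cast at this
    rw [add_div] at this
    nlinarith [s.2.2]
  let q : ℕ → M := fun k => PathCocycle.extend c₀ (k / (n + 1))
  have key : ∀ c : C(unitInterval, M), dist c c₀ < ρ / 2 → ∀ k ≤ n, ∀ s : unitInterval,
      dist (PathCocycle.extend c (k / (n + 1) + s * (1 / (n + 1)))) (q k) < ρ := by
    intro c hc k hk s
    have h1 := ContinuousMap.dist_apply_le_dist (f := c) (g := c₀) ⟨_, hmem k hk s⟩
    have h2 := hu (a := ⟨_, hmem k hk s⟩) (b := ⟨_, hI k (by omega)⟩) (by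
      rw [Subtype.dist_eq, Real.dist_eq]
      simp only [add_sub_cancel_left]
      rw [abs_of_nonneg (mul_nonneg s.2.1 (by positivity))]
      exact (mul_le_of_le_one_left (by positivity) s.2.2).trans_lt hn)
    rw [PathCocycle.extend_apply c ⟨_, hmem k hk s⟩]
    simp only [ContinuousMap.comp_apply, ContinuousMap.coe_mk] at h2
    rw [PathCocycle.extend_apply c₀ ⟨_, hmem k hk s⟩] at h2
    linarith [dist_triangle (c ⟨_, hmem k hk s⟩) (c₀ ⟨_, hmem k hk s⟩) (q k)]
  -- The subdivision and the centers `q k` come from `c₀` alone and serve all nearby curves. The sum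
  -- depends on `c` only through finitely many evaluations, at points where `F (q k) + g` is
  -- continuous.
  have hsum : ∀ c : C(unitInterval, M), dist c c₀ < ρ / 2 →
      ∑ k ∈ Finset.range (n + 1), ((F (q k) (PathCocycle.extend c ((k + 1 : ℕ) / (n + 1))) +
        g (PathCocycle.extend c ((k + 1 : ℕ) / (n + 1)))) -
        (F (q k) (PathCocycle.extend c (k / (n + 1))) + g (PathCocycle.extend c (k / (n + 1))))) =
      Θ c + g (c 1) - g (c 0) := by
    intro c hc
    have h1 := Finset.sum_range_sub (fun k : ℕ => g (PathCocycle.extend c (k / (n + 1)))) (n + 1)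
    have h2 := Θ.along_sum (PathCocycle.extend c) (fun k : ℕ => k / (n + 1)) (n + 1)
    have h3 : ((n + 1 : ℕ) : ℝ) / (n + 1) = 1 := by
      push_cast
      exact div_self hn0.ne'
    simp only [h3, Nat.cast_zero, zero_div, PathCocycle.along_extend] at h1 h2
    have e0 : PathCocycle.extend c 0 = c 0 := PathCocycle.extend_apply c 0
    have e1 : PathCocycle.extend c 1 = c 1 := PathCocycle.extend_apply c 1
    rw [e0, e1] at h1
    rw [add_sub_assoc, h2, ← h1, ← Finset.sum_add_distrib]
    refine Finset.sum_congr rfl fun k hk => ?_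
    have hk' : k ≤ n := Nat.lt_succ_iff.1 (Finset.mem_range.1 hk)
    have hstep : ((k + 1 : ℕ) : ℝ) / (n + 1) - k / (n + 1) = 1 / (n + 1) := by
      push_cast
      ring
    have := hF (q k) ((PathCocycle.extend c).comp (seg (k / (n + 1)) ((k + 1 : ℕ) / (n + 1))))
      fun s => by
        simp only [ContinuousMap.comp_apply, seg_apply, smul_eq_mul, hstep]
        exact key c hc k hk' s
    simp only [ContinuousMap.comp_apply, seg_apply, Set.Icc.coe_one, Set.Icc.coe_zero, one_smul,
      zero_smul, add_zero, add_sub_cancel] at this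
    rw [PathCocycle.along, this]
    ring
  refine ContinuousAt.congr (f := fun c => ∑ k ∈ Finset.range (n + 1),
      ((F (q k) (PathCocycle.extend c ((k + 1 : ℕ) / (n + 1))) +
        g (PathCocycle.extend c ((k + 1 : ℕ) / (n + 1)))) -
        (F (q k) (PathCocycle.extend c (k / (n + 1))) + g (PathCocycle.extend c (k / (n + 1))))))
    ?_ ?_
  · refine tendsto_finsetSum _ fun k hk => ?_
    have hk' : k ≤ n := Nat.lt_succ_iff.1 (Finset.mem_range.1 hk)
    have hev : ∀ a : ℝ, Continuous fun c : C(unitInterval, M) => PathCocycle.extend c a :=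
      fun a => continuous_eval_const (projIcc 0 1 zero_le_one a)
    have hk0 := key c₀ (by simpa using hρ) k hk' 0
    have hk1 := key c₀ (by simpa using hρ) k hk' 1
    simp only [Set.Icc.coe_zero, zero_mul, add_zero] at hk0
    rw [Set.Icc.coe_one, one_mul, ← add_div] at hk1
    refine Tendsto.sub ?_ ?_
    · refine (ContinuousAt.comp (f := fun c : C(unitInterval, M) =>
        PathCocycle.extend c ((k + 1 : ℕ) / (n + 1))) (g := fun y => F (q k) y + g y)
        (hg (q k) _ ?_) (hev _).continuousAt)
      exact_mod_cast hk1
    · exact (ContinuousAt.comp (f := fun c : C(unitInterval, M) =>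
        PathCocycle.extend c (k / (n + 1))) (g := fun y => F (q k) y + g y)
        (hg (q k) _ hk0) (hev _).continuousAt)
  · filter_upwards [Metric.ball_mem_nhds c₀ (half_pos hρ)] with c hc
    exact hsum c hc

end Smoothing

/-! ### The covering in coordinates: projection and height -/

namespace Cover

section Topological

variable {M : Type u} [TopologicalSpace M] {α : CohomH1 M} {x₀ : M}

/-- The height of a point of the covering: the value of `α` along a curve that represents it. -/
def height : Cover α x₀ → ℝ :=
  Quotient.lift (fun c : PathsFrom x₀ => cohomCocycle α c.1) fun c c' h => by
    obtain ⟨-, k, hk, hα⟩ := h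
    have := homCocycle_sub_eq hk
    have h2 : cohomCocycle α c'.1 - cohomCocycle α c.1 = α (homCocycle M c'.1 - homCocycle M c.1) :=
      (map_sub α _ _).symm
    rw [this, hα, sub_eq_zero] at h2
    exact h2.symm

/-- A point of the covering is determined by its projection and its height. -/
def pt (x : Cover α x₀) : M × ℝ := (x.proj, x.height)

@[simp] lemma pt_fst (x : Cover α x₀) : x.pt.1 = x.proj := rfl

@[simp] lemma pt_snd (x : Cover α x₀) : x.pt.2 = x.height := rfl

lemma pt_mk (c : PathsFrom x₀) : (Cover.mk α c).pt = (c.1 1, cohomCocycle α c.1) := rfl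

lemma exists_mk (x : Cover α x₀) : ∃ c, Cover.mk α c = x := Quotient.exists_rep x

lemma height_sub (c c' : PathsFrom x₀) {h : H1 M}
    (hh : IsHomologyClass (pathChain c'.1 - pathChain c.1) h) :
    cohomCocycle α c'.1 = cohomCocycle α c.1 + α h := by
  rw [← homCocycle_sub_eq hh, map_sub]
  exact (add_sub_cancel _ _).symm

/-- Two curves with the same end differ by a cycle, and equal heights mean that `α` vanishes on its
class, which is the defining relation of the covering. -/
lemma pt_injective : Function.Injective (pt : Cover α x₀ → M × ℝ) := by
  intro x y hxy
  obtain ⟨c, rfl⟩ := exists_mk x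
  obtain ⟨c', rfl⟩ := exists_mk y
  rw [pt_mk, pt_mk, Prod.mk.injEq] at hxy
  obtain ⟨h, hh⟩ := exists_isHomologyClass_sub (c.2.trans c'.2.symm) hxy.1
  refine Quotient.sound ⟨hxy.1, h, hh, ?_⟩
  have := height_sub (α := α) c c' hh
  linarith [hxy.2]

lemma pt_of_isTranslate {h : H1 M} {x y : Cover α x₀} (hxy : IsTranslate h x y) :
    y.pt = PathCocycle.raise (α h) x.pt := by
  obtain ⟨c, c', rfl, rfl, h1, hh⟩ := hxy
  rw [pt_mk, pt_mk, height_sub c c' hh, h1]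
  rfl

lemma exists_isTranslate {x y : Cover α x₀} (hxy : x.proj = y.proj) : ∃ h, IsTranslate h x y := by
  obtain ⟨c, rfl⟩ := exists_mk x
  obtain ⟨c', rfl⟩ := exists_mk y
  obtain ⟨h, hh⟩ := exists_isHomologyClass_sub (c.2.trans c'.2.symm) hxy
  exact ⟨h, c, c', rfl, rfl, hxy, hh⟩

lemma continuous_mk : Continuous (Cover.mk α : PathsFrom x₀ → Cover α x₀) := continuous_quotient_mk'

lemma pt_liftFlow (φ : Flow ℝ M) (t : ℝ) (x : Cover α x₀) :
    (liftFlow φ t x).pt = (cohomCocycle α).skew φ t x.pt := by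
  have hx : x = Cover.mk α (Quotient.out x) := (Quotient.out_eq x).symm
  rw [liftFlow, pt_mk]
  conv_rhs => rw [hx, pt_mk]
  ext
  · simp [flowPath]
  · exact (cohomCocycle α).diag_eq φ t _ _ fun s => rfl

lemma liftFlow_zero (φ : Flow ℝ M) (x : Cover α x₀) : liftFlow φ 0 x = x :=
  pt_injective (by simp [pt_liftFlow])

lemma liftFlow_add (φ : Flow ℝ M) (s t : ℝ) (x : Cover α x₀) :
    liftFlow φ (s + t) x = liftFlow φ t (liftFlow φ s x) :=
  pt_injective (by simp only [pt_liftFlow, PathCocycle.skew_add])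

lemma continuous_liftFlow (φ : Flow ℝ M) (x : Cover α x₀) :
    Continuous fun t => liftFlow φ t x := by
  refine continuous_mk.comp (Continuous.subtype_mk (ContinuousMap.continuous_of_continuous_uncurry _ ?_) _)
  exact φ.continuous (by fun_prop) (by fun_prop)

/-- Lifting of curves to the covering. -/
lemma exists_lift (x : Cover α x₀) (p : C(unitInterval, M)) (hp : p 0 = x.proj) :
    ∃ P : unitInterval → Cover α x₀, Continuous P ∧ P 0 = x ∧ (∀ s, (P s).proj = p s) ∧
      (P 1).height = x.height + cohomCocycle α p := by
  obtain ⟨c, rfl⟩ := exists_mk x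
  have hcp : c.1 1 = p 0 := hp.symm
  set C := PathCocycle.concat c.1 p hcp
  -- The lift at time `s` is the class of `c` followed by `p`, cut at parameter `(1 + s) / 2`, where
  -- the concatenation has reached `p s`.
  let Q : unitInterval → PathsFrom x₀ := fun s =>
    ⟨(PathCocycle.extend C).comp (seg 0 ((1 + s) / 2)), by
      have := PathCocycle.extend_apply C 0
      simp only [ContinuousMap.comp_apply, seg_apply, Set.Icc.coe_zero, zero_smul, add_zero] at this ⊢
      rw [this, PathCocycle.concat_zero]
      exact c.2⟩
  have hQ1 : ∀ s, (Q s).1 1 = p s := by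
    intro s
    have := PathCocycle.extend_concat_right c.1 p hcp s
    simpa [Q] using this
  have hQ : ∀ s, (Q s).1 1 = p s ∧ (Cover.mk α (Q s)).height =
      (cohomCocycle α).along (PathCocycle.extend C) 0 ((1 + s) / 2) := fun s => ⟨hQ1 s, rfl⟩
  refine ⟨fun s => Cover.mk α (Q s), continuous_mk.comp (Continuous.subtype_mk
    (ContinuousMap.continuous_of_continuous_uncurry _ ?_) _), ?_, hQ1, ?_⟩
  · have := (PathCocycle.extend C).continuous
    simp only [Function.uncurry_def, ContinuousMap.comp_apply, seg_apply]
    fun_prop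
  · refine pt_injective (Prod.ext ((hQ1 0).trans hcp.symm) ?_)
    refine (hQ 0).2.trans ?_
    rw [pt_mk]
    simp only [Set.Icc.coe_zero, add_zero]
    rw [← (cohomCocycle α).along_extend c.1]
    refine (cohomCocycle α).along_congr fun s => ?_
    rw [show (0 : ℝ) + s * (1 / 2 - 0) = s / 2 by ring, PathCocycle.extend_concat_left]
    simp [PathCocycle.extend_apply]
  · refine (hQ 1).2.trans ?_
    simp only [Set.Icc.coe_one]
    rw [show (1 + 1 : ℝ) / 2 = 1 by norm_num, PathCocycle.along_extend, PathCocycle.concat_eq]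
    rfl

end Topological

section Metric

variable {M : Type u} [MetricSpace M] {α : CohomH1 M} {x₀ : M} {d : MetricSpace (Cover α x₀)}

lemma continuous_dist_left (hd : IsLiftedMetric d) (x : Cover α x₀) :
    Continuous fun y => d.dist x y := by
  have h : ∀ (X : Type u) [MetricSpace X] (x : X), Continuous fun y => dist x y :=
    fun X _ x => by fun_prop
  replace h := @h _ d x
  rwa [hd.compatible] at h

lemma nhds_basis (hd : IsLiftedMetric d) (x : Cover α x₀) :
    (𝓝 x).HasBasis (fun ε : ℝ => 0 < ε) (fun ε => {y | d.dist y x < ε}) := by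
  have h := @Metric.nhds_basis_ball _ d.toPseudoMetricSpace x
  rw [hd.compatible] at h
  exact h

variable [CompactSpace M]

/-- The end of the lift of a short curve. -/
lemma exists_near_lift (hd : IsLiftedMetric d) {r : ℝ}
    (hr : ∀ z x y : Cover α x₀, d.dist z x < r → d.dist z y < r → d.dist x y = dist x.proj y.proj)
    {η : ℝ} (hη : 4 * η ≤ r) (x : Cover α x₀) {Y : M × ℝ} (h : (cohomCocycle α).Near η x.pt Y) :
    ∃ y : Cover α x₀, y.pt = Y ∧ d.dist x y = dist x.proj y.proj ∧ d.dist x y < η := by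
  have hd0 := h.dist_lt
  have hη0 : 0 < η := dist_nonneg.trans_lt hd0
  obtain ⟨p, hp0, hp1, hp, hp2⟩ := h
  obtain ⟨P, hP, hPx, hPp, hP1⟩ := exists_lift x p hp0
  have hxx : d.dist x x < r := by
    have : d.dist x x = 0 := d.dist_self x
    linarith
  have hdist : ∀ s, d.dist x (P s) < r → d.dist x (P s) < 2 * η := by
    intro s hs
    rw [hr x x (P s) hxx hs, hPp, dist_comm]
    have h1 := dist_triangle (p s) Y.1 x.proj
    rw [dist_comm Y.1] at h1
    have h2 : dist x.proj Y.1 < η := hd0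
    linarith [hp s]
  have hcont : Continuous fun s => d.dist x (P s) := (continuous_dist_left hd x).comp hP
  -- While the lift stays within `r` of `x`, the local isometry bounds its distance by `2 * η < r`.
  -- The set is thus also given by a closed condition, and connectedness keeps the whole lift within
  -- `r`.
  have hclopen : IsClopen {s | d.dist x (P s) < r} := by
    refine ⟨?_, isOpen_lt hcont continuous_const⟩
    have : {s | d.dist x (P s) < r} = {s | d.dist x (P s) ≤ 2 * η} :=
      Set.ext fun s => ⟨fun hs => (hdist s hs).le, fun hs =>
        (show d.dist x (P s) ≤ 2 * η from hs).trans_lt (by linarith)⟩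
    rw [this]
    exact isClosed_le hcont continuous_const
  have huniv := hclopen.eq_univ ⟨0, by rw [mem_ofPred_eq, hPx]; exact hxx⟩
  have h1 : d.dist x (P 1) < r := huniv.ge (mem_univ 1)
  have hpt : (P 1).pt = Y := by
    ext
    · exact (hPp 1).trans hp1
    · exact hP1.trans hp2.symm
  have he := hr x x (P 1) hxx h1
  refine ⟨P 1, hpt, he, ?_⟩
  rw [he]
  have : (P 1).proj = Y.1 := congrArg Prod.fst hpt
  rw [this]
  exact hd0

/-- Close points of the covering are joined by short curves. -/
lemma exists_near_of_dist (hd : IsLiftedMetric d) (hM : LocallyContracts M) {η : ℝ} (hη : 0 < η) :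
    ∃ ε > 0, ∀ x y : Cover α x₀, d.dist x y < ε → (cohomCocycle α).Near η x.pt y.pt := by
  obtain ⟨r, hr0, hr⟩ := hd.isometric
  obtain ⟨ρ, hρ, hpath⟩ := hM.exists_path (η := min η (r / 4)) (by positivity)
  refine ⟨min ρ r, by positivity, fun x y hxy => ?_⟩
  have hxx : d.dist x x < r := by
    have : d.dist x x = 0 := d.dist_self x
    linarith
  have hxyr := hxy.trans_le (min_le_right _ _)
  have he := hr x x y hxx hxyr
  obtain ⟨p, hp0, hp1, hp⟩ := hpath x.proj y.proj (he ▸ hxy.trans_le (min_le_left _ _))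
  have hN : (cohomCocycle α).Near (min η (r / 4)) x.pt (y.proj, x.height + cohomCocycle α p) :=
    ⟨p, hp0, hp1, hp, rfl⟩
  obtain ⟨z, hz, -, hz2⟩ := exists_near_lift hd hr
    (by linarith [min_le_right η (r / 4)]) x hN
  -- The points `y` and `z` have the same projection and both lie within `r` of `x`, where the
  -- projection is isometric.
  have hyz : d.dist y z = 0 := by
    rw [hr x y z hxyr (hz2.trans_le (by linarith [min_le_right η (r / 4)]))]
    have : z.proj = y.proj := congrArg Prod.fst hz
    rw [this, dist_self]
  have : y = z := @dist_eq_zero _ d y z |>.1 hyz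
  rw [this, hz, ← hz]
  rw [hz]
  exact hN.mono (min_le_left _ _)

/-- Points close to the projection of a point have a close lift. -/
lemma exists_close_lift (hd : IsLiftedMetric d) (hM : LocallyContracts M) {η : ℝ} (hη : 0 < η) :
    ∃ ρ > 0, ∀ (x : Cover α x₀) (m : M), dist x.proj m < ρ →
      ∃ y : Cover α x₀, y.proj = m ∧ d.dist x y < η ∧ (cohomCocycle α).Near η x.pt y.pt := by
  obtain ⟨r, hr0, hr⟩ := hd.isometric
  obtain ⟨ρ, hρ, hpath⟩ := hM.exists_path (η := min η (r / 4)) (by positivity)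
  refine ⟨ρ, hρ, fun x m hxm => ?_⟩
  obtain ⟨p, hp0, hp1, hp⟩ := hpath _ _ hxm
  have hN : (cohomCocycle α).Near (min η (r / 4)) x.pt (m, x.height + cohomCocycle α p) :=
    ⟨p, hp0, hp1, hp, rfl⟩
  obtain ⟨y, hy, -, hy2⟩ := exists_near_lift hd hr (by linarith [min_le_right η (r / 4)]) x hN
  exact ⟨y, congrArg Prod.fst hy, hy2.trans_le (min_le_left _ _),
    hy ▸ hN.mono (min_le_left _ _)⟩

lemma proj_surjective [ConnectedSpace M] (hd : IsLiftedMetric d) (hM : LocallyContracts M) :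
    Function.Surjective (proj : Cover α x₀ → M) := by
  obtain ⟨ρ, hρ, h⟩ := exists_close_lift hd hM one_pos
  have hcl : IsClopen (range (proj : Cover α x₀ → M)) := by
    constructor
    · refine isClosed_of_closure_subset fun m hm => ?_
      obtain ⟨_, ⟨x, rfl⟩, hx⟩ := Metric.mem_closure_iff.1 hm ρ hρ
      obtain ⟨y, hy, -⟩ := h x m (by rwa [dist_comm])
      exact ⟨y, hy⟩
    · refine Metric.isOpen_iff.2 ?_
      rintro _ ⟨x, rfl⟩
      refine ⟨ρ, hρ, fun m hm => ?_⟩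
      obtain ⟨y, hy, -⟩ := h x m (by rwa [dist_comm])
      exact ⟨y, hy⟩
  refine range_eq_univ.1 (hcl.eq_univ ⟨_, Cover.mk α ⟨.const _ x₀, rfl⟩, rfl⟩)

/-- A continuous equivariant map is at bounded distance from the discretized height. -/
lemma exists_bound [ConnectedSpace M] (hd : IsLiftedMetric d) (hM : LocallyContracts M)
    {f : Cover α x₀ → ℝ} (hf : Continuous f) (he : IsEquivariant f) {g : M → ℝ} {W : Set ℝ}
    (hW : W.Finite) {lam : ℝ} (hlam : 0 < lam)
    (hg : ∀ X Y : M × ℝ, (cohomCocycle α).Near lam X Y → (Y.2 - g Y.1) - (X.2 - g X.1) ∈ W) :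
    ∃ C, ∀ x : Cover α x₀, |f x - (x.height - g x.proj)| ≤ C := by
  -- Both terms are equivariant, so their difference is a function on `M`. As `g` need not be
  -- continuous, it is only shown to have bounded local variation, which suffices by compactness.
  have hinv : ∀ x y : Cover α x₀, x.proj = y.proj →
      f x - (x.height - g x.proj) = f y - (y.height - g y.proj) := by
    intro x y hxy
    obtain ⟨h, hh⟩ := exists_isTranslate hxy
    have h1 := he h x y hh
    have h2 : y.height = x.height + α h := congrArg Prod.snd (pt_of_isTranslate hh)
    rw [h1, h2, hxy]
    ring
  obtain ⟨B, hB⟩ := hW.isBounded.exists_norm_le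
  choose l hl using proj_surjective (α := α) (x₀ := x₀) hd hM
  have hloc : ∀ m : M, ∃ ρ > 0, ∀ m', dist m m' < ρ → ∃ y : Cover α x₀, y.proj = m' ∧
      |f y - (y.height - g y.proj) - (f (l m) - ((l m).height - g (l m).proj))| ≤ 1 + B := by
    intro m
    have hev : ∀ᶠ y in 𝓝 (l m), |f y - f (l m)| < 1 := by
      have := hf.tendsto (l m)
      filter_upwards [this (Metric.ball_mem_nhds _ one_pos)] with y hy
      exact hy
    obtain ⟨δ, hδ, hy⟩ := (nhds_basis hd (l m)).eventually_iff.1 hev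
    obtain ⟨ρ, hρ, h⟩ := exists_close_lift (α := α) (x₀ := x₀) hd hM (lt_min hδ hlam)
    refine ⟨ρ, hρ, fun m' hm => ?_⟩
    obtain ⟨y, hy1, hy2, hy3⟩ := h (l m) m' (by rwa [hl])
    refine ⟨y, hy1, ?_⟩
    have e1 := hy (x := y) (by
      rw [mem_ofPred_eq, show d.dist y (l m) = d.dist (l m) y from d.dist_comm _ _]
      exact hy2.trans_le (min_le_left _ _))
    have e2 := hB _ (hg _ _ (hy3.mono (min_le_right _ _)))
    rw [Real.norm_eq_abs] at e2
    simp only [pt_fst, pt_snd] at e2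
    rw [abs_le] at e2 ⊢
    rw [abs_lt] at e1
    constructor <;> linarith [e1.1, e1.2, e2.1, e2.2]
  choose ρ hρ hloc using hloc
  obtain ⟨t, ht⟩ := isCompact_univ.elim_finite_subcover (fun m : M => Metric.ball m (ρ m))
    (fun _ => Metric.isOpen_ball) (fun m _ => mem_iUnion.2 ⟨m, Metric.mem_ball_self (hρ m)⟩)
  refine ⟨∑ m ∈ t, |f (l m) - ((l m).height - g (l m).proj)| + (1 + B), fun x => ?_⟩
  obtain ⟨m, hm, hxm⟩ := mem_iUnion₂.1 (ht (mem_univ x.proj))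
  obtain ⟨y, hy, hy2⟩ := hloc m x.proj (by rwa [Metric.mem_ball, dist_comm] at hxm)
  rw [hinv x y hy.symm]
  have h1 := Finset.single_le_sum (f := fun m => |f (l m) - ((l m).height - g (l m).proj)|)
    (fun m _ => abs_nonneg _) hm
  rw [abs_le] at hy2 ⊢
  have h2 := neg_abs_le (f (l m) - ((l m).height - g (l m).proj))
  have h3 := le_abs_self (f (l m) - ((l m).height - g (l m).proj))
  constructor <;> linarith [hy2.1, hy2.2]

variable (α x₀) in
/-- There is a continuous equivariant map. -/
lemma exists_continuous_isEquivariant (hM : LocallyContracts M) :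
    ∃ f : Cover α x₀ → ℝ, Continuous f ∧ IsEquivariant f := by
  obtain ⟨g, hg⟩ := hM.exists_continuous (cohomCocycle α)
  -- On the path space this is the cocycle corrected by the coboundary of `g`, which is continuous
  -- there and descends to the quotient.
  refine ⟨fun x => x.height + g x.proj - g x₀, ?_, fun h x y hxy => ?_⟩
  · refine continuous_quot_lift (r := (coverSetoid α x₀).r) (f := fun c : PathsFrom x₀ =>
      cohomCocycle α c.1 + g (c.1 1) - g x₀) (fun c c' h => ?_) ?_ |>.congr ?_
    · have h1 : (Cover.mk α c) = Cover.mk α c' := Quotient.sound h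
      have h2 := congrArg pt h1
      rw [pt_mk, pt_mk, Prod.mk.injEq] at h2
      simp only [h2.1, h2.2]
    · refine (hg.comp continuous_subtype_val).congr fun c => ?_
      simp only [Function.comp_apply, c.2]
    · intro x
      obtain ⟨c, rfl⟩ := exists_mk x
      rfl
  · have h2 := pt_of_isTranslate hxy
    have e1 : y.proj = x.proj := congrArg Prod.fst h2
    have e2 : y.height = x.height + α h := congrArg Prod.snd h2
    simp only [e1, e2]
    ring

end Metric

end Cover

/-! ### From realizations of periodic pseudo-orbits to chains -/

section Realization

variable {M : Type*} [MetricSpace M] {A : Type*} [AddCommGroup A] (Θ : PathCocycle M A)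

/-- The curve in `M × A` given by a curve in `M`. -/
def heightCurve (δ : C(ℝ, M)) (s : ℝ) : M × A := (δ s, Θ.along δ 0 s)

lemma heightCurve_snd (δ : C(ℝ, M)) (s s' : ℝ) :
    (heightCurve Θ δ s').2 = (heightCurve Θ δ s).2 + Θ.along δ s s' :=
  (Θ.along_add δ 0 s s').symm

variable {φ : Flow ℝ M} {γ : ℝ → M} {δ : C(ℝ, M)} {σ : ℝ → ℝ} {Θ}

/-- Between discontinuities `δ` follows one orbit with the clock `σ`, and the cocycle does not see
the parametrization. The ends `s` and `s'` may be discontinuities: the orbit formula extends to them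
by continuity of `δ`. -/
lemma heightCurve_flow (hσ : Continuous σ) (hσm : Monotone σ)
    (hflow : ∀ t s, t ≤ s → ContinuousOn γ (Icc t s) → γ s = φ (s - t) (γ t))
    (hγ : ∀ s, ContinuousAt γ (σ s) → δ s = γ (σ s)) {s s' : ℝ} (hs : s ≤ s')
    (hcont : ∀ r ∈ Ioo s s', ContinuousAt γ (σ r)) :
    heightCurve Θ δ s' = Θ.skew φ (σ s' - σ s) (heightCurve Θ δ s) := by
  rcases hs.eq_or_lt with rfl | hlt
  · simp
  have key : ∀ r ∈ Ioo s s', ∀ r' ∈ Ioo s s', r ≤ r' → δ r' = φ (σ r' - σ r) (δ r) := by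
    intro r hr r' hr' hrr
    rw [hγ r (hcont r hr), hγ r' (hcont r' hr')]
    refine hflow _ _ (hσm hrr) fun u hu => ?_
    obtain ⟨q, hq, rfl⟩ := intermediate_value_Icc hrr hσ.continuousOn hu
    exact (hcont q ⟨hr.1.trans_le hq.1, hq.2.trans_lt hr'.2⟩).continuousWithinAt
  set r₀ := (s + s') / 2
  have hr₀ : r₀ ∈ Ioo s s' := ⟨by simp only [r₀]; linarith, by simp only [r₀]; linarith⟩
  obtain ⟨y, hy⟩ : ∃ y, ∀ r ∈ Ioo s s', δ r = φ (σ r) y := by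
    refine ⟨φ (-σ r₀) (δ r₀), fun r hr => ?_⟩
    rw [← Flow.map_add]
    rcases le_total r₀ r with h | h
    · exact key _ hr₀ _ hr h
    · rw [key _ hr _ hr₀ h, ← Flow.map_add,
        show σ r + -σ r₀ + (σ r₀ - σ r) = 0 by ring, Flow.map_zero_apply]
  have hy' : ∀ r ∈ Icc s s', δ r = φ (σ r) y := by
    have h1 : EqOn δ (fun r => φ (σ r) y) (closure (Ioo s s')) :=
      EqOn.closure hy δ.continuous (φ.continuous hσ continuous_const)
    rw [closure_Ioo hlt.ne] at h1
    exact h1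
  have hs1 := hy' s ⟨le_rfl, hs⟩
  have hs2 := hy' s' ⟨hs, le_rfl⟩
  refine Prod.ext ?_ ?_
  · show δ s' = φ _ (δ s)
    rw [hs1, hs2, ← Flow.map_add, sub_add_cancel]
  · rw [heightCurve_snd Θ δ s s', PathCocycle.skew_snd]
    congr 1
    show _ = Θ.onOrbit φ _ (δ s)
    rw [hs1, ← PathCocycle.along_orbit]
    have := Θ.reparam (PathCocycle.orbit φ y) ((⟨σ, hσ⟩ : C(ℝ, ℝ)).comp (seg s s'))
    simp only [ContinuousMap.comp_apply, ContinuousMap.coe_mk, seg_apply, Set.Icc.coe_zero,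
      Set.Icc.coe_one, zero_smul, one_smul, add_zero, add_sub_cancel] at this
    rw [← this, PathCocycle.along]
    congr 1
    ext u
    refine hy' _ ⟨?_, ?_⟩
    · simp only [seg_apply, smul_eq_mul]
      nlinarith [u.2.1]
    · simp only [seg_apply, smul_eq_mul]
      nlinarith [u.2.2]

lemma heightCurve_jump {ε u : ℝ} {s s' : ℝ} (hs : s ≤ s')
    (h : ∀ r ∈ Icc s s', δ r ∈ Metric.ball (γ u) ε) :
    Θ.Near (2 * ε) (heightCurve Θ δ s) (heightCurve Θ δ s') := by
  refine ⟨δ.comp (seg s s'), by simp [heightCurve], by simp [heightCurve], fun r => ?_,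
    heightCurve_snd Θ δ s s'⟩
  have h1 := h s' ⟨hs, le_rfl⟩
  have h2 := h (seg s s' r) ⟨by simp only [seg_apply, smul_eq_mul]; nlinarith [r.2.1],
    by simp only [seg_apply, smul_eq_mul]; nlinarith [r.2.2]⟩
  rw [Metric.mem_ball] at h1 h2
  show dist (δ (seg s s' r)) (δ s') < _
  linarith [dist_triangle_right (δ (seg s s' r)) (δ s') (γ u)]

/-- A window shorter than `T` meets at most one discontinuity time, so the realization is flow,
jump, flow. The jump is then transported by the flow to the end of the window. -/
lemma heightCurve_step {ε η T : ℝ} (hη : 0 < η) {Δ : Set ℝ}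
    (hε : ∀ X Y, Θ.Near (2 * ε) X Y → ∀ t ∈ Icc 0 T, Θ.Near η (Θ.skew φ t X) (Θ.skew φ t Y))
    (hσ : Continuous σ) (hσm : Monotone σ)
    (hΔ : ∀ t, t ∉ Δ → ContinuousAt γ t) (hsep : ∀ s ∈ Δ, ∀ t ∈ Δ, s ≠ t → T ≤ |s - t|)
    (hflow : ∀ t s, t ≤ s → ContinuousOn γ (Icc t s) → γ s = φ (s - t) (γ t))
    (hγ : ∀ s, ContinuousAt γ (σ s) → δ s = γ (σ s))
    (hγ' : ∀ s, ¬ ContinuousAt γ (σ s) → δ s ∈ Metric.ball (γ (σ s)) ε) {s s' : ℝ} (hs : s ≤ s')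
    (hT : σ s' - σ s < T) :
    Θ.Near η (Θ.skew φ (σ s' - σ s) (heightCurve Θ δ s)) (heightCurve Θ δ s') := by
  by_cases hD : ∃ r₀ ∈ Icc s s', ¬ ContinuousAt γ (σ r₀)
  · obtain ⟨r₀, hr₀, hc⟩ := hD
    have hu : ∀ r ∈ Icc s s', ¬ ContinuousAt γ (σ r) → σ r = σ r₀ := by
      intro r hr hrc
      by_contra hne
      have h1 := hsep _ (by_contra fun h => hrc (hΔ _ h)) _ (by_contra fun h => hc (hΔ _ h)) hne
      have h2 := hσm hr.1
      have h3 := hσm hr.2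
      have h4 := hσm hr₀.1
      have h5 := hσm hr₀.2
      rcases le_abs'.1 h1 with h6 | h6 <;> linarith
    -- The map `σ` may stay constant while the jump curve is traversed; `s₁` and `s₂` are the first
    -- and last such parameters in the window.
    have hcpt : IsCompact (Icc s s' ∩ σ ⁻¹' {σ r₀}) :=
      isCompact_Icc.inter_right (isClosed_singleton.preimage hσ)
    obtain ⟨s₁, hs₁, hmin⟩ := hcpt.exists_isLeast ⟨r₀, hr₀, rfl⟩
    obtain ⟨s₂, hs₂, hmax⟩ := hcpt.exists_isGreatest ⟨r₀, hr₀, rfl⟩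
    have e1 : σ s₁ = σ r₀ := hs₁.2
    have e2 : σ s₂ = σ r₀ := hs₂.2
    have h12 : s₁ ≤ s₂ := hmax hs₁
    have p1 := heightCurve_flow (Θ := Θ) hσ hσm hflow hγ hs₁.1.1 fun r hr => by
      by_contra h
      have hr' : r ∈ Icc s s' := ⟨hr.1.le, hr.2.le.trans hs₁.1.2⟩
      exact (hmin ⟨hr', hu r hr' h⟩).not_gt hr.2
    have p3 := heightCurve_flow (Θ := Θ) hσ hσm hflow hγ hs₂.1.2 fun r hr => by
      by_contra h
      have hr' : r ∈ Icc s s' := ⟨hs₂.1.1.trans hr.1.le, hr.2.le⟩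
      exact (hmax ⟨hr', hu r hr' h⟩).not_gt hr.1
    have p2 : Θ.Near (2 * ε) (heightCurve Θ δ s₁) (heightCurve Θ δ s₂) := by
      refine heightCurve_jump (γ := γ) (u := σ r₀) h12 fun r hr => ?_
      have : σ r = σ r₀ := le_antisymm (e2 ▸ hσm hr.2) (e1 ▸ hσm hr.1)
      rw [← this]
      refine hγ' r ?_
      rwa [this]
    have := hε _ _ p2 (σ s' - σ s₂) ⟨by linarith [hσm hs₂.1.2], by
      linarith [hσm hs₂.1.1]⟩
    rw [← p3, p1, ← PathCocycle.skew_add] at this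
    rwa [show σ s₁ - σ s + (σ s' - σ s₂) = σ s' - σ s by rw [e1, e2]; ring] at this
  · push Not at hD
    rw [heightCurve_flow (Θ := Θ) hσ hσm hflow hγ hs fun r hr => hD r ⟨hr.1.le, hr.2.le⟩]
    exact .refl hη _

/-- The periodic extension of a closed curve. -/
def periodicExtend (δ : C(unitInterval, M)) (h : δ 0 = δ 1) : C(ℝ, M) :=
  ⟨fun s => PathCocycle.extend δ (Int.fract s), by
    refine ContinuousOn.comp_fract'' (f := PathCocycle.extend δ)
      (PathCocycle.extend δ).continuous.continuousOn ?_
    have h0 := PathCocycle.extend_apply δ 0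
    have h1 := PathCocycle.extend_apply δ 1
    simp only [Set.Icc.coe_zero, Set.Icc.coe_one] at h0 h1
    rw [h0, h1, h]⟩

lemma along_periodic {δ : C(ℝ, M)} (h : ∀ s, δ (s + 1) = δ s) (a b : ℝ) :
    Θ.along δ (a + 1) (b + 1) = Θ.along δ a b := by
  refine Θ.along_congr fun s => ?_
  rw [← h (a + s * (b - a))]
  congr 1
  ring

lemma heightCurve_add_nat {δ : C(ℝ, M)} (h : ∀ s, δ (s + 1) = δ s) (s : ℝ) (k : ℕ) :
    heightCurve Θ δ (s + k) = PathCocycle.raise (k • Θ.along δ 0 1) (heightCurve Θ δ s) := by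
  induction k with
  | zero => simp
  | succ k ih =>
    have h1 : heightCurve Θ δ (s + k + 1) =
        PathCocycle.raise (Θ.along δ 0 1) (heightCurve Θ δ (s + k)) := by
      refine Prod.ext (h _) ?_
      show Θ.along δ 0 (s + k + 1) = Θ.along δ 0 (s + k) + Θ.along δ 0 1
      rw [← Θ.along_add δ 0 1, ← along_periodic h 0 (s + k), zero_add]
      abel
    rw [Nat.cast_succ, ← add_assoc, h1, ih, PathCocycle.raise_raise, succ_nsmul]

/-- The parametrization of a realization, extended to the line. -/
lemma exists_periodicExtend {σ : unitInterval → ℝ} (hσ : Continuous σ) (hm : Monotone σ)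
    (h0 : σ 0 = 0) {l : ℝ} (h1 : σ 1 = l) : ∃ τ : ℝ → ℝ, Continuous τ ∧ Monotone τ ∧
      ∀ s, τ s = ⌊s⌋ * l + σ ⟨Int.fract s, Int.fract_nonneg s, (Int.fract_lt_one s).le⟩ := by
  have hl : 0 ≤ l := by rw [← h0, ← h1]; exact hm zero_le_one
  refine ⟨fun s => ⌊s⌋ * l + σ ⟨Int.fract s, Int.fract_nonneg s, (Int.fract_lt_one s).le⟩,
    ?_, fun s s' hs => ?_, fun s => rfl⟩
  · have hc : Continuous ((fun u => σ (projIcc 0 1 zero_le_one u) - u * l) ∘ (Int.fract : ℝ → ℝ)) := by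
      refine ContinuousOn.comp_fract'' (Continuous.continuousOn ?_) ?_
      · exact (hσ.comp continuous_projIcc).sub (by fun_prop)
      · simp [h0, h1]
    refine ((continuous_mul_const l).add hc).congr fun s => ?_
    show s * l + (σ (projIcc 0 1 zero_le_one (Int.fract s)) - Int.fract s * l) = _
    rw [projIcc_of_mem _ ⟨Int.fract_nonneg s, (Int.fract_lt_one s).le⟩]
    have := Int.floor_add_fract s
    linear_combination (-l) * this
  · rcases (Int.floor_mono hs).eq_or_lt with h | h
    · have : Int.fract s ≤ Int.fract s' := by
        rw [Int.fract, Int.fract, h]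
        linarith
      show (⌊s⌋ : ℝ) * l + _ ≤ (⌊s'⌋ : ℝ) * l + _
      rw [h]
      exact add_le_add le_rfl (hm this)
    · have h2 : (⌊s⌋ : ℝ) + 1 ≤ ⌊s'⌋ := by exact_mod_cast h
      have h3 : σ ⟨Int.fract s, Int.fract_nonneg s, (Int.fract_lt_one s).le⟩ ≤ l :=
        (hm (Subtype.coe_le_coe.1 (Int.fract_lt_one s).le)).trans h1.le
      have h4 : 0 ≤ σ ⟨Int.fract s', Int.fract_nonneg s', (Int.fract_lt_one s').le⟩ :=
        h0.ge.trans (hm (Subtype.coe_le_coe.1 (Int.fract_nonneg s')))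
      show (⌊s⌋ : ℝ) * l + _ ≤ (⌊s'⌋ : ℝ) * l + _
      nlinarith [mul_le_mul_of_nonneg_right h2 hl]

lemma continuousAt_add_period {γ : ℝ → M} {l : ℝ} (hγ : Function.Periodic γ l) (k : ℤ) (t : ℝ) :
    ContinuousAt γ (k * l + t) ↔ ContinuousAt γ t := by
  have hp : ∀ k : ℤ, (fun s => γ (k * l + s)) = γ := fun k => by
    ext s
    rw [add_comm]
    exact hγ.int_mul k s
  constructor
  · intro h
    have := ContinuousAt.comp (f := fun s => k * l + s) (g := γ) (x := t) h (by fun_prop)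
    rwa [show γ ∘ (fun s => k * l + s) = γ from hp k] at this
  · intro h
    have h' : ContinuousAt γ ((-k : ℤ) * l + (k * l + t)) := by
      convert h using 1
      push_cast
      ring
    have := ContinuousAt.comp (f := fun s => (-k : ℤ) * l + s) (g := γ) (x := k * l + t) h'
      (by fun_prop)
    rwa [show γ ∘ (fun s => (-k : ℤ) * l + s) = γ from hp (-k)] at this

variable (Θ φ) in
/-- Sampling a realization of a periodic pseudo-orbit at small regular times gives a periodic
sequence of nearly exact steps of the skew flow. -/
lemma exists_chain_of_realization [CompactSpace M] (T : ℝ) {η : ℝ} (hη : 0 < η) :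
    ∃ ε > 0, ∀ (l : ℝ) (γ : ℝ → M) (δ : C(unitInterval, M)), IsPeriodicPseudoOrbit φ ε T l γ →
      IsRealization ε l γ δ → ∀ (h : ℝ) (k n : ℕ), 0 < h → h < T → 0 < n → n * h = k * l →
        ∃ Y : ℕ → M × A, (∀ i, Θ.Near η (Θ.skew φ h (Y i)) (Y (i + 1))) ∧
          ∀ i, Y (i + n) = PathCocycle.raise (k • Θ δ) (Y i) := by
  obtain ⟨ε₂, hε₂, hflow⟩ := Θ.exists_near_flow φ hη T
  refine ⟨ε₂ / 2, half_pos hε₂, ?_⟩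
  rintro l γ δ ⟨hl, hper, -, Δ, -, -, hΔ, hsep, hfl, -⟩ ⟨h01, σ, hσ, hσm, hσ0, hσ1, hreal⟩ h k n
    hh hhT hn hnk
  obtain ⟨τ, hτ, hτm, hτe⟩ := exists_periodicExtend hσ hσm hσ0 hσ1
  have hδe : ∀ s, periodicExtend δ h01 s =
      δ ⟨Int.fract s, Int.fract_nonneg s, (Int.fract_lt_one s).le⟩ := fun s =>
    PathCocycle.extend_apply δ ⟨Int.fract s, _⟩
  have hδp : ∀ s, periodicExtend δ h01 (s + 1) = periodicExtend δ h01 s := fun s => by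
    simp only [hδe, Int.fract_add_one]
  have hγτ : ∀ s, γ (τ s) = γ (σ ⟨Int.fract s, Int.fract_nonneg s, (Int.fract_lt_one s).le⟩) := by
    intro s
    rw [hτe, add_comm]
    exact hper.int_mul _ _
  have hc : ∀ s, ContinuousAt γ (τ s) ↔
      ContinuousAt γ (σ ⟨Int.fract s, Int.fract_nonneg s, (Int.fract_lt_one s).le⟩) := by
    intro s
    rw [hτe]
    exact continuousAt_add_period hper _ _
  have hstep : ∀ {s s' : ℝ}, s ≤ s' → τ s' - τ s < T →
      Θ.Near η (Θ.skew φ (τ s' - τ s) (heightCurve Θ (periodicExtend δ h01) s))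
        (heightCurve Θ (periodicExtend δ h01) s') :=
    heightCurve_step (ε := ε₂ / 2) hη (by rwa [mul_div_cancel₀ _ two_ne_zero]) hτ hτm hΔ hsep hfl
      (fun s hs => by rw [hδe, hγτ]; exact (hreal _).1 ((hc s).1 hs))
      (fun s hs => by rw [hδe, hγτ]; exact (hreal _).2 (mt (hc s).2 hs))
  have hτn : ∀ (s : ℝ) (j : ℕ), τ (s + j) = τ s + j * l := by
    intro s j
    simp only [hτe, Int.floor_add_natCast, Int.fract_add_natCast]
    push_cast
    ring
  have hτ0 : τ 0 = 0 := by
    rw [hτe]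
    simpa using hσ0
  have hsurj : ∀ j : ℕ, ∃ s, τ s = j * h := by
    intro j
    obtain ⟨N, hN⟩ := exists_nat_ge (j * h / l)
    rw [div_le_iff₀ hl] at hN
    have h1 : τ N = N * l := by
      have := hτn 0 N
      rwa [zero_add, hτ0, zero_add] at this
    obtain ⟨s, -, hs⟩ := intermediate_value_Icc (Nat.cast_nonneg (α := ℝ) N) hτ.continuousOn
      (show (j : ℝ) * h ∈ Icc (τ 0) (τ N) by rw [hτ0, h1]; exact ⟨by positivity, hN⟩)
    exact ⟨s, hs⟩
  choose b hb using hsurj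
  -- The clock is constant along jumps, so preimages of sampling times are not unique. Choosing them
  -- for the first `n` samples and translating makes the samples exactly periodic; `n` samples cover
  -- `k` turns because `n * h = k * l`.
  let s : ℕ → ℝ := fun i => b (i % n) + (i / n * k : ℕ)
  have hs : ∀ i, τ (s i) = i * h := by
    intro i
    rw [hτn, hb]
    have := Nat.mod_add_div i n
    calc ((i % n : ℕ) : ℝ) * h + (i / n * k : ℕ) * l
        = (i % n : ℕ) * h + (i / n : ℕ) * (k * l) := by push_cast; ring
      _ = ((i % n + n * (i / n) : ℕ) : ℝ) * h := by rw [← hnk]; push_cast; ring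
      _ = i * h := by rw [this]
  refine ⟨fun i => heightCurve Θ (periodicExtend δ h01) (s i), fun i => ?_, fun i => ?_⟩
  · have hlt : τ (s (i + 1)) - τ (s i) = h := by
      rw [hs, hs]
      push_cast
      ring
    have hle : s i ≤ s (i + 1) := by
      by_contra hcon
      have := hτm (not_le.1 hcon).le
      linarith
    have := hstep hle (by rw [hlt]; exact hhT)
    rwa [hlt] at this
  · have e : s (i + n) = s i + k := by
      simp only [s, Nat.add_mod_right, Nat.add_div_right i hn]
      push_cast
      ring
    show heightCurve Θ (periodicExtend δ h01) (s (i + n)) = _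
    rw [e, heightCurve_add_nat hδp]
    congr 2
    rw [← Θ.along_extend δ]
    refine Θ.along_congr fun u => ?_
    rw [hδe]
    by_cases hu : u = 1
    · subst hu
      have : PathCocycle.extend δ 1 = δ 1 := PathCocycle.extend_apply δ 1
      simp [this, ← h01]
    · have hu1 : (u : ℝ) < 1 := lt_of_le_of_ne u.2.2 fun h => hu (Subtype.ext h)
      have hf : Int.fract (u : ℝ) = u := Int.fract_eq_self.2 ⟨u.2.1, hu1⟩
      simp [hf, PathCocycle.extend_apply]

/-- The choice of a sampling step. -/
lemma exists_sampling {l T : ℝ} (hl : 0 < l) (hT : 0 < T) :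
    ∃ (h : ℝ) (k n : ℕ), T / 4 ≤ h ∧ h ≤ T / 2 ∧ 0 < k ∧ 0 < n ∧ n * h = k * l := by
  -- The period may be much shorter than `T`, so the orbit is run `k` times until `k * l > T` before
  -- dividing into steps.
  obtain ⟨k, hk⟩ := exists_nat_gt (T / l)
  rw [div_lt_iff₀ hl] at hk
  have hk0 : (0 : ℝ) < k * l := hT.trans hk
  set n := ⌈2 * (k * l) / T⌉₊
  have hn0 : 0 < n := Nat.ceil_pos.2 (by positivity)
  have hn1 : 2 * (k * l) / T ≤ n := Nat.le_ceil _
  have hn2 : (n : ℝ) < 2 * (k * l) / T + 1 := Nat.ceil_lt_add_one (by positivity)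
  have hnR : (0 : ℝ) < n := by exact_mod_cast hn0
  rw [div_le_iff₀ hT] at hn1
  have hn3 : n * T < 2 * (k * l) + T := by
    have := mul_lt_mul_of_pos_right hn2 hT
    rwa [add_mul, div_mul_cancel₀ _ hT.ne', one_mul] at this
  refine ⟨k * l / n, k, n, ?_, ?_, ?_, hn0, mul_div_cancel₀ _ hnR.ne'⟩
  · rw [le_div_iff₀ hnR]
    linarith
  · rw [div_le_iff₀ hnR]
    linarith
  · rcases Nat.eq_zero_or_pos k with rfl | h
    · simp at hk0
    · exact h

end Realization

/-! ### From pseudo-orbits of the covering to chains -/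

section CoverPseudoOrbit

variable {M : Type u} [MetricSpace M] [CompactSpace M] {α : CohomH1 M} {x₀ : M}
  {d : MetricSpace (Cover α x₀)}

lemma Cover.t2Space (hd : IsLiftedMetric d) : T2Space (Cover α x₀) := by
  have h : ∀ (X : Type u) [MetricSpace X], T2Space X := fun X _ => inferInstance
  replace h := @h _ d
  rwa [hd.compatible] at h

/-- Over short times, a pseudo-orbit of the covering follows the flow up to small jumps. -/
lemma exists_near_of_isPseudoOrbit (hd : IsLiftedMetric d) (hM : LocallyContracts M) (φ : Flow ℝ M)
    (T : ℝ) {η : ℝ} (hη : 0 < η) :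
    ∃ ε > 0, ∀ (l : ℝ) (γ : ℝ → Cover α x₀), IsPseudoOrbit d.dist (liftFlow φ) ε T l γ →
      ∀ a b, 0 ≤ a → a ≤ b → b < l → b - a < T →
        (cohomCocycle α).Near η ((cohomCocycle α).skew φ (b - a) (γ a).pt) (γ b).pt := by
  have := Cover.t2Space hd
  obtain ⟨ε₂, hε₂, hflow⟩ := (cohomCocycle α).exists_near_flow φ hη T
  obtain ⟨ε, hε, hnear⟩ := Cover.exists_near_of_dist hd hM hε₂
  refine ⟨ε, hε, ?_⟩
  rintro l γ ⟨hl, hright, Δ, -, hΔI, -, hcont, hsep, hfl, hjump⟩ a b ha hab hbl hT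
  have hex : ∀ b', a ≤ b' → b' < l → (∀ t ∈ Ioc a b', t ∉ Δ) → γ b' = liftFlow φ (b' - a) (γ a) := by
    intro b' hab' hbl' hno
    refine hfl a b' ha hab' hbl' fun t ht => ?_
    rcases ht.1.eq_or_lt with rfl | hat
    · exact (hright a ⟨ha, hab'.trans_lt hbl'⟩).mono fun s hs => ⟨hs.1, hs.2.trans_lt hbl'⟩
    · exact (hcont t ⟨ha.trans ht.1, ht.2.trans_lt hbl'⟩ (hno t ⟨hat, ht.2⟩)).mono
        fun s hs => ⟨ha.trans hs.1, hs.2.trans_lt hbl'⟩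
  -- A jump at `a` itself is harmless, since right continuity already places `γ a` after it; a jump
  -- at `b` counts.
  by_cases hD : ∃ u ∈ Ioc a b, u ∈ Δ
  · obtain ⟨u, hu, huΔ⟩ := hD
    have huniq : ∀ t ∈ Ioc a b, t ∈ Δ → t = u := by
      intro t ht htΔ
      by_contra hne
      have := hsep _ htΔ _ huΔ hne
      rcases le_abs'.1 this with h6 | h6 <;> linarith [ht.1, ht.2, hu.1, hu.2]
    obtain ⟨y, hy, hdy⟩ := hjump u huΔ
    have hlim : Tendsto γ (𝓝[<] u) (𝓝 (liftFlow φ (u - a) (γ a))) := by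
      have hc := (Cover.continuous_liftFlow φ (γ a)).comp (continuous_sub_right a)
      have := (hc.tendsto u).mono_left (nhdsWithin_le_nhds (s := Iio u))
      refine this.congr' ?_
      filter_upwards [Ioo_mem_nhdsLT hu.1] with t ht
      refine (hex t ht.1.le (ht.2.trans_le hu.2 |>.trans hbl) fun s hs hsΔ => ?_).symm
      have := huniq s ⟨hs.1, hs.2.trans (ht.2.le.trans hu.2)⟩ hsΔ
      linarith [hs.2, ht.2]
    have hyeq := tendsto_nhds_unique hy hlim
    have h1 : (cohomCocycle α).Near ε₂ y.pt (γ u).pt :=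
      hnear _ _ (by rw [show d.dist y (γ u) = d.dist (γ u) y from d.dist_comm _ _]; exact hdy)
    have h2 : γ b = liftFlow φ (b - u) (γ u) := by
      refine hfl u b (ha.trans hu.1.le) hu.2 hbl fun t ht => ?_
      rcases ht.1.eq_or_lt with rfl | hat
      · exact (hright u ⟨ha.trans hu.1.le, hu.2.trans_lt hbl⟩).mono fun s hs => ⟨hs.1, hs.2.trans_lt hbl⟩
      · refine (hcont t ⟨ha.trans (hu.1.le.trans ht.1), ht.2.trans_lt hbl⟩ fun htΔ => ?_).mono
          fun s hs => ⟨ha.trans (hu.1.le.trans hs.1), hs.2.trans_lt hbl⟩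
        exact hat.ne' (huniq t ⟨hu.1.trans hat, ht.2⟩ htΔ)
    have h3 := hflow _ _ h1 (b - u) ⟨by linarith [hu.2], by linarith [hu.1]⟩
    rw [hyeq, ← Cover.pt_liftFlow, ← Cover.pt_liftFlow, ← h2, ← Cover.liftFlow_add,
      Cover.pt_liftFlow] at h3
    rwa [show u - a + (b - u) = b - a by ring] at h3
  · push Not at hD
    rw [hex b hab hbl hD, Cover.pt_liftFlow]
    exact .refl hη _

end CoverPseudoOrbit

/-! ### Piecewise orbits are pseudo-orbits -/

section Spacing

variable {t : ℤ → ℝ} {T : ℝ}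

lemma spacing_strictMono (hT : 0 < T) (ht : ∀ k, T ≤ t (k + 1) - t k) : StrictMono t :=
  strictMono_int_of_lt_succ fun k => by linarith [ht k]

lemma spacing_add (ht : ∀ k, T ≤ t (k + 1) - t k) (k : ℤ) (n : ℕ) : t k + n * T ≤ t (k + n) := by
  induction n with
  | zero => simp
  | succ n ih =>
    have := ht (k + n)
    push_cast
    rw [← add_assoc]
    linarith

lemma spacing_exists (hT : 0 < T) (ht : ∀ k, T ≤ t (k + 1) - t k) (s : ℝ) :
    ∃ k, s ∈ Ico (t k) (t (k + 1)) := by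
  obtain ⟨n, hn⟩ := exists_nat_gt (|s - t 0| / T)
  rw [div_lt_iff₀ hT] at hn
  have h1 := spacing_add ht 0 n
  have h2 := spacing_add ht (-n) n
  rw [neg_add_cancel] at h2
  rw [zero_add] at h1
  have hm := spacing_strictMono hT ht
  obtain ⟨k, hk, hmax⟩ := Int.exists_greatest_of_bdd (P := fun k => t k ≤ s)
    ⟨n, fun z hz => by
      by_contra hcon
      have := hm (not_le.1 hcon)
      linarith [le_abs_self (s - t 0)]⟩ ⟨-n, by linarith [neg_abs_le (s - t 0)]⟩
  refine ⟨k, hk, ?_⟩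
  by_contra hcon
  have := hmax _ (not_lt.1 hcon)
  omega

lemma spacing_unique (hT : 0 < T) (ht : ∀ k, T ≤ t (k + 1) - t k) {s : ℝ} {j k : ℤ}
    (hj : s ∈ Ico (t j) (t (j + 1))) (hk : s ∈ Ico (t k) (t (k + 1))) : j = k := by
  have hm := spacing_strictMono hT ht
  have h1 := hm.lt_iff_lt.1 (hj.1.trans_lt hk.2)
  have h2 := hm.lt_iff_lt.1 (hk.1.trans_lt hj.2)
  omega

lemma spacing_sep (hT : 0 < T) (ht : ∀ k, T ≤ t (k + 1) - t k) {s s' : ℝ}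
    (hs : s ∈ range t) (hs' : s' ∈ range t) (hne : s ≠ s') : T ≤ |s - s'| := by
  have hm := spacing_strictMono hT ht
  have key : ∀ i j, i < j → T ≤ t j - t i := fun i j hij => by
    have := hm.monotone (Int.add_one_le_of_lt hij)
    linarith [ht i]
  obtain ⟨i, rfl⟩ := hs
  obtain ⟨j, rfl⟩ := hs'
  rcases lt_trichotomy i j with h | rfl | h
  · rw [abs_sub_comm]
    exact (key _ _ h).trans (le_abs_self _)
  · exact absurd rfl hne
  · exact (key _ _ h).trans (le_abs_self _)

end Spacing

section PiecewiseOrbit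

/-- The curve `γ` follows the orbit of `x k` during `[t k, t (k + 1))`. -/
def IsPiecewiseOrbit {N : Type*} (ψ : ℝ → N → N) (t : ℤ → ℝ) (x : ℤ → N) (γ : ℝ → N) : Prop :=
  ∀ k, ∀ s ∈ Ico (t k) (t (k + 1)), γ s = ψ (s - t k) (x k)

lemma exists_isPiecewiseOrbit {N : Type*} (ψ : ℝ → N → N) (x : ℤ → N) {t : ℤ → ℝ} {T : ℝ}
    (hT : 0 < T) (ht : ∀ k, T ≤ t (k + 1) - t k) :
    ∃ γ, IsPiecewiseOrbit ψ t x γ := by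
  choose κ hκ using spacing_exists hT ht
  refine ⟨fun s => ψ (s - t (κ s)) (x (κ s)), fun k s hs => ?_⟩
  simp only [spacing_unique hT ht (hκ s) hs]

variable {N : Type*} [TopologicalSpace N] {ψ : ℝ → N → N} {t : ℤ → ℝ} {x : ℤ → N} {γ : ℝ → N}
  {T : ℝ}

namespace IsPiecewiseOrbit

lemma apply_start (hT : 0 < T) (ht : ∀ k, T ≤ t (k + 1) - t k) (hγ : IsPiecewiseOrbit ψ t x γ)
    (h0 : ∀ y, ψ 0 y = y) (k : ℤ) : γ (t k) = x k := by
  rw [hγ k (t k) ⟨le_rfl, spacing_strictMono hT ht (lt_add_one k)⟩, sub_self, h0]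

lemma continuousWithinAt (hT : 0 < T) (ht : ∀ k, T ≤ t (k + 1) - t k)
    (hγ : IsPiecewiseOrbit ψ t x γ) (hc : ∀ y, Continuous fun s => ψ s y) (s : ℝ) :
    ContinuousWithinAt γ (Ici s) s := by
  obtain ⟨k, hk⟩ := spacing_exists hT ht s
  have : ContinuousWithinAt (fun s' => ψ (s' - t k) (x k)) (Ici s) s :=
    ((hc (x k)).comp (continuous_sub_right (t k))).continuousWithinAt
  refine this.congr_of_eventuallyEq ?_ (hγ k s hk)
  filter_upwards [Ico_mem_nhdsGE hk.2] with s' hs'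
  exact hγ k s' ⟨hk.1.trans hs'.1, hs'.2⟩

lemma continuousAt (hT : 0 < T) (ht : ∀ k, T ≤ t (k + 1) - t k)
    (hγ : IsPiecewiseOrbit ψ t x γ) (hc : ∀ y, Continuous fun s => ψ s y) {s : ℝ}
    (hs : s ∉ range t) : ContinuousAt γ s := by
  obtain ⟨k, hk⟩ := spacing_exists hT ht s
  have hlt : t k < s := lt_of_le_of_ne hk.1 fun h => hs ⟨k, h⟩
  have : ContinuousAt (fun s' => ψ (s' - t k) (x k)) s :=
    ((hc (x k)).comp (continuous_sub_right (t k))).continuousAt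
  refine this.congr ?_
  filter_upwards [Ioo_mem_nhds hlt hk.2] with s' hs'
  exact (hγ k s' ⟨hs'.1.le, hs'.2⟩).symm

lemma tendsto_left (hT : 0 < T) (ht : ∀ k, T ≤ t (k + 1) - t k)
    (hγ : IsPiecewiseOrbit ψ t x γ) (hc : ∀ y, Continuous fun s => ψ s y) (k : ℤ) :
    Tendsto γ (𝓝[<] (t (k + 1))) (𝓝 (ψ (t (k + 1) - t k) (x k))) := by
  have := (((hc (x k)).comp (continuous_sub_right (t k))).tendsto (t (k + 1))).mono_left
    (nhdsWithin_le_nhds (s := Iio (t (k + 1))))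
  refine this.congr' ?_
  filter_upwards [Ioo_mem_nhdsLT (spacing_strictMono hT ht (lt_add_one k))] with s hs
  exact (hγ k s ⟨hs.1.le, hs.2⟩).symm

/-- Some of the times `t k` may carry trivial jumps, so an interval of continuity can contain
several of them. The orbit is continued across each one because continuity identifies the value with
the left limit. -/
lemma flow [T2Space N] (hT : 0 < T) (ht : ∀ k, T ≤ t (k + 1) - t k)
    (hγ : IsPiecewiseOrbit ψ t x γ) (hc : ∀ y, Continuous fun s => ψ s y) (h0 : ∀ y, ψ 0 y = y)
    (hadd : ∀ s s' y, ψ (s + s') y = ψ s' (ψ s y)) {a b : ℝ} (hab : a ≤ b)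
    (hcont : ContinuousOn γ (Icc a b)) : γ b = ψ (b - a) (γ a) := by
  obtain ⟨k₀, hk₀⟩ := spacing_exists hT ht a
  have hm := spacing_strictMono hT ht
  have key : ∀ k, k₀ ≤ k → ∀ s ∈ Ico (t k) (t (k + 1)), s ∈ Icc a b → γ s = ψ (s - a) (γ a) := by
    intro k hk
    induction k, hk using Int.leInduction with
    | base =>
      intro s hs hsab
      rw [hγ k₀ s hs, hγ k₀ a hk₀, ← hadd]
      congr 1
      ring
    | succ k hk ih =>
      intro s hs hsab
      have hat : a < t (k + 1) := hk₀.2.trans_le (hm.monotone (by omega))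
      have htb : t (k + 1) ∈ Icc a b := ⟨hat.le, hs.1.trans hsab.2⟩
      have h1 : Tendsto γ (𝓝[<] (t (k + 1))) (𝓝 (γ (t (k + 1)))) := by
        rw [← nhdsWithin_Ioo_eq_nhdsLT hat]
        exact ((hcont _ htb).mono fun u hu => ⟨hu.1.le, hu.2.le.trans htb.2⟩)
      have h2 : Tendsto γ (𝓝[<] (t (k + 1))) (𝓝 (ψ (t (k + 1) - a) (γ a))) := by
        have := (((hc (γ a)).comp (continuous_sub_right a)).tendsto (t (k + 1))).mono_left
          (nhdsWithin_le_nhds (s := Iio (t (k + 1))))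
        refine this.congr' ?_
        have hmax : max a (t k) < t (k + 1) := max_lt hat (hm (lt_add_one k))
        filter_upwards [Ioo_mem_nhdsLT hmax] with u hu
        exact (ih u ⟨(le_max_right _ _).trans hu.1.le, hu.2⟩
          ⟨(le_max_left _ _).trans hu.1.le, hu.2.le.trans htb.2⟩).symm
      have h3 := tendsto_nhds_unique h1 h2
      rw [hγ _ s hs, ← hγ.apply_start hT ht h0 (k + 1), h3, ← hadd]
      congr 1
      ring
  obtain ⟨k, hk⟩ := spacing_exists hT ht b
  exact key k (Int.lt_add_one_iff.1 (hm.lt_iff_lt.1 (hk₀.1.trans_lt (hab.trans_lt hk.2)))) b hk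
    ⟨hab, le_rfl⟩

end IsPiecewiseOrbit

end PiecewiseOrbit

section CoverPiecewise

variable {M : Type u} [MetricSpace M] [CompactSpace M] {α : CohomH1 M} {x₀ : M}
  {d : MetricSpace (Cover α x₀)}

/-- A piecewise orbit with small jumps is a pseudo-orbit of the covering. -/
lemma IsPiecewiseOrbit.isPseudoOrbit (hd : IsLiftedMetric d) {φ : Flow ℝ M} {ε T : ℝ} (hT : 0 < T)
    {t : ℤ → ℝ} {x : ℤ → Cover α x₀} {γ : ℝ → Cover α x₀} (ht0 : t 0 = 0)
    (ht : ∀ k, T ≤ t (k + 1) - t k) (hγ : IsPiecewiseOrbit (liftFlow φ) t x γ)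
    (hj : ∀ k, 0 ≤ k → d.dist (x (k + 1)) (liftFlow φ (t (k + 1) - t k) (x k)) < ε)
    {n : ℤ} (hn : 0 < n) : IsPseudoOrbit d.dist (liftFlow φ) ε T (t n) γ := by
  have := Cover.t2Space hd
  have hm := spacing_strictMono hT ht
  have hc := Cover.continuous_liftFlow (α := α) (x₀ := x₀) φ
  have hright := hγ.continuousWithinAt hT ht hc
  -- Only `t k` with `0 < k < n` are jump times: `t 0` is the start, and the first jump `t 1` is at
  -- least `T`.
  refine ⟨ht0 ▸ hm hn, fun s _ => (hright s).mono Ico_subset_Ici_self,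
    t '' Ioo 0 n, (finite_Ioo 0 n).image _, ?_, ?_, ?_, ?_, ?_, ?_⟩
  · rintro _ ⟨k, hk, rfl⟩
    exact ⟨ht0 ▸ (hm hk.1).le, hm hk.2⟩
  · rw [Set.disjoint_left]
    rintro _ ⟨k, hk, rfl⟩ h
    have h1 := hm.monotone (Int.add_one_le_of_lt hk.1)
    have h2 := ht 0
    linarith [h.2]
  · intro s hs hsΔ
    rcases hs.1.eq_or_lt with rfl | hs0
    · exact (hright 0).mono Ico_subset_Ici_self
    · refine (hγ.continuousAt hT ht hc ?_).continuousWithinAt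
      rintro ⟨k, rfl⟩
      exact hsΔ ⟨k, ⟨hm.lt_iff_lt.1 (ht0.symm ▸ hs0), hm.lt_iff_lt.1 hs.2⟩, rfl⟩
  · intro s hs s' hs'
    exact spacing_sep hT ht (image_subset_range _ _ hs) (image_subset_range _ _ hs')
  · intro a b _ hab _ hcont
    exact hγ.flow hT ht hc (Cover.liftFlow_zero φ) (Cover.liftFlow_add φ) hab hcont
  · rintro _ ⟨k, hk, rfl⟩
    have h1 := hγ.tendsto_left hT ht hc (k - 1)
    have h2 := hj (k - 1) (by have := hk.1; omega)
    rw [sub_add_cancel] at h1 h2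
    refine ⟨_, h1, ?_⟩
    rw [hγ.apply_start hT ht (Cover.liftFlow_zero φ)]
    exact h2

end CoverPiecewise

section BasePiecewise

variable {M : Type*} [MetricSpace M]

lemma flow_continuous_time (φ : Flow ℝ M) (y : M) : Continuous fun s => φ s y :=
  φ.continuous continuous_id continuous_const

lemma flow_add_swap (φ : Flow ℝ M) (s s' : ℝ) (y : M) : φ (s + s') y = φ s' (φ s y) := by
  rw [add_comm, Flow.map_add]

/-- A periodic piecewise orbit with small jumps is a periodic pseudo-orbit. -/
lemma IsPiecewiseOrbit.isPeriodicPseudoOrbit {φ : Flow ℝ M} {ε T l : ℝ} (hT : 0 < T)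
    {t : ℤ → ℝ} {x : ℤ → M} {γ : ℝ → M} (ht0 : t 0 = 0) (ht : ∀ k, T ≤ t (k + 1) - t k)
    (hγ : IsPiecewiseOrbit (fun s y => φ s y) t x γ) {n : ℤ} (hn : 0 < n)
    (hj : ∀ k, dist (x (k + 1)) (φ (t (k + 1) - t k) (x k)) < ε)
    (htn : ∀ k, t (k + n) = t k + l) (hxn : ∀ k, x (k + n) = x k) :
    IsPeriodicPseudoOrbit φ ε T l γ := by
  have hm := spacing_strictMono hT ht
  have hl : t n = l := by simpa [ht0] using htn 0
  have hc := flow_continuous_time φ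
  have hper : ∀ s, γ (s + l) = γ s := by
    intro s
    obtain ⟨k, hk⟩ := spacing_exists hT ht s
    rw [hγ k s hk, hγ (k + n) (s + l), htn, hxn]
    · congr 1
      ring
    · rw [add_right_comm, htn, htn]
      exact ⟨by linarith [hk.1], by linarith [hk.2]⟩
  refine ⟨hl ▸ ht0 ▸ hm hn, hper, hγ.continuousWithinAt hT ht hc, range t, fun s => ⟨?_, ?_⟩, ?_,
    fun s hs => hγ.continuousAt hT ht hc hs, fun s hs s' hs' => spacing_sep hT ht hs hs', ?_, ?_⟩
  · rintro ⟨k, hk⟩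
    refine ⟨k - n, ?_⟩
    have := htn (k - n)
    rw [sub_add_cancel] at this
    linarith
  · rintro ⟨k, rfl⟩
    exact ⟨k + n, htn k⟩
  · refine ((finite_Ico 0 n).image t).subset ?_
    rintro _ ⟨⟨k, rfl⟩, hk⟩
    exact ⟨k, ⟨hm.le_iff_le.1 (ht0.symm ▸ hk.1), hm.lt_iff_lt.1 (hl.symm ▸ hk.2)⟩, rfl⟩
  · intro a b hab hcont
    exact hγ.flow hT ht hc (fun y => φ.map_zero_apply y) (flow_add_swap φ) hab hcont
  · rintro _ ⟨k, rfl⟩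
    have h1 := hγ.tendsto_left hT ht hc (k - 1)
    have h2 := hj (k - 1)
    rw [sub_add_cancel] at h1 h2
    refine ⟨_, h1, ?_⟩
    rw [hγ.apply_start hT ht (fun y => φ.map_zero_apply y)]
    exact h2

end BasePiecewise

/-! ### Closed chains and their realizations -/

section ClosedChain

variable {M : Type*} [MetricSpace M] {A : Type*} [AddCommGroup A]

/-- A closed chain of `n` orbit arcs of lengths `τ k ≥ T`, with `ε`-small jumps; the increments of
the height over the steps are `w k`. -/
structure IsClosedChain (Θ : PathCocycle M A) (φ : Flow ℝ M) (ε T : ℝ) (n : ℕ) (m : ℕ → M)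
    (τ : ℕ → ℝ) (w : ℕ → A) : Prop where
  pos : 0 < n
  closed : m n = m 0
  le : ∀ k < n, T ≤ τ k
  near : ∀ k < n, Θ.Near ε (Θ.skew φ (τ k) (m k, 0)) (m (k + 1), w k)

/-- A closed chain, as a periodic sequence indexed by the integers. -/
structure IsPeriodicChain (Θ : PathCocycle M A) (φ : Flow ℝ M) (ε T l : ℝ) (n : ℕ) (x : ℤ → M)
    (t : ℤ → ℝ) (w : ℤ → A) : Prop where
  pos : 0 < n
  start : t 0 = 0
  le : ∀ k, T ≤ t (k + 1) - t k
  near : ∀ k, Θ.Near ε (Θ.skew φ (t (k + 1) - t k) (x k, 0)) (x (k + 1), w k)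
  time_add : ∀ k, t (k + n) = t k + l
  point_add : ∀ k, x (k + n) = x k
  height_add : ∀ k, w (k + n) = w k

variable {Θ : PathCocycle M A} {φ : Flow ℝ M} {ε T : ℝ}

lemma IsClosedChain.exists_periodic {n : ℕ} {m : ℕ → M} {τ : ℕ → ℝ} {w : ℕ → A}
    (h : IsClosedChain Θ φ ε T n m τ w) : ∃ x t W,
      IsPeriodicChain Θ φ ε T (∑ k ∈ Finset.range n, τ k) n x t W ∧ x 0 = m 0 ∧
        ∀ k < n, W k = w k := by
  have hn : (0 : ℤ) < n := by exact_mod_cast h.pos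
  set l := ∑ k ∈ Finset.range n, τ k
  let r : ℤ → ℕ := fun k => (k % n).toNat
  have hr : ∀ k, r k < n := fun k => by
    have := Int.emod_lt_of_pos k hn
    have := Int.emod_nonneg k hn.ne'
    simp only [r]
    omega
  have hrn : ∀ k, r (k + n) = r k := fun k => by simp [r]
  -- Quotient and remainder by `n` count full turns and the position within a turn. The step from
  -- remainder `n - 1` back to `0` is where closedness of the chain enters.
  let t : ℤ → ℝ := fun k => ((k / n : ℤ) : ℝ) * l + ∑ i ∈ Finset.range (r k), τ i
  have hstep : ∀ k, m (r (k + 1)) = m (r k + 1) ∧ t (k + 1) - t k = τ (r k) := by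
    intro k
    have h1 := Int.emod_lt_of_pos k hn
    have h2 := Int.emod_nonneg k hn.ne'
    have h3 := Int.emod_add_mul_ediv k n
    by_cases hk : k % n + 1 < n
    · obtain ⟨e1, e2⟩ := (Int.ediv_emod_unique (a := k + 1) (r := k % n + 1) (q := k / n) hn).2
        ⟨by linarith, by omega, hk⟩
      have e3 : r (k + 1) = r k + 1 := by simp only [r, e2]; omega
      refine ⟨by rw [e3], ?_⟩
      simp only [t, e1, e3, Finset.sum_range_succ]
      ring
    · obtain ⟨e1, e2⟩ := (Int.ediv_emod_unique (a := k + 1) (r := 0) (q := k / n + 1) hn).2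
        ⟨by rw [mul_add]; omega, le_rfl, hn⟩
      have e3 : r (k + 1) = 0 := by simp only [r, e2]; rfl
      have e4 : n = r k + 1 := by simp only [r]; omega
      refine ⟨by rw [e3, ← e4, h.closed], ?_⟩
      have e5 : l = ∑ i ∈ Finset.range (r k), τ i + τ (r k) := by
        rw [← Finset.sum_range_succ, ← e4]
      simp only [t, e1, e3, Finset.sum_range_zero]
      push_cast
      linear_combination e5
  refine ⟨fun k => m (r k), t, fun k => w (r k), ⟨h.pos, by simp [t, r], fun k => ?_, fun k => ?_,
    fun k => ?_, fun k => by simp only [hrn], fun k => by simp only [hrn]⟩, by simp [r], fun k hk => ?_⟩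
  · rw [(hstep k).2]
    exact h.le _ (hr k)
  · rw [(hstep k).2, (hstep k).1]
    exact h.near _ (hr k)
  · have : (k + n) / (n : ℤ) = k / n + 1 := by
      rw [Int.add_ediv_of_dvd_right (dvd_refl _), Int.ediv_self hn.ne']
    simp only [t, hrn, this]
    push_cast
    ring
  · have : r k = k := by
      simp only [r]
      rw [Int.emod_eq_of_lt (by omega) (by exact_mod_cast hk)]
      rfl
    show w (r k) = w k
    rw [this]

lemma PathCocycle.concat_monotone {p q : C(unitInterval, M)} (h : p 1 = q 0) {f : M → ℝ}
    (hp : Monotone fun s => f (p s)) (hq : Monotone fun s => f (q s)) :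
    Monotone fun s => f (PathCocycle.concat p q h s) := by
  have he : ∀ {p : C(unitInterval, M)}, (Monotone fun s => f (p s)) →
      Monotone fun s => f (PathCocycle.extend p s) :=
    fun hp => hp.comp (monotone_projIcc zero_le_one)
  intro s s' hs
  have hs' : (s : ℝ) ≤ s' := hs
  simp only [PathCocycle.concat_apply]
  split_ifs with h1 h2 h2
  · exact he hp (by linarith)
  · have e1 : f (PathCocycle.extend p (2 * s)) ≤ f (p 1) := hp unitInterval.le_one'
    have e2 : f (q 0) ≤ f (PathCocycle.extend q (2 * s' - 1)) := hq unitInterval.nonneg'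
    rw [h] at e1
    exact e1.trans e2
  · linarith
  · exact he hq (by linarith)

/-- The points of `M × ℝ` through which a realization of `γ` may pass. -/
def IsRealizationPoint (ε : ℝ) (γ : ℝ → M) (z : M × ℝ) : Prop :=
  (ContinuousAt γ z.2 → z.1 = γ z.2) ∧ (¬ ContinuousAt γ z.2 → z.1 ∈ Metric.ball (γ z.2) ε)

variable (Θ) in
/-- Jumps can be realized by curves that are constant when there is no jump. -/
lemma LocallyContracts.exists_jump [CompactSpace M] (hM : LocallyContracts M) :
    ∃ ρ > 0, ∀ ε ≤ ρ, ∀ X Y : M × A, Θ.Near ε X Y → ∃ q : C(unitInterval, M), q 0 = X.1 ∧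
      q 1 = Y.1 ∧ (∀ s, dist (q s) Y.1 < ε) ∧ Y.2 = X.2 + Θ q ∧ (X.1 = Y.1 → ∀ s, q s = Y.1) := by
  obtain ⟨ρ, hρ, hF⟩ := hM.exists_primitive Θ
  refine ⟨ρ, hρ, fun ε hε X Y h => ?_⟩
  have hd := h.dist_lt
  obtain ⟨p, hp0, hp1, hp, hp2⟩ := h
  -- When the ends coincide `γ` has no discontinuity there, so the realization must stand still.
  -- Replacing the small loop by a constant does not change the height, because a local primitive
  -- exists.
  by_cases hXY : X.1 = Y.1
  · obtain ⟨F, hF⟩ := hF Y.1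
    have h1 := hF p fun s => (hp s).trans_le hε
    rw [hp0, hp1, hXY, sub_self] at h1
    refine ⟨.const _ Y.1, hXY.symm, rfl, fun s => ?_, ?_, fun _ _ => rfl⟩
    · rw [hXY] at hd
      exact hd
    · rw [Θ.const, hp2, h1]
  · exact ⟨p, hp0, hp1, hp, hp2, fun h => absurd h hXY⟩

variable (Θ) in
/-- Realization of a finite part of a piecewise orbit. -/
lemma LocallyContracts.exists_realization [CompactSpace M] (hM : LocallyContracts M) :
    ∃ ρ > 0, ∀ ε ≤ ρ, ∀ T > 0, ∀ (x : ℤ → M) (t : ℤ → ℝ) (w : ℤ → A) (γ : ℝ → M),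
      (∀ k, T ≤ t (k + 1) - t k) →
      (∀ k, Θ.Near ε (Θ.skew φ (t (k + 1) - t k) (x k, 0)) (x (k + 1), w k)) →
      IsPiecewiseOrbit (fun s y => φ s y) t x γ → ∀ n : ℕ, ∃ δ : C(unitInterval, M × ℝ),
        δ 0 = (x 0, t 0) ∧ δ 1 = (x n, t n) ∧ (Monotone fun s => (δ s).2) ∧
        (∀ s, IsRealizationPoint ε γ (δ s)) ∧
        (Θ.comap (⟨Prod.fst, continuous_fst⟩ : C(M × ℝ, M))) δ = ∑ k ∈ Finset.range n, w k := by
  obtain ⟨ρ, hρ, hjump⟩ := hM.exists_jump Θ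
  refine ⟨ρ, hρ, fun ε hε T hT x t w γ ht hx hγ n => ?_⟩
  have hε0 : 0 < ε := dist_nonneg.trans_lt (hx 0).dist_lt
  have hstart : ∀ k, γ (t k) = x k := hγ.apply_start hT ht fun y => φ.map_zero_apply y
  induction n with
  | zero =>
    refine ⟨.const _ (x 0, t 0), rfl, by simp, monotone_const, fun s => ?_, ?_⟩
    · exact ⟨fun _ => (hstart 0).symm, fun _ => by simp [hstart, hε0]⟩
    · rw [PathCocycle.const]
      simp
  | succ n ih =>
    obtain ⟨δ, hδ0, hδ1, hδm, hδr, hδe⟩ := ih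
    obtain ⟨q, hq0, hq1, hq, hq2, hqc⟩ := hjump ε hε _ _ (hx n)
    simp only [PathCocycle.skew_fst, PathCocycle.skew_snd, zero_add] at hq0 hq1 hq hq2 hqc
    set a := t ((n : ℤ) + 1) - t n
    have ha : 0 < a := hT.trans_le (ht n)
    -- The second coordinate is the clock of the realization: it runs along the orbit arc `o` and
    -- stops during the jump `j`.
    let o : C(unitInterval, M × ℝ) := ⟨fun s => (φ (s * a) (x n), t n + s * a),
      (φ.continuous (by fun_prop) continuous_const).prodMk (by fun_prop)⟩
    let j : C(unitInterval, M × ℝ) := ⟨fun s => (q s, t ((n : ℤ) + 1)), by fun_prop⟩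
    have h1 : δ 1 = o 0 := by simp [hδ1, o]
    have h2 : PathCocycle.concat δ o h1 1 = j 0 := by simp [o, j, hq0, a]
    have hleft := hγ.tendsto_left hT ht (flow_continuous_time φ) n
    have hor : ∀ s, IsRealizationPoint ε γ (o s) := by
      intro s
      -- At the end of the arc the clock already shows the next jump time while the point is still
      -- the left limit of `γ`.
      rcases s.2.2.eq_or_lt with hs | hs
      · have e : o s = (φ a (x n), t ((n : ℤ) + 1)) := by
          simp only [o, ContinuousMap.coe_mk, hs, one_mul, a, add_sub_cancel]
        rw [e]
        refine ⟨fun hc => ?_, fun _ => ?_⟩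
        · exact tendsto_nhds_unique hleft (hc.tendsto.mono_left nhdsWithin_le_nhds)
        · have := hq 0
          rw [hq0] at this
          simpa [hstart] using this
      · have e := hγ n (t n + s * a) ⟨by nlinarith [s.2.1], by
          simp only [a]; nlinarith [s.2.1]⟩
        rw [add_sub_cancel_left] at e
        exact ⟨fun _ => e.symm, fun _ => by
          show φ (s * a) (x n) ∈ Metric.ball (γ (t n + s * a)) ε
          rw [e]
          exact Metric.mem_ball_self hε0⟩
    have hjr : ∀ s, IsRealizationPoint ε γ (j s) := by
      intro s
      refine ⟨fun hc => ?_, fun _ => ?_⟩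
      · have e := tendsto_nhds_unique hleft (hc.tendsto.mono_left nhdsWithin_le_nhds)
        simp only [j, ContinuousMap.coe_mk] at e ⊢
        rw [hstart] at e ⊢
        exact hqc e s
      · simpa [j, hstart] using hq s
    refine ⟨PathCocycle.concat (PathCocycle.concat δ o h1) j h2, by simp [hδ0], ?_, ?_, ?_, ?_⟩
    · simp [j, hq1]
    · refine PathCocycle.concat_monotone (f := Prod.snd) _
        (PathCocycle.concat_monotone (f := Prod.snd) _ hδm ?_) ?_
      · intro s s' hs
        have : (s : ℝ) ≤ s' := hs
        simp only [o, ContinuousMap.coe_mk]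
        nlinarith
      · exact monotone_const
    · exact PathCocycle.concat_forall _ (PathCocycle.concat_forall _ hδr hor) hjr
    · rw [PathCocycle.concat_eq, PathCocycle.concat_eq, hδe, Finset.sum_range_succ, hq2, add_assoc]
      congr 2
      show Θ _ = Θ _
      congr 1
      ext s
      simp [o, PathCocycle.orbit]

end ClosedChain

/-! ### Closed chains against periodic pseudo-orbits and quasi-Lyapunov maps -/

section Class

variable {M : Type u} [MetricSpace M] [CompactSpace M]

/-- A closed chain with small jumps yields a periodic pseudo-orbit with a realization. -/
lemma LocallyContracts.exists_periodicPseudoOrbit (hM : LocallyContracts M) (φ : Flow ℝ M)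
    (α : CohomH1 M) : ∃ ρ > 0, ∀ ε ≤ ρ, ∀ T > 0, ∀ (n : ℕ) (m : ℕ → M) (τ : ℕ → ℝ) (w : ℕ → ℝ),
      IsClosedChain (cohomCocycle α) φ ε T n m τ w → ∃ (l : ℝ) (γ : ℝ → M) (h : H1 M),
        IsPeriodicPseudoOrbit φ ε T l γ ∧ γ 0 = m 0 ∧ IsClassOf ε l γ h ∧
          α h = ∑ k ∈ Finset.range n, w k := by
  obtain ⟨ρ, hρ, hreal⟩ := hM.exists_realization (cohomCocycle α) (φ := φ)
  refine ⟨ρ, hρ, fun ε hε T hT n m τ w hc => ?_⟩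
  obtain ⟨x, t, W, hp, hx0, hW⟩ := hc.exists_periodic
  obtain ⟨γ, hγ⟩ := exists_isPiecewiseOrbit (fun s y => φ s y) x hT hp.le
  obtain ⟨δ, hδ0, hδ1, hδm, hδr, hδe⟩ := hreal ε hε T hT x t W γ hp.le hp.near hγ n
  have hn : (0 : ℤ) < n := by exact_mod_cast hp.pos
  have hxn : x n = x 0 := by simpa using hp.point_add 0
  have htn : t n = ∑ k ∈ Finset.range n, τ k := by simpa [hp.start] using hp.time_add 0
  let δ₁ : C(unitInterval, M) := (⟨Prod.fst, continuous_fst⟩ : C(M × ℝ, M)).comp δ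
  have hδ₁ : δ₁ 0 = δ₁ 1 := by simp [δ₁, hδ0, hδ1, hxn]
  obtain ⟨h, hh⟩ := exists_isHomologyClass_of_closed hδ₁
  refine ⟨_, γ, h, hγ.isPeriodicPseudoOrbit hT hp.start hp.le hn (fun k => ?_) hp.time_add
    hp.point_add, ?_, ⟨δ₁, ⟨hδ₁, fun s => (δ s).2, by fun_prop, hδm, ?_, ?_, fun s => hδr s⟩, hh⟩, ?_⟩
  · have := (hp.near k).dist_lt
    rwa [dist_comm] at this
  · have := hγ.apply_start hT hp.le (fun y => φ.map_zero_apply y) 0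
    rwa [hp.start, hx0] at this
  · simp [hδ0, hp.start]
  · simp [hδ1, htn]
  · rw [← homCocycle_eq hh]
    refine Eq.trans ?_ (hδe.trans (Finset.sum_congr rfl fun k hk => hW k (Finset.mem_range.1 hk)))
    rfl

variable [ConnectedSpace M] {α : CohomH1 M} {x₀ : M} {d : MetricSpace (Cover α x₀)}

/-- If an equivariant map is quasi-Lyapunov then `α` is nonpositive on closed chains. -/
lemma sum_nonpos_of_isQuasiLyapunovWith (hM : LocallyContracts M) (hd : IsLiftedMetric d)
    {φ : Flow ℝ M} {T : ℝ} (hT : 0 < T) {C : ℝ} {f : Cover α x₀ → ℝ} (hf : IsEquivariant f)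
    (hQ : IsQuasiLyapunovWith φ T d C f) : ∃ ρ > 0, ∀ (n : ℕ) (m : ℕ → M) (τ : ℕ → ℝ) (w : ℕ → ℝ),
      IsClosedChain (cohomCocycle α) φ ρ T n m τ w → ∑ k ∈ Finset.range n, w k ≤ 0 := by
  obtain ⟨ε, hε, hQ⟩ := hQ
  obtain ⟨r, hr0, hr⟩ := hd.isometric
  refine ⟨min ε (r / 4), by positivity, fun n m τ w hc => ?_⟩
  obtain ⟨x, t, W, hp, hx0, hW⟩ := hc.exists_periodic
  have hnext : ∀ (k : ℕ) (y : {y : Cover α x₀ // y.proj = x k}),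
      ∃ z : {z : Cover α x₀ // z.proj = x (k + 1 : ℕ)}, z.1.height = y.1.height + W k ∧
        d.dist z.1 (liftFlow φ (t ((k : ℤ) + 1) - t k) y.1) < ε := by
    rintro k ⟨y, hy⟩
    have h1 := (hp.near k).raise y.height
    rw [← PathCocycle.skew_raise] at h1
    have h2 : PathCocycle.raise y.height (x k, (0 : ℝ)) = y.pt := by
      simp [PathCocycle.raise, Cover.pt, hy]
    rw [h2, ← Cover.pt_liftFlow] at h1
    obtain ⟨z, hz, -, hz2⟩ := Cover.exists_near_lift hd hr
      (by linarith [min_le_right ε (r / 4)]) _ h1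
    refine ⟨⟨z, by push_cast; exact congrArg Prod.fst hz⟩, ?_, ?_⟩
    · have : z.height = W k + y.height := congrArg Prod.snd hz
      rw [this, add_comm]
    · rw [show d.dist z _ = d.dist _ z from d.dist_comm _ _]
      exact hz2.trans_le (min_le_left _ _)
  choose next hnext_height hnext_dist using hnext
  obtain ⟨y₀, hy₀⟩ := Cover.proj_surjective (α := α) (x₀ := x₀) hd hM (x 0)
  let Y : ∀ k : ℕ, {y : Cover α x₀ // y.proj = x k} := fun k =>
    Nat.rec ⟨y₀, hy₀⟩ (fun k y => next k y) k
  have hheight : ∀ N, (Y N).1.height = y₀.height + ∑ k ∈ Finset.range N, W k := by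
    intro N
    induction N with
    | zero => simp [Y]
    | succ N ih =>
      rw [Finset.sum_range_succ, ← add_assoc, ← ih]
      exact hnext_height N (Y N)
  -- Negative indices all receive the starting point; the resulting piece of curve at negative times
  -- plays no role.
  obtain ⟨γ, hγ⟩ := exists_isPiecewiseOrbit (liftFlow φ) (fun k : ℤ => (Y k.toNat).1) hT hp.le
  have hpo : ∀ N : ℤ, 0 < N → IsPseudoOrbit d.dist (liftFlow φ) ε T (t N) γ := fun N hN =>
    hγ.isPseudoOrbit hd hT hp.start hp.le (fun k hk => by
      obtain ⟨k, rfl⟩ := Int.eq_ofNat_of_zero_le hk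
      exact hnext_dist k (Y k)) hN
  have hstart := hγ.apply_start hT hp.le (Cover.liftFlow_zero φ)
  have hm := spacing_strictMono hT hp.le
  have hxj : ∀ j : ℕ, x (j * n : ℕ) = x 0 := by
    intro j
    induction j with
    | zero => simp
    | succ j ih =>
      rw [← ih, ← hp.point_add (j * n : ℕ)]
      congr 1
      push_cast
      ring
  have hWj : ∀ j : ℕ, ∑ k ∈ Finset.range (j * n), W k = j * ∑ k ∈ Finset.range n, w k := by
    have hWp : ∀ (j k : ℕ), W (j * n + k : ℕ) = W k := by
      intro j k
      induction j with
      | zero => simp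
      | succ j ih =>
        rw [← ih, ← hp.height_add (j * n + k : ℕ)]
        congr 1
        push_cast
        ring
    intro j
    induction j with
    | zero => simp
    | succ j ih =>
      rw [add_mul, one_mul, Finset.sum_range_add, ih]
      simp only [hWp]
      rw [Finset.sum_congr rfl fun k hk => hW k (Finset.mem_range.1 hk)]
      push_cast
      ring
  have hbound : ∀ j : ℕ, j * ∑ k ∈ Finset.range n, w k ≤ C := by
    intro j
    -- One extra arc is taken because the time `t (j * n)` must be strictly less than the length.
    -- After `j` turns the lift is a translate of its start, with height gain `j` times the sum.
    have h1 := hQ _ γ (hpo ((j * n : ℕ) + 1) (by positivity)) (t (j * n : ℕ))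
      ⟨hp.start ▸ hm.monotone (by positivity), hm (lt_add_one _)⟩
    have h0 := hstart 0
    rw [hp.start] at h0
    rw [h0, hstart] at h1
    obtain ⟨h, hh⟩ := Cover.exists_isTranslate (x := y₀) (y := (Y (j * n)).1)
      (by rw [(Y (j * n)).2, hxj, hy₀])
    have h2 := hf h _ _ hh
    have h3 : (Y (j * n)).1.height = y₀.height + α h := congrArg Prod.snd (Cover.pt_of_isTranslate hh)
    rw [hheight, hWj] at h3
    have h4 : f (Y (j * n)).1 - C ≤ f y₀ := h1
    linarith
  by_contra hcon
  push Not at hcon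
  obtain ⟨j, hj⟩ := exists_nat_gt (C / ∑ k ∈ Finset.range n, w k)
  rw [div_lt_iff₀ hcon] at hj
  linarith [hbound j]

end Class

/-! ### Walks in a finite weighted graph -/

section Walk

/-- A walk in a finite weighted graph all of whose short closed walks have weight at most `-s` has
at most linearly growing weight, with slope `-s` over the number of vertices. -/
lemma walk_sum_le {V : Type*} [Fintype V] {E : V → V → ℝ → Prop} {B s : ℝ} (hB : 0 ≤ B)
    (hs : 0 ≤ s) (hE : ∀ a b w, E a b w → w ≤ B)
    (hcl : ∀ (n : ℕ) (v : ℕ → V) (w : ℕ → ℝ), 0 < n → n ≤ Fintype.card V →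
      (∀ k < n, E (v k) (v (k + 1)) (w k)) → v n = v 0 → ∑ k ∈ Finset.range n, w k ≤ -s)
    (n : ℕ) : ∀ (v : ℕ → V) (w : ℕ → ℝ), (∀ k < n, E (v k) (v (k + 1)) (w k)) →
      ∑ k ∈ Finset.range n, w k ≤
        Fintype.card V * B + s - s / Fintype.card V * n := by
  induction n using Nat.strong_induction_on with
  | _ n ih =>
    intro v w hv
    set K := Fintype.card V
    have hK : (0 : ℝ) < K := by exact_mod_cast Fintype.card_pos_iff.2 ⟨v 0⟩
    rcases le_or_gt n K with hn | hn
    · have h1 : ∑ k ∈ Finset.range n, w k ≤ n * B := by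
        have := Finset.sum_le_card_nsmul (Finset.range n) w B fun k hk =>
          hE _ _ _ (hv k (Finset.mem_range.1 hk))
        simpa using this
      have hn' : (n : ℝ) ≤ K := by exact_mod_cast hn
      have h2 : s / K * n ≤ s := by
        rw [div_mul_eq_mul_div, div_le_iff₀ hK]
        gcongr
      have h3 : n * B ≤ K * B := by gcongr
      linarith
    · obtain ⟨a, b, hab, hbK, hvab⟩ : ∃ a b : ℕ, a < b ∧ b ≤ K ∧ v a = v b := by
        obtain ⟨i, j, hij, he⟩ := Fintype.exists_ne_map_eq_of_card_lt
          (fun i : Fin (K + 1) => v i) (by simp [K])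
        rcases lt_or_gt_of_ne (Fin.val_ne_of_ne hij) with h | h
        · exact ⟨i, j, h, by omega, he⟩
        · exact ⟨j, i, h, by omega, he.symm⟩
      obtain ⟨c, rfl⟩ := Nat.exists_eq_add_of_lt hab
      obtain ⟨r, rfl⟩ := Nat.exists_eq_add_of_le (hbK.trans hn.le)
      set c' := c + 1
      have hb : a + c + 1 = a + c' := rfl
      rw [hb] at *
      have h1 := hcl c' (fun k => v (a + k)) (fun k => w (a + k)) (by omega) (by omega)
        (fun k hk => hv (a + k) (by omega)) hvab.symm
      have h2 := ih (a + r) (by omega) (fun k => if k ≤ a then v k else v (k + c'))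
        (fun k => if k < a then w k else w (k + c')) (fun k hk => by
          rcases lt_trichotomy k a with h | h | h
          · have := hv k (by omega)
            simpa [h, h.le, Nat.succ_le_of_lt h] using this
          · have := hv (a + c') (by omega)
            have e : v a = v (a + c') := hvab
            rw [← e] at this
            subst h
            simpa [add_right_comm] using this
          · have := hv (k + c') (by omega)
            simp only [h.not_ge, h.not_gt, if_false, show ¬ k + 1 ≤ a by omega]
            rwa [add_right_comm])
      rw [Finset.sum_range_add] at h2
      rw [Finset.sum_range_add, Finset.sum_range_add]
      have h3 : ∀ k ∈ Finset.range a, (if k < a then w k else w (k + c')) = w k := fun k hk => by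
        simp [Finset.mem_range.1 hk]
      have h4 : ∀ k ∈ Finset.range r, (if a + k < a then w (a + k) else w (a + k + c')) =
          w (a + c' + k) := fun k _ => by
        simp [add_right_comm]
      rw [Finset.sum_congr rfl h3, Finset.sum_congr rfl h4] at h2
      have h5 : s / K * c' ≤ s := by
        have : (c' : ℝ) ≤ K := by exact_mod_cast (show c' ≤ K by omega)
        rw [div_mul_eq_mul_div, div_le_iff₀ hK]
        gcongr
      push_cast at h2 ⊢
      nlinarith

end Walk

/-! ### Height drift along chains, by shadowing in a finite graph -/

section Drift

variable {M : Type*} [MetricSpace M]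

lemma IsClosedChain.mono {A : Type*} [AddCommGroup A] {Θ : PathCocycle M A} {φ : Flow ℝ M}
    {ε ε' T T' : ℝ} {n : ℕ} {m : ℕ → M} {τ : ℕ → ℝ} {w : ℕ → A}
    (h : IsClosedChain Θ φ ε T n m τ w) (hε : ε ≤ ε') (hT : T' ≤ T) :
    IsClosedChain Θ φ ε' T' n m τ w :=
  ⟨h.pos, h.closed, fun k hk => hT.trans (h.le k hk), fun k hk => (h.near k hk).mono hε⟩

/-- Finiteness turns strict negativity into a uniform gap; when only nonpositivity is known, the
value `s = 0` is kept. Both cases are needed later. -/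
lemma exists_le_neg_of_finite {F : Set ℝ} (hF : F.Finite) (h0 : ∀ x ∈ F, x ≤ 0) :
    ∃ s ≥ 0, ((∀ x ∈ F, x < 0) → 0 < s) ∧ ∀ x ∈ F, x ≤ -s := by
  by_cases h : ∀ x ∈ F, x < 0
  · rcases F.eq_empty_or_nonempty with rfl | hne
    · exact ⟨1, by norm_num, by simp, by simp⟩
    · obtain ⟨a, ha, hmax⟩ := hF.exists_maximalFor id F hne
      refine ⟨-a, by linarith [h a ha], fun _ => by linarith [h a ha], fun x hx => ?_⟩
      rw [neg_neg]
      rcases le_total x a with hxa | hxa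
      · exact hxa
      · exact hmax hx hxa
  · exact ⟨0, le_rfl, fun h' => absurd h' h, by simpa using h0⟩

/-- If heights never increase along closed chains, then they are bounded above along chains of long
arcs; if they decrease along closed chains, then they decrease linearly along chains. -/
lemma LocallyContracts.exists_drift [CompactSpace M] [Nonempty M] (hM : LocallyContracts M)
    (Θ : PathCocycle M ℝ) (φ : Flow ℝ M) {L ε lam : ℝ} (hε : 0 < ε) (hlam : 0 < lam)
    (hL : 0 ≤ L) {g : M → ℝ} {W : Set ℝ} (hW : W.Finite)
    (hg : ∀ X Y : M × ℝ, Θ.Near lam X Y → Y.2 - g Y.1 - (X.2 - g X.1) ∈ W)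
    (hgφ : ∀ X : M × ℝ, ∀ t ∈ Icc 0 (3 * L),
      (Θ.skew φ t X).2 - g (Θ.skew φ t X).1 - (X.2 - g X.1) ∈ W)
    (hcl : ∀ (n : ℕ) (m : ℕ → M) (τ w : ℕ → ℝ), IsClosedChain Θ φ ε L n m τ w →
      ∑ k ∈ Finset.range n, w k ≤ 0) :
    ∃ η > 0, ∃ B c : ℝ, ((∀ (n : ℕ) (m : ℕ → M) (τ w : ℕ → ℝ),
        IsClosedChain Θ φ ε L n m τ w → ∑ k ∈ Finset.range n, w k < 0) → 0 < c) ∧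
      0 ≤ c ∧ ∀ (n : ℕ) (X : ℕ → M × ℝ) (τ : ℕ → ℝ), (∀ k < n, τ k ∈ Icc L (3 * L)) →
        (∀ k < n, Θ.Near η (Θ.skew φ (τ k) (X k)) (X (k + 1))) →
        (X n).2 - g (X n).1 - ((X 0).2 - g (X 0).1) ≤ B - c * n := by
  set ε' := min ε lam
  have hε' : 0 < ε' := lt_min hε hlam
  obtain ⟨δ, hδ, hflow⟩ := Θ.exists_near_flow φ (η := ε' / 3) (by positivity) (3 * L)
  set η' := min (δ / 2) (ε' / 3)
  have hη' : 0 < η' := by positivity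
  obtain ⟨ρ, hρ, hpath⟩ := hM.exists_path hη'
  obtain ⟨P, -, hPfin, hP⟩ := isCompact_univ.finite_cover_balls (X := M) hρ
  have hcenter : ∀ x : M, ∃ p : P, dist x p < ρ := fun x => by
    obtain ⟨p, hp, hx⟩ := mem_iUnion₂.1 (hP (mem_univ x))
    exact ⟨⟨p, hp⟩, hx⟩
  have : Fintype P := hPfin.fintype
  have hcell : ∀ X : M × ℝ, ∃ (p : P) (z : ℝ), Θ.Near η' X (p, z) := fun X => by
    obtain ⟨p, hp⟩ := hcenter X.1
    obtain ⟨c, hc0, hc1, hc⟩ := hpath _ _ hp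
    exact ⟨p, X.2 + Θ c, c, hc0, hc1, hc, rfl⟩
  -- Vertices are net points placed at height `g p`, and the weight of an edge is the gain of
  -- corrected height. It lies in `W + W`, one term for the arc and one for the jump.
  let E : P → P → ℝ → Prop := fun p q u => ∃ τ ∈ Icc L (3 * L),
    Θ.Near ε' (Θ.skew φ τ (p, g p)) (q, u + g q)
  have hEW : ∀ p q u, E p q u → u ∈ (fun z : ℝ × ℝ => z.1 + z.2) '' (W ×ˢ W) := by
    rintro p q u ⟨τ, hτ, h⟩
    have h1 := hg _ _ (h.mono (min_le_right _ _))
    have h2 := hgφ (p, g p) τ ⟨hL.trans hτ.1, hτ.2⟩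
    refine ⟨(_, _), ⟨h1, h2⟩, ?_⟩
    simp
  have hΨ : ((fun z : ℝ × ℝ => z.1 + z.2) '' (W ×ˢ W)).Finite := (hW.prod hW).image _
  set Ψ := (fun z : ℝ × ℝ => z.1 + z.2) '' (W ×ˢ W)
  obtain ⟨B₀, hB₀⟩ := (hΨ.union hW).bddAbove
  obtain ⟨B₁, hB₁⟩ := hW.bddBelow
  set K := Fintype.card P
  choose F hF hFs using fun N => exists_finite_sums hΨ N
  have hclosed : ∀ (n : ℕ) (v : ℕ → P) (u : ℕ → ℝ), 0 < n →
      (∀ k < n, E (v k) (v (k + 1)) (u k)) → v n = v 0 → ∃ m τ w, IsClosedChain Θ φ ε L n m τ w ∧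
        ∑ k ∈ Finset.range n, u k = ∑ k ∈ Finset.range n, w k := by
    intro n v u hn hv hvn
    choose! τ hτ hnear using hv
    refine ⟨fun k => v k, τ, fun k => u k + (g (v (k + 1)) - g (v k)),
      ⟨hn, by simp [hvn], fun k hk => (hτ k hk).1, fun k hk => ?_⟩, ?_⟩
    · have := (hnear k hk).raise (-g (v k))
      rw [← PathCocycle.skew_raise] at this
      convert this.mono (min_le_left ε lam) using 1
      · simp [PathCocycle.raise]
      · refine Prod.ext rfl ?_
        simp only [PathCocycle.raise_snd]
        ring
    · rw [Finset.sum_add_distrib, Finset.sum_range_sub (fun k => g (v k)), hvn, sub_self, add_zero]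
  -- These are the weights of closed walks with at most `K` edges. Each is the sum of a closed
  -- chain, since the corrections by `g` telescope to zero.
  let S : Set ℝ := {x | ∃ (n : ℕ) (v : ℕ → P) (u : ℕ → ℝ), 0 < n ∧ n ≤ K ∧
    (∀ k < n, E (v k) (v (k + 1)) (u k)) ∧ v n = v 0 ∧ x = ∑ k ∈ Finset.range n, u k}
  have hSfin : S.Finite := by
    refine ((Finset.range (K + 1)).finite_toSet.biUnion fun N _ => hF N).subset ?_
    rintro x ⟨n, v, u, hn, hnK, hv, hvn, rfl⟩
    refine mem_biUnion (x := n) (by simpa using Nat.lt_succ_of_le hnK) ?_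
    have := hFs n (fun k => ∑ i ∈ Finset.range k, u i) fun k hk => by
      simpa [Finset.sum_range_succ] using hEW _ _ _ (hv k hk)
    simpa using this
  obtain ⟨s, hs0, hspos, hs⟩ := exists_le_neg_of_finite hSfin (by
    rintro x ⟨n, v, u, hn, hnK, hv, hvn, rfl⟩
    obtain ⟨m, τ, w, hc, he⟩ := hclosed n v u hn hv hvn
    rw [he]
    exact hcl _ _ _ _ hc)
  -- The walk bound gives `K * max B₀ 0 + s`. Replacing the two end points of the chain by net
  -- points costs `B₀ - B₁`.
  refine ⟨ε' / 3, by positivity, K * max B₀ 0 + s + B₀ - B₁, s / K, fun hneg => ?_, by positivity,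
    fun n X τ hτ hX => ?_⟩
  · have hK : 0 < (K : ℝ) := by
      exact_mod_cast Fintype.card_pos_iff.2 ⟨(hcenter (Classical.arbitrary M)).choose⟩
    refine div_pos (hspos ?_) hK
    rintro x ⟨n, v, u, hn, hnK, hv, hvn, rfl⟩
    obtain ⟨m, τ, w, hc, he⟩ := hclosed n v u hn hv hvn
    rw [he]
    exact hneg _ _ _ _ hc
  · choose p z hpz using fun k => hcell (X k)
    have hwalk := walk_sum_le (E := E) (le_max_right B₀ 0) hs0
      (fun a b u hu => (hB₀ (Or.inl (hEW a b u hu))).trans (le_max_left _ _))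
      (fun n v u hn hnK hv hvn => hs _ ⟨n, v, u, hn, hnK, hv, hvn, rfl⟩) n p
      (fun k => z (k + 1) - g (p (k + 1)) - (z k - g (p k))) fun k hk => by
        refine ⟨τ k, hτ k hk, ?_⟩
        -- Three errors of at most `ε' / 3` add up: from the net point to `X k` carried along the
        -- arc, the jump of the chain, and from `X (k + 1)` to its net point.
        have h1 := (hpz k).symm.mono (show 2 * η' ≤ δ by linarith [min_le_left (δ / 2) (ε' / 3)])
        have h2 := hflow _ _ h1 (τ k) ⟨hL.trans (hτ k hk).1, (hτ k hk).2⟩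
        have h3 := ((h2.trans (hX k hk)).trans (hpz (k + 1))).mono
          (show ε' / 3 + ε' / 3 + η' ≤ ε' by linarith [min_le_right (δ / 2) (ε' / 3)])
        have h4 := h3.raise (g (p k) - z k)
        rw [← PathCocycle.skew_raise] at h4
        convert h4 using 1
        · simp [PathCocycle.raise]
        · refine Prod.ext rfl ?_
          simp only [PathCocycle.raise_snd]
          ring
    rw [Finset.sum_range_sub (fun k => z k - g (p k))] at hwalk
    have hle : η' ≤ lam := by
      linarith [min_le_right (δ / 2) (ε' / 3), min_le_right ε lam]
    have h0 := hB₀ (Or.inr (hg _ _ ((hpz 0).mono hle)))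
    have h1 := hB₁ (hg _ _ ((hpz n).mono hle))
    simp only at h0 h1
    linarith

end Drift

/-! ### Moving closed chains, and the recurrent set -/

section Recurrence

variable {M : Type u} [MetricSpace M]

/-- A step of a chain: an orbit arc of length at least `T` followed by an `ε`-small jump. -/
def PathCocycle.Step {A : Type*} [AddCommGroup A] (Θ : PathCocycle M A) (φ : Flow ℝ M) (ε T : ℝ)
    (X Y : M × A) : Prop :=
  ∃ τ ≥ T, Θ.Near ε (Θ.skew φ τ X) Y

variable {A : Type*} [AddCommGroup A] {Θ : PathCocycle M A} {φ : Flow ℝ M} {ε T : ℝ}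

lemma IsClosedChain.transGen {n : ℕ} {m : ℕ → M} {τ : ℕ → ℝ} {w : ℕ → A}
    (h : IsClosedChain Θ φ ε T n m τ w) :
    Relation.TransGen (Θ.Step φ ε T) (m 0, 0) (m 0, ∑ k ∈ Finset.range n, w k) := by
  have hstep : ∀ k < n, Θ.Step φ ε T (m k, ∑ i ∈ Finset.range k, w i)
      (m (k + 1), ∑ i ∈ Finset.range (k + 1), w i) := fun k hk => by
    refine ⟨τ k, h.le k hk, ?_⟩
    have := (h.near k hk).raise (∑ i ∈ Finset.range k, w i)
    rw [← PathCocycle.skew_raise] at this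
    simpa [PathCocycle.raise, Finset.sum_range_succ, add_comm] using this
  have key : ∀ k, k < n → Relation.TransGen (Θ.Step φ ε T) (m 0, 0)
      (m (k + 1), ∑ i ∈ Finset.range (k + 1), w i) := by
    intro k
    induction k with
    | zero => exact fun hk => .single (by simpa using hstep 0 hk)
    | succ k ih => exact fun hk => (ih (by omega)).tail (hstep _ hk)
  obtain ⟨k, rfl⟩ := Nat.exists_eq_succ_of_ne_zero h.pos.ne'
  simpa [h.closed] using key k (Nat.lt_succ_self k)

/-- Step sequences in `M × A` can be recombined without indices; this converts the result back into
a closed chain. -/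
lemma exists_isClosedChain_of_transGen {x : M} {S : A}
    (h : Relation.TransGen (Θ.Step φ ε T) (x, 0) (x, S)) : ∃ n m τ w,
      IsClosedChain Θ φ ε T n m τ w ∧ m 0 = x ∧ ∑ k ∈ Finset.range n, w k = S := by
  have key : ∀ X Y : M × A, Relation.TransGen (Θ.Step φ ε T) X Y → ∃ n, 0 < n ∧
      ∃ Z : ℕ → M × A, Z 0 = X ∧ Z n = Y ∧ ∀ k < n, Θ.Step φ ε T (Z k) (Z (k + 1)) := by
    intro X Y h
    induction h with
    | @single Y h =>
      refine ⟨1, one_pos, fun k => if k = 0 then X else Y, rfl, rfl, fun k hk => ?_⟩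
      obtain rfl : k = 0 := by omega
      simpa using h
    | @tail Y Y' _ h ih =>
      obtain ⟨n, hn, Z, h0, h1, hZ⟩ := ih
      refine ⟨n + 1, by omega, fun k => if k ≤ n then Z k else Y', by simp [h0], by simp,
        fun k hk => ?_⟩
      rcases (Nat.lt_succ_iff.1 hk).eq_or_lt with rfl | hk'
      · simpa [h1] using h
      · simpa [hk'.le, Nat.succ_le_of_lt hk'] using hZ k hk'
  obtain ⟨n, hn, Z, h0, h1, hZ⟩ := key _ _ h
  choose! τ hτ hnear using hZ
  refine ⟨n, fun k => (Z k).1, τ, fun k => (Z (k + 1)).2 - (Z k).2,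
    ⟨hn, by simp [h0, h1], hτ, fun k hk => ?_⟩, by simp [h0], ?_⟩
  · have := (hnear k hk).raise (-(Z k).2)
    rw [← PathCocycle.skew_raise] at this
    simpa [PathCocycle.raise, sub_eq_add_neg] using this
  · rw [Finset.sum_range_sub (fun k => (Z k).2)]
    simp [h0, h1]

/-- A closed chain through a point near `x` can be moved to a closed chain through `x`. -/
lemma LocallyContracts.exists_transGen [CompactSpace M] (hM : LocallyContracts M)
    (Θ : PathCocycle M A) (φ : Flow ℝ M) (hε : 0 < ε) (hT : 0 ≤ T) :
    ∃ ρ > 0, ∀ x y : M, dist y x < ρ → ∀ S : A,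
      Relation.TransGen (Θ.Step φ ρ (2 * T)) (y, 0) (y, S) →
        Relation.TransGen (Θ.Step φ ε T) (x, 0) (x, S) := by
  obtain ⟨δ, hδ, hflow⟩ := Θ.exists_near_flow φ hε T
  set η := min (δ / 2) (ε / 2)
  have hη : 0 < η := by positivity
  obtain ⟨ρ, hρ, hpath⟩ := hM.exists_path hη
  refine ⟨min ρ (ε / 2), by positivity, fun x y hxy S h => ?_⟩
  obtain ⟨c, hc0, hc1, hc⟩ := hpath y x (hxy.trans_le (min_le_left _ _))
  have hnear : ∀ S : A, Θ.Near η (y, S + -Θ c) (x, S) := fun S => ⟨c, hc0, hc1, hc, by simp⟩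
  have hdrop : Relation.TransGen (Θ.Step φ (ε / 2) (2 * T)) (y, -Θ c) (y, S + -Θ c) := by
    have := Relation.TransGen.lift (p := Θ.Step φ (ε / 2) (2 * T)) (PathCocycle.raise (-Θ c))
      (by
        rintro X Y ⟨τ, hτ, h⟩
        refine ⟨τ, hτ, ?_⟩
        rw [PathCocycle.skew_raise]
        exact (h.mono (min_le_right _ _)).raise _) _ _ h
    simpa [Function.onFun, PathCocycle.raise] using this
  have hlast : Relation.TransGen (Θ.Step φ ε (2 * T)) (y, -Θ c) (x, S) := by
    obtain ⟨b, hb, τ, hτ, hbY⟩ := Relation.TransGen.tail'_iff.1 hdrop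
    refine Relation.TransGen.tail' (Relation.ReflTransGen.mono ?_ _ _ hb) ⟨τ, hτ,
      (hbY.trans (hnear S)).mono (by linarith [min_le_right (δ / 2) (ε / 2)])⟩
    rintro X Y ⟨τ, hτ, h⟩
    exact ⟨τ, hτ, h.mono (by linarith)⟩
  obtain ⟨b, ⟨τ, hτ, hb⟩, hbY⟩ := Relation.TransGen.head'_iff.1 hlast
  -- The first arc, of length at least `2 * T`, is split at time `T`: the new chain follows the
  -- orbit of `x` for time `T`, jumps to the nearby orbit of `y`, and still has an arc of length at
  -- least `T` left. The last jump is prolonged along `c` to end at `x`, which restores the height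
  -- offset `-Θ c`.
  have hfirst : Θ.Step φ ε T (x, 0) (Θ.skew φ T (y, -Θ c)) := by
    have h0 := hnear 0
    rw [zero_add] at h0
    exact ⟨T, le_rfl, hflow _ _ (h0.symm.mono (by linarith [min_le_left (δ / 2) (ε / 2)])) T
      ⟨hT, le_rfl⟩⟩
  refine (Relation.TransGen.single hfirst).trans (Relation.TransGen.head' (b := b) ?_
    (Relation.ReflTransGen.mono ?_ _ _ hbY))
  · refine ⟨τ - T, by linarith, ?_⟩
    rwa [← PathCocycle.skew_add, add_sub_cancel]
  · rintro X Y ⟨τ, hτ, h⟩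
    exact ⟨τ, by linarith, h⟩

section Mono

variable {l ε' : ℝ} {γ : ℝ → M}

lemma IsPeriodicPseudoOrbit.mono (h : IsPeriodicPseudoOrbit φ ε T l γ) (hε : ε ≤ ε') :
    IsPeriodicPseudoOrbit φ ε' T l γ := by
  obtain ⟨h1, h2, h3, Δ, h4, h5, h6, h7, h8, h9⟩ := h
  refine ⟨h1, h2, h3, Δ, h4, h5, h6, h7, h8, fun t ht => ?_⟩
  obtain ⟨y, hy, hd⟩ := h9 t ht
  exact ⟨y, hy, hd.trans_le hε⟩

lemma IsClassOf.mono {h : H1 M} (hh : IsClassOf ε l γ h) (hε : ε ≤ ε') : IsClassOf ε' l γ h := by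
  obtain ⟨δ, ⟨h1, σ, h2, h3, h4, h5, h6⟩, h7⟩ := hh
  exact ⟨δ, ⟨h1, σ, h2, h3, h4, h5, fun s => ⟨(h6 s).1, fun hs =>
    Metric.ball_subset_ball hε ((h6 s).2 hs)⟩⟩, h7⟩

end Mono

/-- If the `α`-recurrent set is empty, `α` does not vanish on closed chains with small jumps and
long arcs. -/
lemma LocallyContracts.exists_sum_ne_zero [CompactSpace M] (hM : LocallyContracts M) {α : CohomH1 M}
    (φ : Flow ℝ M) (T₀ : ℝ) (hR : alphaRecurrentSet φ α = ∅) : ∃ ε > 0, ∃ T ≥ T₀,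
      ∀ (n : ℕ) (m : ℕ → M) (τ w : ℕ → ℝ), IsClosedChain (cohomCocycle α) φ ε T n m τ w →
        ∑ k ∈ Finset.range n, w k ≠ 0 := by
  by_contra! hcon
  have hchain : ∀ N : ℕ, ∃ y : M, Relation.TransGen
      ((cohomCocycle α).Step φ (1 / (N + 1)) (max T₀ N)) (y, 0) (y, 0) := fun N => by
    obtain ⟨n, m, τ, w, hc, hw⟩ := hcon (1 / (N + 1)) (by positivity) (max T₀ N) (le_max_left _ _)
    have := hc.transGen
    rw [hw] at this
    exact ⟨_, this⟩
  choose y hy using hchain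
  -- Base points of zero-sum chains with jumps tending to zero and arcs tending to infinity
  -- accumulate at `x`, to which these chains can be moved.
  obtain ⟨x, -, f, hf, hlim⟩ := isCompact_univ.tendsto_subseq (x := y) fun _ => mem_univ _
  obtain ⟨ρ, hρ, hreal⟩ := hM.exists_periodicPseudoOrbit φ α
  have hx : x ∈ alphaRecurrentSet φ α := by
    intro ε hε T hT
    have hε' : 0 < min ε ρ := by positivity
    obtain ⟨ρ', hρ', hmove⟩ := hM.exists_transGen (cohomCocycle α) φ hε' hT.le
    have h1 : ∀ᶠ N in atTop, dist (y (f N)) x < ρ' :=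
      hlim.eventually (Metric.ball_mem_nhds x hρ')
    have h2 : ∀ᶠ N in atTop, 1 / ((f N : ℝ) + 1) < ρ' :=
      (tendsto_one_div_add_atTop_nhds_zero_nat.comp hf.tendsto_atTop).eventually_lt_const hρ'
    have h3 : ∀ᶠ N in atTop, 2 * T ≤ (f N : ℝ) :=
      (tendsto_natCast_atTop_atTop.comp hf.tendsto_atTop).eventually_ge_atTop _
    obtain ⟨N, h1, h2, h3⟩ := (h1.and (h2.and h3)).exists
    have h4 := hmove x (y (f N)) h1 0 (Relation.TransGen.mono
      (fun X Y ⟨τ, hτ, h⟩ => ⟨τ, h3.trans ((le_max_right _ _).trans hτ), h.mono h2.le⟩) _ _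
      (hy (f N)))
    obtain ⟨n, m, τ, w, hc, hm, hw⟩ := exists_isClosedChain_of_transGen h4
    obtain ⟨l, γ, h, hγ, hγ0, hh, hα⟩ := hreal _ (min_le_right ε ρ) T hT n m τ w hc
    exact ⟨l, γ, h, hγ.mono (min_le_left _ _), ⟨0, hγ0.trans hm⟩, hh.mono (min_le_left _ _),
      hα.trans hw⟩
  rw [hR] at hx
  exact hx

end Recurrence

/-! ### Grouping short steps into long arcs -/

section Steps

/-- A version of `LocallyContracts.exists_drift` for chains of short arcs. -/
lemma LocallyContracts.exists_drift_of_steps {M : Type*} [MetricSpace M] [CompactSpace M]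
    [Nonempty M] (hM : LocallyContracts M) (Θ : PathCocycle M ℝ) (φ : Flow ℝ M)
    {T L ε lam : ℝ} (hε : 0 < ε) (hlam : 0 < lam) (hL : 0 ≤ L) {m : ℕ}
    (hm : 4 * L ≤ m * T) (hm' : m * T ≤ 6 * L) (hT : 0 < T) {g : M → ℝ} {W : Set ℝ} (hW : W.Finite)
    (hg : ∀ X Y : M × ℝ, Θ.Near lam X Y → Y.2 - g Y.1 - (X.2 - g X.1) ∈ W)
    (hgφ : ∀ X : M × ℝ, ∀ t ∈ Icc 0 (3 * L),
      (Θ.skew φ t X).2 - g (Θ.skew φ t X).1 - (X.2 - g X.1) ∈ W)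
    (hcl : ∀ (n : ℕ) (m : ℕ → M) (τ w : ℕ → ℝ), IsClosedChain Θ φ ε L n m τ w →
      ∑ k ∈ Finset.range n, w k ≤ 0) :
    ∃ η > 0, ∃ B c : ℝ, ((∀ (n : ℕ) (m : ℕ → M) (τ w : ℕ → ℝ),
        IsClosedChain Θ φ ε L n m τ w → ∑ k ∈ Finset.range n, w k < 0) → 0 < c) ∧
      0 ≤ c ∧ ∀ (n : ℕ) (X : ℕ → M × ℝ), ∀ h ∈ Icc (T / 4) (T / 2),
        (∀ k < m * n, Θ.Near η (Θ.skew φ h (X k)) (X (k + 1))) →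
        (X (m * n)).2 - g (X (m * n)).1 - ((X 0).2 - g (X 0).1) ≤ B - c * n := by
  obtain ⟨η, hη, B, c, hc, hc0, hdrift⟩ := hM.exists_drift Θ φ hε hlam hL hW hg hgφ hcl
  obtain ⟨δ, hδ, hiter⟩ := Θ.exists_near_iterate φ hη (T / 2) m
  refine ⟨δ, hδ, B, c, hc, hc0, fun n X h hh hX => ?_⟩
  -- With `h` between `T / 4` and `T / 2`, the bounds on `m * T` put the length `m * h` of a group
  -- between `L` and `3 * L`.
  refine hdrift n (fun k => X (m * k)) (fun _ => m * h) (fun k _ => ⟨?_, ?_⟩) fun k hk => ?_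
  · have : m * (T / 4) ≤ m * h := by gcongr; exact hh.1
    linarith
  · have : m * h ≤ m * (T / 2) := by gcongr; exact hh.2
    linarith
  · refine hiter (fun j => X (m * k + j)) h ⟨by linarith [hh.1], hh.2⟩ fun j hj => hX _ ?_
    calc m * k + j < m * (k + 1) := by rw [mul_add]; omega
      _ ≤ m * n := Nat.mul_le_mul_left _ hk

end Steps

/-! ### Normalized classes of periodic pseudo-orbits -/

section Directions

variable {M : Type u} [MetricSpace M] [CompactSpace M]

/-- The normalized classes of periodic pseudo-orbits with small jumps stay in a compact set. -/
lemma LocallyContracts.exists_isCompact (hM : LocallyContracts M) (φ : Flow ℝ M) {T : ℝ}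
    (hT : 0 < T) : ∃ ε > 0, ∃ K : Set (H1 M), @IsCompact (H1 M) (moduleTopology ℝ (H1 M)) K ∧
      ∀ (l : ℝ) (γ : ℝ → M) (h : H1 M), IsPeriodicPseudoOrbit φ ε T l γ → IsClassOf ε l γ h →
        l⁻¹ • h ∈ K := by
  let : TopologicalSpace (H1 M) := moduleTopology ℝ (H1 M)
  have : IsModuleTopology ℝ (H1 M) := ⟨rfl⟩
  have : ContinuousSMul ℝ (H1 M) := IsModuleTopology.toContinuousSMul ℝ (H1 M)
  have : IsTopologicalAddGroup (H1 M) := IsModuleTopology.topologicalAddGroup ℝ (H1 M)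
  obtain ⟨g, W, hW, lam, hlam, hg, hgφ⟩ := hM.exists_height (homCocycle M) φ T
  obtain ⟨ε, hε, hchain⟩ := exists_chain_of_realization (homCocycle M) φ T hlam
  let Ψ : Set (H1 M) := (fun z : H1 M × H1 M => z.1 + z.2) '' (W ×ˢ W)
  have hΨ : Ψ.Finite := (hW.prod hW).image _
  -- Since `n * a = k * l`, the normalized class is `a⁻¹` times the average of `n` increments from
  -- the finite set `Ψ`, with `a⁻¹ ≤ 4 / T`. This gives compactness without using that `H1 M` is
  -- finite-dimensional.
  refine ⟨ε, hε, (fun p : ℝ × H1 M => p.1 • p.2) '' (Icc 0 (4 / T) ×ˢ convexHull ℝ Ψ),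
    (isCompact_Icc.prod (hΨ.isCompact_convexHull ℝ)).image continuous_smul, ?_⟩
  rintro l γ h hγ ⟨δ, hδ, hh⟩
  have hl : 0 < l := hγ.1
  obtain ⟨a, k, n, ha, ha', hk, hn, hank⟩ := exists_sampling hl hT
  have ha0 : 0 < a := by linarith
  obtain ⟨Y, hY, hYn⟩ := hchain l γ δ hγ hδ a k n ha0 (by linarith) hn hank
  rw [homCocycle_eq hh] at hYn
  have hn' : (0 : ℝ) < n := by exact_mod_cast hn
  have hk' : (0 : ℝ) < k := by exact_mod_cast hk
  let D : ℕ → H1 M := fun i => (Y i).2 - g (Y i).1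
  have hsum : ∑ i ∈ Finset.range n, (D (i + 1) - D i) = (k : ℝ) • h := by
    have := hYn 0
    rw [zero_add] at this
    rw [Finset.sum_range_sub]
    simp only [D, this, PathCocycle.raise_snd, PathCocycle.raise_fst, Nat.cast_smul_eq_nsmul]
    abel
  refine ⟨(a⁻¹, ∑ i ∈ Finset.range n, (n : ℝ)⁻¹ • (D (i + 1) - D i)), ⟨⟨by positivity, ?_⟩, ?_⟩, ?_⟩
  · rw [inv_le_comm₀ ha0 (by positivity), inv_div]
    exact ha
  · have hD : ∀ i, D (i + 1) - D i ∈ Ψ := fun i =>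
      ⟨(_, _), ⟨hg _ _ (hY i), hgφ (Y i) a ⟨ha0.le, by linarith⟩⟩, by simp [D]⟩
    have hn0 : (0 : ℝ) ≤ (n : ℝ)⁻¹ := by positivity
    exact (convex_convexHull ℝ Ψ).sum_mem (t := Finset.range n) (w := fun _ => (n : ℝ)⁻¹) (fun _ _ => hn0)
      (by simp [hn'.ne']) fun i _ => subset_convexHull ℝ Ψ (hD i)
  · show a⁻¹ • _ = l⁻¹ • h
    rw [← Finset.smul_sum, hsum, smul_smul, smul_smul]
    congr 1
    field_simp
    linarith

/-- If `α` is negative on `D_φ`, it is negative on the classes of all periodic pseudo-orbits with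
small jumps. -/
lemma LocallyContracts.exists_forall_neg (hM : LocallyContracts M) {φ : Flow ℝ M} {T : ℝ}
    (hT : 0 < T) {α : CohomH1 M} (hα : ∀ v ∈ asympPseudoDirections φ T, α v < 0) :
    ∃ ε > 0, ∀ (l : ℝ) (γ : ℝ → M) (h : H1 M), IsPeriodicPseudoOrbit φ ε T l γ →
      IsClassOf ε l γ h → α h < 0 := by
  let : TopologicalSpace (H1 M) := moduleTopology ℝ (H1 M)
  have : IsModuleTopology ℝ (H1 M) := ⟨rfl⟩
  have hcont : Continuous α := IsModuleTopology.continuous_of_linearMap α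
  obtain ⟨ε₀, hε₀, K, hK, hgen⟩ := hM.exists_isCompact φ hT
  by_contra! hcon
  have hseq : ∀ N : ℕ, 0 < min ε₀ (1 / ((N : ℝ) + 1)) := fun N => by positivity
  choose l γ h hγ hh hαh using fun N => hcon _ (hseq N)
  -- A cluster point of classes with `α ≥ 0` and jumps tending to zero lies in every closure, hence
  -- in `D_φ`, yet satisfies `α v ≥ 0`.
  obtain ⟨v, -, hv⟩ := hK.exists_mapClusterPt (f := atTop) (u := fun N => (l N)⁻¹ • h N)
    (tendsto_principal.2 (.of_forall fun N =>
      hgen _ _ _ ((hγ N).mono (min_le_left _ _)) ((hh N).mono (min_le_left _ _))))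
  have hpos : 0 ≤ α v := (isClosed_Ici.preimage hcont).mem_of_mapClusterPt hv (.of_forall fun N => by
    have : 0 < l N := (hγ N).1
    simpa using mul_nonneg (inv_nonneg.2 this.le) (hαh N))
  refine hpos.not_gt (hα v (mem_iInter₂.2 fun ε hε => ?_))
  refine isClosed_closure.mem_of_mapClusterPt hv ?_
  filter_upwards [tendsto_one_div_add_atTop_nhds_zero_nat.eventually_lt_const hε] with N hN
  have hle : min ε₀ (1 / ((N : ℝ) + 1)) ≤ ε := (min_le_right _ _).trans hN.le
  exact subset_closure ⟨l N, γ N, h N, (hγ N).mono hle, (hh N).mono hle, rfl⟩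

/-- Classes of periodic pseudo-orbits decrease linearly with the length, if heights decrease along
closed chains. -/
lemma LocallyContracts.exists_forall_le [Nonempty M] (hM : LocallyContracts M) (φ : Flow ℝ M)
    {T : ℝ} (hT : 0 < T) (α : CohomH1 M) {ε L : ℝ} (hε : 0 < ε) (hL : T ≤ L)
    (hcl : ∀ (n : ℕ) (m : ℕ → M) (τ w : ℕ → ℝ), IsClosedChain (cohomCocycle α) φ ε L n m τ w →
      ∑ k ∈ Finset.range n, w k < 0) :
    ∃ ε' > 0, ∃ c > 0, ∀ (l : ℝ) (γ : ℝ → M) (h : H1 M), IsPeriodicPseudoOrbit φ ε' T l γ →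
      IsClassOf ε' l γ h → α (l⁻¹ • h) ≤ -c := by
  obtain ⟨g, W, hW, lam, hlam, hg, hgφ⟩ := hM.exists_height (cohomCocycle α) φ (3 * L)
  set m := ⌈4 * L / T⌉₊
  have hm : 4 * L ≤ m * T := (div_le_iff₀ hT).1 (Nat.le_ceil _)
  have hm' : m * T ≤ 6 * L := by
    have := Nat.ceil_lt_add_one (show 0 ≤ 4 * L / T from div_nonneg (by linarith) hT.le)
    have h2 : m * T < (4 * L / T + 1) * T := by gcongr
    rw [add_mul, div_mul_cancel₀ _ hT.ne'] at h2
    linarith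
  have hm0 : (0 : ℝ) < m := by
    have : 0 < m * T := by linarith
    exact pos_of_mul_pos_left this hT.le
  obtain ⟨η, hη, B, c, hc, -, hdrift⟩ := hM.exists_drift_of_steps (cohomCocycle α) φ hε hlam
    (hT.le.trans hL) hm hm' hT hW hg hgφ fun n p τ w h => (hcl n p τ w h).le
  have hc := hc hcl
  obtain ⟨ε', hε', hchain⟩ := exists_chain_of_realization (cohomCocycle α) φ T hη
  refine ⟨ε', hε', 2 * c / (m * T), by positivity, ?_⟩
  rintro l γ h hγ ⟨δ, hδ, hh⟩
  have hl : 0 < l := hγ.1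
  obtain ⟨a, k, n, ha, ha', hk, hn, hank⟩ := exists_sampling hl hT
  have ha0 : 0 < a := by linarith
  obtain ⟨Y, hY, hYn⟩ := hchain l γ δ hγ hδ a k n ha0 (by linarith) hn hank
  have hαδ : (cohomCocycle α).toFun δ = α h := by
    rw [← homCocycle_eq hh]
    rfl
  rw [hαδ] at hYn
  have hn' : (0 : ℝ) < n := by exact_mod_cast hn
  have hk' : (0 : ℝ) < k := by exact_mod_cast hk
  have hYj : ∀ j : ℕ, Y (j * n) = PathCocycle.raise (j * (k * α h)) (Y 0) := by
    intro j
    induction j with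
    | zero => simp
    | succ j ih =>
      rw [add_mul, one_mul, hYn, ih, PathCocycle.raise_raise]
      congr 1
      push_cast
      simp only [nsmul_eq_mul]
      ring
  -- Running the periodic chain for `m * (j * n)` steps gives height gain `m * j * k * α h` against
  -- a drift of `c * (j * n)`. Letting `j` grow removes the constant `B`.
  have hbound : ∀ j : ℕ, j * (m * (k * α h) + c * n) ≤ B := by
    intro j
    have := hdrift (j * n) Y a ⟨ha, ha'⟩ fun i _ => hY i
    rw [← mul_assoc, hYj] at this
    simp only [PathCocycle.raise_fst, PathCocycle.raise_snd] at this
    push_cast at this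
    linarith
  have hle : m * (k * α h) + c * n ≤ 0 := by
    by_contra! hpos
    obtain ⟨j, hj⟩ := exists_nat_gt (B / (m * (k * α h) + c * n))
    rw [div_lt_iff₀ hpos] at hj
    linarith [hbound j]
  have hna : n = k * l / a := by rw [← hank, mul_div_cancel_right₀ _ ha0.ne']
  have hle' : m * (k * α h) ≤ -(c * (k * l / a)) := by rw [← hna]; linarith
  have h1 : m * α h ≤ -(c * (l / a)) := by
    refine le_of_mul_le_mul_left ?_ hk'
    calc k * (m * α h) = m * (k * α h) := by ring
      _ ≤ -(c * (k * l / a)) := hle'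
      _ = k * -(c * (l / a)) := by ring
  have h2 : 2 / T ≤ 1 / a := by
    rw [div_le_div_iff₀ hT ha0]
    linarith
  rw [map_smul, smul_eq_mul]
  have h3 : m * (l⁻¹ * α h) ≤ -(c * (1 / a)) := by
    calc m * (l⁻¹ * α h) = l⁻¹ * (m * α h) := by ring
      _ ≤ l⁻¹ * -(c * (l / a)) := by gcongr
      _ = -(c * (1 / a)) := by field_simp
  refine le_of_mul_le_mul_left ?_ hm0
  calc m * (l⁻¹ * α h) ≤ -(c * (1 / a)) := h3
    _ ≤ -(c * (2 / T)) := by gcongr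
    _ = m * -(2 * c / (m * T)) := by field_simp

end Directions

/-! ### Heights bounded above along pseudo-orbits of the covering -/

section QuasiLyapunov

variable {M : Type u} [MetricSpace M] [CompactSpace M] [ConnectedSpace M] {α : CohomH1 M} {x₀ : M}
  {d : MetricSpace (Cover α x₀)}

/-- If heights do not increase along closed chains, then `α` is quasi-Lyapunov. -/
lemma isQuasiLyapunov_of_sum_nonpos (hM : LocallyContracts M) (hd : IsLiftedMetric d)
    {φ : Flow ℝ M} {T ε : ℝ} (hT : 0 < T) (hε : 0 < ε)
    (hcl : ∀ (n : ℕ) (m : ℕ → M) (τ w : ℕ → ℝ), IsClosedChain (cohomCocycle α) φ ε T n m τ w →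
      ∑ k ∈ Finset.range n, w k ≤ 0) : IsQuasiLyapunov φ T α x₀ d := by
  intro f hf hfe
  obtain ⟨g, W, hW, lam, hlam, hg, hgφ⟩ := hM.exists_height (cohomCocycle α) φ (3 * T)
  obtain ⟨η, hη, B, c, -, hc, hdrift⟩ := hM.exists_drift_of_steps (m := 4) (cohomCocycle α) φ hε
    hlam hT.le (by norm_num) (by norm_num; linarith) hT hW hg hgφ hcl
  obtain ⟨δ, hδ, hiter⟩ := (cohomCocycle α).exists_near_iterate φ hlam (T / 2) 4
  obtain ⟨ε', hε', hnear⟩ := exists_near_of_isPseudoOrbit hd hM φ T (lt_min hη hδ)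
  obtain ⟨C, hC⟩ := Cover.exists_bound hd hM hf hfe hW hlam hg
  obtain ⟨b, hb⟩ := hW.bddAbove
  refine ⟨max 0 (2 * C + max B (2 * b)), le_max_left _ _, ε', hε', fun l γ hγ t ht => ?_⟩
  have hX : ∀ N : ℕ, 0 < N → t / (4 * N) ≤ T / 2 → ∀ k < 4 * N,
      (cohomCocycle α).Near (min η δ) ((cohomCocycle α).skew φ (t / (4 * N))
        (γ (k * (t / (4 * N)))).pt) (γ ((k + 1 : ℕ) * (t / (4 * N)))).pt := by
    intro N hN hle k hk
    have hN' : (0 : ℝ) < N := by exact_mod_cast hN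
    have h0 : 0 ≤ t / (4 * N) := div_nonneg ht.1 (by positivity)
    have h1 : ((k + 1 : ℕ) : ℝ) * (t / (4 * N)) ≤ t := by
      have : ((k + 1 : ℕ) : ℝ) ≤ 4 * N := by exact_mod_cast hk
      calc ((k + 1 : ℕ) : ℝ) * (t / (4 * N)) ≤ 4 * N * (t / (4 * N)) := by gcongr
        _ = t := by field_simp
    have h2 : ((k + 1 : ℕ) : ℝ) * (t / (4 * N)) - k * (t / (4 * N)) = t / (4 * N) := by
      push_cast
      ring
    have := hnear l γ hγ (k * (t / (4 * N))) ((k + 1 : ℕ) * (t / (4 * N))) (by positivity)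
      (by linarith) (h1.trans_lt ht.2) (by linarith)
    rwa [h2] at this
  have key : (γ t).height - g (γ t).proj - ((γ 0).height - g (γ 0).proj) ≤ max B (2 * b) := by
    -- For `t ≥ 2 * T` the interval divides into `4 * N` steps of length between `T / 4` and `T /
    -- 2`, so the drift bound applies. Shorter times make one nearly exact arc, whose height gain is
    -- a sum of two elements of `W`.
    rcases le_or_gt (2 * T) t with h2T | h2T
    · set N := ⌈t / (2 * T)⌉₊
      have hN : 0 < N := Nat.ceil_pos.2 (div_pos (by linarith) (by linarith))
      have hN' : (0 : ℝ) < N := by exact_mod_cast hN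
      have h1 : t ≤ N * (2 * T) := (div_le_iff₀ (by positivity)).1 (Nat.le_ceil _)
      have h2 : N * (2 * T) < t + 2 * T := by
        have := Nat.ceil_lt_add_one (show 0 ≤ t / (2 * T) from div_nonneg ht.1 (by linarith))
        have h3 : N * (2 * T) < (t / (2 * T) + 1) * (2 * T) := by gcongr
        rwa [add_mul, div_mul_cancel₀ _ (by positivity), one_mul] at h3
      have h3 : t / (4 * N) ≤ T / 2 := by
        rw [div_le_div_iff₀ (by positivity) (by positivity)]
        linarith
      have h4 : T / 4 ≤ t / (4 * N) := by
        rw [div_le_div_iff₀ (by positivity) (by positivity)]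
        linarith
      have := hdrift N (fun k => (γ (k * (t / (4 * N)))).pt) _ ⟨h4, h3⟩ fun k hk =>
        (hX N hN h3 k hk).mono (min_le_left _ _)
      have h5 : ((4 * N : ℕ) : ℝ) * (t / (4 * N)) = t := by
        push_cast
        field_simp
      simp only [h5, Nat.cast_zero, zero_mul, Cover.pt_fst, Cover.pt_snd] at this
      exact le_max_of_le_left (this.trans (by linarith [mul_nonneg hc hN'.le]))
    · have h3 : t / (4 * (1 : ℕ)) ≤ T / 2 := by
        push_cast
        linarith
      have h0 : 0 ≤ t := ht.1
      have := hiter (fun k => (γ (k * (t / (4 * (1 : ℕ))))).pt) _ ⟨by positivity, h3⟩ fun k hk =>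
        (hX 1 one_pos h3 k (by omega)).mono (min_le_right _ _)
      have h5 : ((4 : ℕ) : ℝ) * (t / (4 * (1 : ℕ))) = t := by
        push_cast
        ring
      simp only [h5, Nat.cast_zero, zero_mul] at this
      have h6 := hb (hg _ _ this)
      have h7 := hb (hgφ (γ 0).pt t ⟨h0, by linarith⟩)
      simp only [Cover.pt_fst, Cover.pt_snd] at h6 h7
      exact le_max_of_le_right (by linarith)
  have h1 := abs_le.1 (hC (γ t))
  have h2 := abs_le.1 (hC (γ 0))
  linarith [le_max_right 0 (2 * C + max B (2 * b)), h1.2, h2.1]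

end QuasiLyapunov

end AsympDir

end

/-! ### The equivalence -/

theorem proposition3 {M : Type u} [MetricSpace M] [CompactSpace M] [ConnectedSpace M]
    (hM : AsympDir.IsTopManifold M) (φ : Flow ℝ M) (T : ℝ) (hT : 0 < T)
    (α : AsympDir.CohomH1 M) (x₀ : M)
    (d : MetricSpace (AsympDir.Cover α x₀)) (hd : AsympDir.IsLiftedMetric d) :
    (∀ v ∈ AsympDir.asympPseudoDirections φ T, α v < 0) ↔
      AsympDir.IsQuasiLyapunov φ T α x₀ d ∧ AsympDir.alphaRecurrentSet φ α = ∅ := by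
  have hL := hM.locallyContracts
  constructor
  · intro hα
    obtain ⟨ε, hε, hneg⟩ := hL.exists_forall_neg hT hα
    obtain ⟨ρ, hρ, hreal⟩ := hL.exists_periodicPseudoOrbit φ α
    refine ⟨AsympDir.isQuasiLyapunov_of_sum_nonpos hL hd hT (lt_min hε hρ) fun n m τ w hc => ?_, ?_⟩
    · obtain ⟨l, γ, h, hγ, -, hh, hαh⟩ := hreal _ (min_le_right ε ρ) T hT n m τ w hc
      rw [← hαh]
      exact (hneg l γ h (hγ.mono (min_le_left _ _)) (hh.mono (min_le_left _ _))).le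
    · refine Set.eq_empty_of_forall_notMem fun x hx => ?_
      obtain ⟨l, γ, h, hγ, -, hh, hαh⟩ := hx ε hε T hT
      exact (hneg l γ h hγ hh).ne hαh
  · rintro ⟨hQ, hR⟩ v hv
    obtain ⟨f, hf, hfe⟩ := AsympDir.Cover.exists_continuous_isEquivariant α x₀ hL
    obtain ⟨C, -, hfQ⟩ := hQ f hf hfe
    obtain ⟨ρ, hρ, hnonpos⟩ := AsympDir.sum_nonpos_of_isQuasiLyapunovWith hL hd hT hfe hfQ
    -- The quasi-Lyapunov property gives nonpositive sums for arcs at least `T`, the empty recurrent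
    -- set gives nonzero sums only for arcs at least `L ≥ T`; together they give negative sums at
    -- scale `L`.
    obtain ⟨ε, hε, L, hTL, hne⟩ := hL.exists_sum_ne_zero φ T hR
    obtain ⟨ε', hε', c, hc, hle⟩ := hL.exists_forall_le φ hT α (lt_min hε hρ) hTL
      fun n m τ w h => lt_of_le_of_ne (hnonpos n m τ w (h.mono (min_le_right _ _) hTL))
        (hne n m τ w (h.mono (min_le_left _ _) le_rfl))
    let : TopologicalSpace (AsympDir.H1 M) := moduleTopology ℝ (AsympDir.H1 M)
    have : IsModuleTopology ℝ (AsympDir.H1 M) := ⟨rfl⟩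
    have hcont : Continuous α := IsModuleTopology.continuous_of_linearMap α
    have : v ∈ α ⁻¹' Set.Iic (-c) := closure_minimal (by
      rintro _ ⟨l, γ, h, hγ, hh, rfl⟩
      exact hle l γ h hγ hh) (isClosed_Iic.preimage hcont) (Set.mem_iInter₂.1 hv ε' hε')
    exact lt_of_le_of_lt this (neg_lt_zero.2 hc)
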